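/- Let $\Gamma$ be the $\mathbb Z^2$-periodic graph whose vertices are the translates $T(p)v_a$ ($p\in\mathbb Z^2$) of five vertices $v_1,\dots,v_5$ and whose edges are the $\mathbb Z^2$-translates of the eight edges $$v_1\sim T(1,0)v_3,\quad v_1\sim v_4,\quad v_1\sim v_5,\quad v_2\sim v_3,\quad v_2\sim T(0,1)v_4,\quad v_2\sim v_5,\quad v_3\sim v_4,\quad v_4\sim v_5 ,$$ so that the degrees are $(d_1,\dots,d_5)=(3,3,3,4,3)$. For $k=(k_1,k_2)\in\mathbb R^2$ let $L(k)=S^{-1}\Delta(k)S^{-1}$ with $$\Delta(k)=\begin{pmatrix}0&0&e^{ik_1}&1&1\\0&0&1&e^{ik_2}&1\\e^{-ik_1}&1&0&1&0\\1&e^{-ik_2}&1&0&1\\1&1&0&1&0\end{pmatrix},\qquad S=\operatorname{diag}(\sqrt3,\sqrt3,\sqrt3,2,\sqrt3).$$ Let $G$ be the metric graph obtained from $\Gamma$ by giving every edge length $1$. Let $H=-d^2/dx_e^2$ be the Kirchhoff Laplacian in $L^2(G)=\bigoplus_e L^2(e)$: its domain consists of all $f$ with $f\in H^2(e)$ for every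 edge $e$, $\sum_e\|f\|^2_{H^2(e)}<\infty$, $f$ continuous at each vertex, and vanishing sum of the outgoing derivatives at each vertex. Let $H(k)$ be the same differential expression on the functions in $H^2_{loc}(G)$ that satisfy the same vertex conditions and $f(T(p)x)=e^{ip\cdot k}f(x)$ for all $p\in\mathbb Z^2$, $x\in G$; its eigenvalues are the Bloch eigenvalues with quasimomentum $k$. Let $B=[-\pi,\pi]^2$, and let $X$ be the set of the points of $B$ both of whose coordinates are integer multiples of $\pi$. Then the following hold. 1. Let $k\in\mathbb R^2$ and $\omega\in\mathbb C$ with $\sin\omega\neq0$. Then $\omega^2$ is an eigenvalue of $H(k)$ if and only if $\cos\omega$ is an eigenvalue of $L(k)$. Moreover there is a linear isomorphism $\Phi$ from the eigenspace of $H(k)$ for $\omega^2$ onto the eigenspace of $L(k)$ for $\cos\omega$ such that, for every $\psi$ in the former, the function $\varphi(T(p)v_a)=e^{ip\cdot k}\,d_a^{-1/2}(\Phi\psi)_a$ on the vertices satisfies, on every edge $e=(v,u)$ with coordinate $x_e\in[0,1]$ measured from $v$, $$\psi_e(x_e)=\varphi(v)\cos\omega x_e+\frac{\varphi(u)-\cos\omega\,\varphi(v)}{\sin\omega}\,\sin\omega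 x_e ;$$ in particular $\varphi$ is the restriction of $\psi$ to the vertices. 2. For every $\omega\in\mathbb C$ with $\sin\omega\ne0$: $\omega^2\in\sigma(H)$ if and only if $\cos\omega$ is an eigenvalue of $L(k)$ for some $k\in B$. 3. $H$ has an isolated spectral band whose two edges are attained only strictly inside the Brillouin zone, and not at the points of $X$. That is, if $\lambda_0(k)\le\lambda_1(k)\le\cdots$ are the eigenvalues of $H(k)$ counted with multiplicity, then there are an index $n$ and real numbers $a<b$ and $\varepsilon>0$ such that: $\lambda_n(B)=[a,b]$; $\sigma(H)\cap[a-\varepsilon,b+\varepsilon]=[a,b]$; for every $k\in B$, the number $\lambda_n(k)$ is a simple eigenvalue of $H(k)$ and the only eigenvalue of $H(k)$ in $[a-\varepsilon,b+\varepsilon]$; and whenever $k\in B$ and $a$ or $b$ is an eigenvalue of $H(k)$, then $k$ lies in the interior of $B$ and $k\notin X$. -/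

import Mathlib

open MeasureTheory
open scoped ENNReal

namespace QuantumGraph

noncomputable section

/-! ## The periodic graph `Γ`

The vertices are the `ℤ²`-translates of five vertices `0, …, 4`, the edges the `ℤ²`-translates of
eight edges of unit length, each identified with `[0, 1]` by the orientation from `src` to `tgt`. -/

/-- The vertex `(p, a)` is the translate by `p ∈ ℤ²` of the vertex `a` of the fundamental domain. -/
abbrev Vertex : Type := (ℤ × ℤ) × Fin 5

/-- The edge `(p, i)` is the translate by `p ∈ ℤ²` of the edge `i` of the fundamental domain. -/
abbrev Edge : Type := (ℤ × ℤ) × Fin 8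

/-- The initial vertices of the eight edges of the fundamental domain. -/
def srcIdx : Fin 8 → Fin 5 := ![0, 0, 0, 1, 1, 1, 2, 3]

/-- The terminal vertices of the eight edges, up to translation. -/
def tgtIdx : Fin 8 → Fin 5 := ![2, 3, 4, 2, 3, 4, 3, 4]

/-- The cells that contain the terminal vertices of the eight edges. -/
def tgtCell : Fin 8 → ℤ × ℤ :=
  ![(1, 0), (0, 0), (0, 0), (0, 0), (0, 1), (0, 0), (0, 0), (0, 0)]

/-- Initial vertex of an edge (the point `0` of `[0, 1]`). -/
def src (e : Edge) : Vertex := (e.1, srcIdx e.2)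

/-- Terminal vertex of an edge (the point `1` of `[0, 1]`). -/
def tgt (e : Edge) : Vertex := (e.1 + tgtCell e.2, tgtIdx e.2)

/-- The finite set of edges that start at `v`. -/
def outEdges (v : Vertex) : Finset Edge :=
  (Finset.univ.filter fun i => srcIdx i = v.2).image fun i => (v.1, i)

/-- The finite set of edges that end at `v`. -/
def inEdges (v : Vertex) : Finset Edge :=
  (Finset.univ.filter fun i => tgtIdx i = v.2).image fun i => (v.1 - tgtCell i, i)

theorem mem_outEdges (v : Vertex) (e : Edge) : e ∈ outEdges v ↔ src e = v := by
  obtain ⟨p, i⟩ := e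
  obtain ⟨q, a⟩ := v
  simp only [outEdges, src, Finset.mem_image, Finset.mem_filter, Finset.mem_univ, true_and,
    Prod.mk.injEq]
  constructor
  · rintro ⟨j, hj, rfl, rfl⟩
    exact ⟨rfl, hj⟩
  · rintro ⟨rfl, h⟩
    exact ⟨i, h, rfl, rfl⟩

theorem mem_inEdges (v : Vertex) (e : Edge) : e ∈ inEdges v ↔ tgt e = v := by
  obtain ⟨p, i⟩ := e
  obtain ⟨q, a⟩ := v
  simp only [inEdges, tgt, Finset.mem_image, Finset.mem_filter, Finset.mem_univ, true_and,
    Prod.mk.injEq]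
  constructor
  · rintro ⟨j, hj, rfl, rfl⟩
    exact ⟨sub_add_cancel _ _, hj⟩
  · rintro ⟨rfl, h⟩
    exact ⟨i, h, add_sub_cancel_right _ _, rfl⟩

/-! ## The Floquet matrices -/

/-- The Floquet multiplier `exp (i p · k)`. -/
def phase (k : ℝ × ℝ) (p : ℤ × ℤ) : ℂ :=
  Complex.exp (Complex.I * ((p.1 : ℂ) * (k.1 : ℂ) + (p.2 : ℂ) * (k.2 : ℂ)))

open Complex in
/-- The matrix `Δ(k)` of the operator `f ↦ (v ↦ ∑_{u ∼ v} f u)` on functions on the vertices with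
`f (p + v) = exp (i p · k) f v`, see `adjacency_cyclicExtension`. -/
def DeltaMatrix (k : ℝ × ℝ) : Matrix (Fin 5) (Fin 5) ℂ :=
  !![0, 0, exp (I * k.1), 1, 1;
     0, 0, 1, exp (I * k.2), 1;
     exp (-(I * k.1)), 1, 0, 1, 0;
     1, exp (-(I * k.2)), 1, 0, 1;
     1, 1, 0, 1, 0]

/-- The degrees of the five vertices of the fundamental domain. -/
def deg : Fin 5 → ℕ := ![3, 3, 3, 4, 3]

theorem card_outEdges_add_card_inEdges (v : Vertex) :
    (outEdges v).card + (inEdges v).card = deg v.2 := by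
  obtain ⟨p, a⟩ := v
  rw [outEdges, inEdges, Finset.card_image_of_injective, Finset.card_image_of_injective]
  · fin_cases a <;> rfl
  · exact fun i j h => (Prod.mk.inj h).2
  · exact fun i j h => (Prod.mk.inj h).2

/-- The diagonal matrix `S` of the square roots of the degrees. -/
def sqrtDegMatrix : Matrix (Fin 5) (Fin 5) ℂ :=
  Matrix.diagonal fun a => ((Real.sqrt (deg a) : ℝ) : ℂ)

/-- The normalized Floquet matrix `L(k) = S⁻¹ Δ(k) S⁻¹`. -/
def LMatrix (k : ℝ × ℝ) : Matrix (Fin 5) (Fin 5) ℂ :=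
  sqrtDegMatrix⁻¹ * DeltaMatrix k * sqrtDegMatrix⁻¹

/-- The function `φ` on the vertices with `φ (p, a) = exp (i p · k) c a`. -/
def cyclicExtension (k : ℝ × ℝ) (c : Fin 5 → ℂ) (v : Vertex) : ℂ := phase k v.1 * c v.2

theorem phase_add (k : ℝ × ℝ) (p q : ℤ × ℤ) : phase k (p + q) = phase k p * phase k q := by
  rw [phase, phase, phase, ← Complex.exp_add]
  congr 1
  push_cast [Prod.fst_add, Prod.snd_add]
  ring

theorem adjacency_cyclicExtension (k : ℝ × ℝ) (c : Fin 5 → ℂ) (v : Vertex) :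
    ∑ e ∈ outEdges v, cyclicExtension k c (tgt e) + ∑ e ∈ inEdges v, cyclicExtension k c (src e)
      = cyclicExtension k ((DeltaMatrix k).mulVec c) v := by
  obtain ⟨p, a⟩ := v
  rw [outEdges, inEdges, Finset.sum_image, Finset.sum_image]
  · simp only [cyclicExtension, src, tgt, phase_add, sub_eq_add_neg]
    rw [Finset.sum_filter, Finset.sum_filter]
    fin_cases a <;>
      simp [Fin.sum_univ_succ, srcIdx, tgtIdx, tgtCell, DeltaMatrix, Matrix.mulVec, dotProduct,
        phase] <;> ring
  · exact fun i _ j _ h => (Prod.mk.inj h).2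
  · exact fun i _ j _ h => (Prod.mk.inj h).2

/-- The Brillouin zone `B = [-π, π]²`. -/
def brillouinZone : Set (ℝ × ℝ) := Set.Icc (-Real.pi) Real.pi ×ˢ Set.Icc (-Real.pi) Real.pi

/-- The set `X` of the points of `B` both coordinates of which are integer multiples of `π`. -/
def symmetryPoints : Set (ℝ × ℝ) :=
  {k | k ∈ brillouinZone ∧ ∃ m n : ℤ, k = (m * Real.pi, n * Real.pi)}

/-! ## The Kirchhoff Laplacian on the metric graph -/

/-- `L²(e)` for an edge `e`, identified with `[0, 1]`. -/
abbrev L2Edge : Type := Lp ℂ 2 (volume.restrict (Set.Icc (0 : ℝ) 1))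

/-- `L²_loc(G)`: a square-integrable function on each edge. -/
abbrev L2loc : Type := Edge → L2Edge

/-- The Hilbert space `L²(G) = ⨁_e L²(e)`. -/
abbrev L2G : Type := lp (fun _ : Edge => L2Edge) 2

/-- `f ∈ H²(0, 1)` with first derivative `d` and second derivative `s`; `u` is the continuously
differentiable representative of `f` on `[0, 1]`, and `v = u'` its absolutely continuous
derivative. -/
structure IsH2Rep (f d s : L2Edge) (u v : ℝ → ℂ) : Prop where
  val : ∀ᵐ x ∂(volume.restrict (Set.Icc (0 : ℝ) 1)), f x = u x
  der : ∀ᵐ x ∂(volume.restrict (Set.Icc (0 : ℝ) 1)), d x = v x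
  ftc_val : ∀ x ∈ Set.Icc (0 : ℝ) 1, u x = u 0 + ∫ t in (0 : ℝ)..x, d t
  ftc_der : ∀ x ∈ Set.Icc (0 : ℝ) 1, v x = v 0 + ∫ t in (0 : ℝ)..x, s t

/-- `f ∈ H²_loc(G)`, with edgewise derivatives `d = f'` and `s = f''`, is continuous at each vertex
(with values `φ`), and the outgoing derivatives at each vertex sum up to zero. -/
def IsKirchhoff (f d s : L2loc) : Prop :=
  ∃ (u v : Edge → ℝ → ℂ) (φ : Vertex → ℂ),
    (∀ e, IsH2Rep (f e) (d e) (s e) (u e) (v e)) ∧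
    (∀ e, u e 0 = φ (src e)) ∧
    (∀ e, u e 1 = φ (tgt e)) ∧
    (∀ w, ∑ e ∈ outEdges w, v e 0 + ∑ e ∈ inEdges w, -(v e 1) = 0)

theorem L2Edge.intervalIntegrable (f : L2Edge) {x : ℝ} (hx : x ∈ Set.Icc (0 : ℝ) 1) :
    IntervalIntegrable (fun t => f t) volume 0 x := by
  have h : Integrable (fun t => f t) (volume.restrict (Set.Icc (0 : ℝ) 1)) :=
    (Lp.memLp f).integrable (by norm_num)
  rw [intervalIntegrable_iff_integrableOn_Ioc_of_le hx.1]
  exact IntegrableOn.mono_set h fun t ht => ⟨ht.1.le, ht.2.trans hx.2⟩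

theorem L2Edge.integral_congr {f g : ℝ → ℂ}
    (h : ∀ᵐ t ∂(volume.restrict (Set.Icc (0 : ℝ) 1)), f t = g t) {x : ℝ}
    (hx : x ∈ Set.Icc (0 : ℝ) 1) : ∫ t in (0 : ℝ)..x, f t = ∫ t in (0 : ℝ)..x, g t := by
  rw [intervalIntegral.integral_of_le hx.1, intervalIntegral.integral_of_le hx.1]
  apply MeasureTheory.integral_congr_ae
  have hsub : Set.Ioc 0 x ⊆ Set.Icc (0 : ℝ) 1 := fun t ht => ⟨ht.1.le, ht.2.trans hx.2⟩
  exact ae_restrict_of_ae_restrict_of_subset hsub h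

theorem L2Edge.integral_add (f g : L2Edge) {x : ℝ} (hx : x ∈ Set.Icc (0 : ℝ) 1) :
    ∫ t in (0 : ℝ)..x, (f + g : L2Edge) t
      = (∫ t in (0 : ℝ)..x, f t) + ∫ t in (0 : ℝ)..x, g t := by
  rw [← intervalIntegral.integral_add (f.intervalIntegrable hx) (g.intervalIntegrable hx)]
  exact L2Edge.integral_congr (Lp.coeFn_add f g) hx

theorem L2Edge.integral_smul (c : ℂ) (f : L2Edge) {x : ℝ} (hx : x ∈ Set.Icc (0 : ℝ) 1) :
    ∫ t in (0 : ℝ)..x, (c • f : L2Edge) t = c * ∫ t in (0 : ℝ)..x, f t := by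
  rw [← intervalIntegral.integral_const_mul]
  exact L2Edge.integral_congr (Lp.coeFn_smul c f) hx

theorem IsH2Rep.add {f d s f' d' s' : L2Edge} {u v u' v' : ℝ → ℂ} (h : IsH2Rep f d s u v)
    (h' : IsH2Rep f' d' s' u' v') : IsH2Rep (f + f') (d + d') (s + s') (u + u') (v + v') where
  val := by
    filter_upwards [h.val, h'.val, Lp.coeFn_add f f'] with x h1 h2 h3
    rw [h3, Pi.add_apply, Pi.add_apply, h1, h2]
  der := by
    filter_upwards [h.der, h'.der, Lp.coeFn_add d d'] with x h1 h2 h3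
    rw [h3, Pi.add_apply, Pi.add_apply, h1, h2]
  ftc_val := fun x hx => by
    rw [L2Edge.integral_add d d' hx, Pi.add_apply, Pi.add_apply, h.ftc_val x hx, h'.ftc_val x hx]
    ring
  ftc_der := fun x hx => by
    rw [L2Edge.integral_add s s' hx, Pi.add_apply, Pi.add_apply, h.ftc_der x hx, h'.ftc_der x hx]
    ring

theorem IsH2Rep.smul {f d s : L2Edge} {u v : ℝ → ℂ} (c : ℂ) (h : IsH2Rep f d s u v) :
    IsH2Rep (c • f) (c • d) (c • s) (c • u) (c • v) where
  val := by
    filter_upwards [h.val, Lp.coeFn_smul c f] with x h1 h3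
    rw [h3, Pi.smul_apply, Pi.smul_apply, h1]
  der := by
    filter_upwards [h.der, Lp.coeFn_smul c d] with x h1 h3
    rw [h3, Pi.smul_apply, Pi.smul_apply, h1]
  ftc_val := fun x hx => by
    rw [L2Edge.integral_smul c d hx, Pi.smul_apply, Pi.smul_apply, smul_eq_mul, smul_eq_mul,
      h.ftc_val x hx]
    ring
  ftc_der := fun x hx => by
    rw [L2Edge.integral_smul c s hx, Pi.smul_apply, Pi.smul_apply, smul_eq_mul, smul_eq_mul,
      h.ftc_der x hx]
    ring

theorem IsKirchhoff.add {f d s f' d' s' : L2loc} (h : IsKirchhoff f d s)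
    (h' : IsKirchhoff f' d' s') : IsKirchhoff (f + f') (d + d') (s + s') := by
  obtain ⟨u, v, φ, h1, h2, h3, h4⟩ := h
  obtain ⟨u', v', φ', h1', h2', h3', h4'⟩ := h'
  refine ⟨u + u', v + v', φ + φ', fun e => (h1 e).add (h1' e), fun e => ?_, fun e => ?_,
    fun w => ?_⟩
  · simp [h2, h2']
  · simp [h3, h3']
  · have := congrArg₂ (· + ·) (h4 w) (h4' w)
    simp only [Pi.add_apply, neg_add, Finset.sum_add_distrib] at this ⊢
    rw [← add_zero (0 : ℂ), ← this]
    ring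

theorem IsKirchhoff.smul {f d s : L2loc} (c : ℂ) (h : IsKirchhoff f d s) :
    IsKirchhoff (c • f) (c • d) (c • s) := by
  obtain ⟨u, v, φ, h1, h2, h3, h4⟩ := h
  refine ⟨c • u, c • v, c • φ, fun e => (h1 e).smul c, fun e => ?_, fun e => ?_, fun w => ?_⟩
  · simp [h2]
  · simp [h3]
  · have := congrArg (c * ·) (h4 w)
    simpa [mul_add, Finset.mul_sum] using this

theorem IsKirchhoff.zero : IsKirchhoff 0 0 0 := by
  refine ⟨0, 0, 0, fun e => ⟨?_, ?_, fun x hx => ?_, fun x hx => ?_⟩, fun e => rfl, fun e => rfl,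
    fun w => by simp⟩
  · exact Lp.coeFn_zero ℂ 2 _
  · exact Lp.coeFn_zero ℂ 2 _
  all_goals
    have := L2Edge.integral_smul 0 0 hx
    rw [zero_smul, zero_mul] at this
    simpa using this.symm

/-- The graph of the Kirchhoff Laplacian `H` in `L²(G)`: the pairs `(f, -f'')`, where `f` is in
`H²` of each edge, `∑_e ‖f‖²_{H²(e)} < ∞` (that is, `f`, `f'` and `f''` are in `L²(G)`), and `f`
satisfies the vertex conditions. -/
def kirchhoffGraph : Submodule ℂ (L2G × L2G) where
  carrier := {q | ∃ d : L2G, IsKirchhoff (q.1 : L2loc) (d : L2loc) ((-q.2 : L2G) : L2loc)}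
  add_mem' := by
    rintro ⟨f, g⟩ ⟨f', g'⟩ ⟨d, h⟩ ⟨d', h'⟩
    refine ⟨d + d', ?_⟩
    change IsKirchhoff ((f + f' : L2G) : L2loc) _ ((-(g + g') : L2G) : L2loc)
    rw [neg_add, lp.coeFn_add, lp.coeFn_add, lp.coeFn_add]
    exact h.add h'
  zero_mem' := by
    refine ⟨0, ?_⟩
    change IsKirchhoff ((0 : L2G) : L2loc) ((0 : L2G) : L2loc) ((-0 : L2G) : L2loc)
    rw [neg_zero, lp.coeFn_zero]
    exact IsKirchhoff.zero
  smul_mem' := by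
    rintro c ⟨f, g⟩ ⟨d, h⟩
    refine ⟨c • d, ?_⟩
    change IsKirchhoff ((c • f : L2G) : L2loc) _ ((-(c • g) : L2G) : L2loc)
    rw [← smul_neg, lp.coeFn_smul, lp.coeFn_smul, lp.coeFn_smul]
    exact h.smul c

theorem L2Edge.eq_zero_of_primitive (g : L2Edge) (F : ℝ → ℂ)
    (hF : ∀ x ∈ Set.Icc (0 : ℝ) 1, F x = F 0 + ∫ t in (0 : ℝ)..x, g t)
    (h0 : ∀ᵐ x ∂(volume.restrict (Set.Icc (0 : ℝ) 1)), F x = 0) : g = 0 := by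
  have hint : IntervalIntegrable (fun t => g t) volume 0 1 := g.intervalIntegrable (by simp)
  have hcont : ContinuousOn F (Set.Icc 0 1) := by
    have h1 := intervalIntegral.continuousOn_primitive_interval' hint Set.left_mem_uIcc
    rw [Set.uIcc_of_le zero_le_one] at h1
    exact (continuousOn_const.add h1).congr hF
  have hzero : Set.EqOn F 0 (Set.Icc 0 1) :=
    Measure.eqOn_Icc_of_ae_eq volume zero_ne_one h0 hcont continuousOn_const
  have hprim : ∀ x ∈ Set.Icc (0 : ℝ) 1, ∫ t in (0 : ℝ)..x, g t = 0 := fun x hx => by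
    have h1 := hF x hx
    rw [hzero hx, hzero (Set.left_mem_Icc.2 zero_le_one)] at h1
    simpa using h1.symm
  rw [Lp.eq_zero_iff_ae_eq_zero]
  suffices h : ∀ᵐ x ∂(volume.restrict (Set.Ioo (0 : ℝ) 1)), g x = 0 by
    rwa [restrict_Ioo_eq_restrict_Icc] at h
  rw [ae_restrict_iff' measurableSet_Ioo]
  filter_upwards [hint.ae_hasDerivAt_integral] with x hx hx1
  have h1 := hx (by rw [Set.uIcc_of_le zero_le_one]; exact Set.Ioo_subset_Icc_self hx1) 0 (by simp)
  have h2 : HasDerivAt (fun x => ∫ t in (0 : ℝ)..x, g t) 0 x := by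
    refine (hasDerivAt_const x (0 : ℂ)).congr_of_eventuallyEq ?_
    filter_upwards [isOpen_Ioo.mem_nhds hx1] with y hy
    exact hprim y (Set.Ioo_subset_Icc_self hy)
  exact h1.unique h2

/-- `H f` is determined by `f`, so that `kirchhoffGraph` is the graph of an operator. -/
theorem kirchhoffGraph_single_valued (q : L2G × L2G) (hq : q ∈ kirchhoffGraph) (h0 : q.1 = 0) :
    q.2 = 0 := by
  obtain ⟨d, u, v, φ, h, -⟩ := hq
  rw [← neg_eq_zero]
  ext1
  funext e
  have hu : ∀ᵐ x ∂(volume.restrict (Set.Icc (0 : ℝ) 1)), u e x = 0 := by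
    have hf : (q.1 : L2loc) e = 0 := by rw [h0]; rfl
    have hv := (h e).val
    rw [hf] at hv
    filter_upwards [hv, Lp.coeFn_zero ℂ 2 (volume.restrict (Set.Icc (0 : ℝ) 1))] with x h1 h2
    rw [← h1, h2, Pi.zero_apply]
  have hd : (d : L2loc) e = 0 := L2Edge.eq_zero_of_primitive _ _ (h e).ftc_val hu
  refine L2Edge.eq_zero_of_primitive _ (v e) (h e).ftc_der ?_
  have hv := (h e).der
  rw [hd] at hv
  filter_upwards [hv, Lp.coeFn_zero ℂ 2 (volume.restrict (Set.Icc (0 : ℝ) 1))] with x h1 h2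
  rw [← h1, h2, Pi.zero_apply]

/-- The Kirchhoff Laplacian `H`, an unbounded operator in `L²(G)`. -/
def kirchhoffLaplacian : L2G →ₗ.[ℂ] L2G := kirchhoffGraph.toLinearPMap

theorem graph_kirchhoffLaplacian : kirchhoffLaplacian.graph = kirchhoffGraph :=
  Submodule.toLinearPMap_graph_eq _ kirchhoffGraph_single_valued

/-- The spectrum of an unbounded operator `T`: the complement of the set of the `z` for which
`T - z` has a bounded everywhere defined inverse. -/
def unboundedSpectrum {E : Type*} [NormedAddCommGroup E] [NormedSpace ℂ E] (T : E →ₗ.[ℂ] E) :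
    Set ℂ :=
  {z | ¬ ∃ R : E →L[ℂ] E,
    (∀ y, ∃ h : R y ∈ T.domain, T ⟨R y, h⟩ - z • R y = y) ∧
    (∀ x : T.domain, R (T x - z • (x : E)) = x)}

/-! ## Bloch eigenfunctions and bands -/

/-- The Floquet condition `f (T(p) x) = exp (i p · k) f x`. -/
def IsCyclic (k : ℝ × ℝ) (f : L2loc) : Prop :=
  ∀ (p q : ℤ × ℤ) (i : Fin 8), f (p + q, i) = phase k p • f (q, i)

/-- The eigenspace of the Floquet Hamiltonian `H(k)` for `z`: the `f ∈ H²_loc(G)` that satisfy the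
Kirchhoff vertex conditions, the Floquet condition and `-f'' = z f` on every edge. -/
def blochEigenspace (k : ℝ × ℝ) (z : ℂ) : Submodule ℂ L2loc where
  carrier := {f | IsCyclic k f ∧ ∃ d : L2loc, IsKirchhoff f d (-(z • f))}
  add_mem' := by
    rintro f f' ⟨hf, d, h⟩ ⟨hf', d', h'⟩
    refine ⟨fun p q i => ?_, d + d', ?_⟩
    · rw [Pi.add_apply, Pi.add_apply, hf, hf', smul_add]
    · have := h.add h'
      rwa [← neg_add, ← smul_add] at this
  zero_mem' := ⟨fun p q i => by simp, 0, by simpa using IsKirchhoff.zero⟩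
  smul_mem' := by
    rintro c f ⟨hf, d, h⟩
    refine ⟨fun p q i => ?_, c • d, ?_⟩
    · rw [Pi.smul_apply, Pi.smul_apply, hf, smul_comm]
    · have := h.smul c
      rwa [smul_neg, smul_comm] at this

/-- `z` is a Bloch eigenvalue with quasimomentum `k`, that is, an eigenvalue of `H(k)`. -/
def IsBlochEigenvalue (k : ℝ × ℝ) (z : ℂ) : Prop := blochEigenspace k z ≠ ⊥

/-- The `n`-th eigenvalue of `H(k)` (`n = 0, 1, …`), in nondecreasing order and counted with
multiplicity; as a function of `k`, the `n`-th branch of the dispersion relation. -/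
def bandFunction (n : ℕ) (k : ℝ × ℝ) : ℝ :=
  sInf {t : ℝ | ((n + 1 : ℕ) : Cardinal) ≤
    Module.rank ℂ (⨆ s : Set.Iic t, blochEigenspace k ((s : ℝ) : ℂ) : Submodule ℂ L2loc)}

end

end QuantumGraph

open QuantumGraph

/-!
On an edge the equation `-u'' = ω² u` is solved by its boundary values as soon as `sin ω ≠ 0`, and
the outgoing derivatives at the ends are then linear in these values. The Kirchhoff condition at a
vertex becomes the discrete equation `∑_{u ∼ v} φ u = cos ω · deg v · φ v` for the vertex values
(`exists_eq_vertexExtension`, `isKirchhoff_vertexExtension`). On quasiperiodic `φ` this is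
`Δ(k) c = cos ω S² c`, the eigenvalue equation of `L(k)` after division by the square roots of the
degrees. This is the correspondence of the Bloch eigenfunctions (`exists_blochEquiv`).

The inhomogeneous equation `-f'' - ω² f = g` reduces in the same way to
`(cos ω S² - A) φ = -vertexSource ω g`, where `A` is the adjacency operator on
`ℓ²(ℤ²)⁵`, a matrix of translations (`edgewiseSolution_mem_kirchhoffGraph`). If `cos ω` is not an
eigenvalue of any `L(k)`, then the determinant of `cos ω S² - A`, an element of the commutative
Banach algebra generated by the translations, is not annihilated by any character, so that it is a
unit by Gelfand theory and the adjugate formula gives a bounded inverse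
(`exists_inverse_sub_floquetMatrix`); hence `H - ω²` has a bounded inverse (`notMem_spectrum`). If
`cos ω` is an eigenvalue of `L(k)`, then a plane wave with a slowly decaying weight yields
approximate eigenvectors of all translations, hence approximate solutions of the discrete equation
and, through a bounded right inverse of `vertexSource ω`, a sequence `g n → 0` whose image under a
bounded inverse of `H - ω²` would not tend to `0` (`mem_spectrum`).

The isolated band is the one of index `3`. The polynomial `det (x S² - Δ(k))` is negative at
`x = -1/4` and positive at `x = -11/20` for all `k`; as the eigenvalues of `L(k)` have modulus at
most `1` and sum `0`, exactly one of them, the fourth, lies between these two numbers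
(`floquetEigenvalue_separation`). It is a continuous function of `k`, and the square of its arc
cosine is the band function. That the extrema are not attained on the boundary of the Brillouin
zone or in `X` is again read off from signs: there `sin k₁ sin k₂ = 0`, and the polynomial is
positive at `-1/2` and negative at `-5/16`, so that the fourth eigenvalue stays between
`-1/2` and `-5/16` (`floquetEigenvalue_three_mem_of_notMem`), whereas it takes values below `-1/2`
and above `-5/16` at interior points with rational sines and cosines.
-/

open MeasureTheory
open scoped ENNReal

namespace QuantumGraph

noncomputable section

/-! ### Calculus on one edge -/

/-- The restriction of Lebesgue measure to the edge `[0, 1]`. -/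
abbrev edgeMeasure : Measure ℝ := volume.restrict (Set.Icc (0 : ℝ) 1)

instance : IsProbabilityMeasure edgeMeasure := ⟨by simp [edgeMeasure]⟩

theorem memLp_edge_of_continuousOn {f : ℝ → ℂ} (hf : ContinuousOn f (Set.Icc 0 1)) :
    MemLp f 2 edgeMeasure := by
  obtain ⟨C, hC⟩ := isCompact_Icc.exists_bound_of_continuousOn hf
  exact MemLp.of_bound (hf.aestronglyMeasurable measurableSet_Icc) C
    (ae_restrict_of_forall_mem measurableSet_Icc hC)

/-- The element of `L²(e)` represented by a function that is continuous on the edge. -/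
def toEdge (f : ℝ → ℂ) (hf : ContinuousOn f (Set.Icc 0 1)) : L2Edge :=
  (memLp_edge_of_continuousOn hf).toLp f

theorem coeFn_toEdge {f : ℝ → ℂ} (hf : ContinuousOn f (Set.Icc 0 1)) :
    ∀ᵐ x ∂edgeMeasure, toEdge f hf x = f x :=
  MemLp.coeFn_toLp _

theorem isH2Rep_toEdge {f f' f'' : ℝ → ℂ} (h1 : ∀ x, HasDerivAt f (f' x) x)
    (h2 : ∀ x, HasDerivAt f' (f'' x) x) (h3 : Continuous f'')
    (c1 : ContinuousOn f (Set.Icc 0 1)) (c2 : ContinuousOn f' (Set.Icc 0 1)) :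
    IsH2Rep (toEdge f c1) (toEdge f' c2) (toEdge f'' h3.continuousOn) f f' where
  val := coeFn_toEdge _
  der := coeFn_toEdge _
  ftc_val := fun x hx => by
    have hc : Continuous f' := continuous_iff_continuousAt.2 fun x => (h2 x).continuousAt
    rw [L2Edge.integral_congr (coeFn_toEdge c2) hx,
      intervalIntegral.integral_eq_sub_of_hasDerivAt (fun y _ => h1 y)
        (hc.intervalIntegrable _ _)]
    ring
  ftc_der := fun x hx => by
    rw [L2Edge.integral_congr (coeFn_toEdge h3.continuousOn) hx,
      intervalIntegral.integral_eq_sub_of_hasDerivAt (fun y _ => h2 y)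
        (h3.intervalIntegrable _ _)]
    ring

theorem L2Edge.norm_integral_le (g : L2Edge) {x : ℝ} (hx : x ∈ Set.Icc (0 : ℝ) 1) :
    ‖∫ t in (0 : ℝ)..x, g t‖ ≤ ‖g‖ := by
  have hfin : edgeMeasure (Set.Ioc 0 x) ≠ ∞ := measure_ne_top _ _
  have h : ∫ t in (0 : ℝ)..x, g t
      = inner ℂ (indicatorConstLp 2 measurableSet_Ioc hfin (1 : ℂ)) g := by
    have hsub : Set.Ioc 0 x ⊆ Set.Icc (0 : ℝ) 1 := fun t ht => ⟨ht.1.le, ht.2.trans hx.2⟩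
    rw [L2.inner_indicatorConstLp_one, intervalIntegral.integral_of_le hx.1,
      Measure.restrict_restrict measurableSet_Ioc, Set.inter_eq_left.2 hsub]
  rw [h]
  refine (norm_inner_le_norm _ _).trans ?_
  refine mul_le_of_le_one_left (norm_nonneg _) (norm_indicatorConstLp_le.trans ?_)
  rw [norm_one, one_mul]
  exact Real.rpow_le_one measureReal_nonneg measureReal_le_one (by norm_num)

theorem L2Edge.continuousOn_primitive (g : L2Edge) :
    ContinuousOn (fun x => ∫ t in (0 : ℝ)..x, g t) (Set.Icc 0 1) := by
  have h1 := intervalIntegral.continuousOn_primitive_interval'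
    (g.intervalIntegrable (x := 1) (by simp)) Set.left_mem_uIcc
  rwa [Set.uIcc_of_le zero_le_one] at h1

theorem L2Edge.norm_le_of_ae_bound {g : L2Edge} {C : ℝ} (hC : 0 ≤ C)
    (h : ∀ᵐ x ∂edgeMeasure, ‖g x‖ ≤ C) : ‖g‖ ≤ C := by
  refine (Lp.norm_le_of_ae_bound hC h).trans_eq ?_
  have : measureUnivNNReal edgeMeasure = 1 := by
    ext; simp [measureUnivNNReal]
  rw [this]; simp

/-- The total integral over an edge, as a functional on `L²(e)`. -/
def edgeIntegral : L2Edge →L[ℂ] ℂ :=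
  LinearMap.mkContinuous
    { toFun := fun g => ∫ t in (0 : ℝ)..1, g t
      map_add' := fun f g => L2Edge.integral_add f g (by simp)
      map_smul' := fun c f => L2Edge.integral_smul c f (by simp) } 1
    fun g => by
      rw [one_mul]
      exact g.norm_integral_le (by simp)

theorem edgeIntegral_apply (g : L2Edge) : edgeIntegral g = ∫ t in (0 : ℝ)..1, g t := rfl

/-- The Volterra operator `g ↦ (x ↦ ∫₀ˣ g)` on `L²(e)`. -/
def volterra : L2Edge →L[ℂ] L2Edge :=
  LinearMap.mkContinuous
    { toFun := fun g => toEdge _ g.continuousOn_primitive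
      map_add' := fun f g => by
        apply Lp.ext
        filter_upwards [coeFn_toEdge (f + g).continuousOn_primitive,
          coeFn_toEdge f.continuousOn_primitive, coeFn_toEdge g.continuousOn_primitive,
          Lp.coeFn_add (toEdge _ f.continuousOn_primitive) (toEdge _ g.continuousOn_primitive),
          ae_restrict_mem measurableSet_Icc] with x h1 h2 h3 h4 hx
        rw [h1, h4, Pi.add_apply, h2, h3, L2Edge.integral_add f g hx]
      map_smul' := fun c f => by
        apply Lp.ext
        filter_upwards [coeFn_toEdge (c • f).continuousOn_primitive,
          coeFn_toEdge f.continuousOn_primitive,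
          Lp.coeFn_smul c (toEdge _ f.continuousOn_primitive),
          ae_restrict_mem measurableSet_Icc] with x h1 h2 h4 hx
        rw [h1, RingHom.id_apply, h4, Pi.smul_apply, h2, L2Edge.integral_smul c f hx,
          smul_eq_mul] } 1
    fun g => by
      rw [one_mul]
      refine L2Edge.norm_le_of_ae_bound (norm_nonneg _) ?_
      filter_upwards [coeFn_toEdge g.continuousOn_primitive,
        ae_restrict_mem measurableSet_Icc] with x h1 hx
      exact h1 ▸ g.norm_integral_le hx

theorem coeFn_volterra (g : L2Edge) :
    ∀ᵐ x ∂edgeMeasure, volterra g x = ∫ t in (0 : ℝ)..x, g t :=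
  coeFn_toEdge g.continuousOn_primitive

theorem norm_volterra_pow_apply_le (n : ℕ) (g : L2Edge) :
    ∀ᵐ x ∂edgeMeasure, ‖(volterra ^ (n + 1)) g x‖ ≤ x ^ n / n.factorial * ‖g‖ := by
  induction n with
  | zero =>
    filter_upwards [coeFn_volterra g, ae_restrict_mem measurableSet_Icc] with x h1 hx
    simpa [h1] using g.norm_integral_le hx
  | succ n ih =>
    rw [pow_succ' volterra (n + 1), mul_apply_eq_comp]
    filter_upwards [coeFn_volterra ((volterra ^ (n + 1)) g),
      ae_restrict_mem measurableSet_Icc] with x h1 hx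
    rw [h1]
    have hsub : Set.Ioc 0 x ⊆ Set.Icc (0 : ℝ) 1 := fun t ht => ⟨ht.1.le, ht.2.trans hx.2⟩
    have h2 : ‖∫ t in (0 : ℝ)..x, (volterra ^ (n + 1)) g t‖
        ≤ ∫ t in (0 : ℝ)..x, t ^ n / n.factorial * ‖g‖ := by
      refine intervalIntegral.norm_integral_le_of_norm_le hx.1 ?_ (by
        apply Continuous.intervalIntegrable; fun_prop)
      have := ae_restrict_of_ae_restrict_of_subset hsub ih
      rwa [ae_restrict_iff' measurableSet_Ioc] at this
    refine h2.trans_eq ?_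
    rw [intervalIntegral.integral_mul_const, intervalIntegral.integral_div, integral_pow,
      Nat.factorial_succ]
    push_cast
    have : (n.factorial : ℝ) ≠ 0 := by positivity
    field_simp
    simp

theorem norm_volterra_pow_le (n : ℕ) : ‖volterra ^ (n + 1)‖ ≤ 1 / n.factorial := by
  refine ContinuousLinearMap.opNorm_le_bound _ (by positivity) fun g => ?_
  refine L2Edge.norm_le_of_ae_bound (by positivity) ?_
  filter_upwards [norm_volterra_pow_apply_le n g, ae_restrict_mem measurableSet_Icc] with x h1 hx
  refine h1.trans ?_
  gcongr
  exact pow_le_one₀ hx.1 hx.2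

/-- The Volterra operator is quasinilpotent; hence the initial value problem `-u'' - z u = g`,
`u(0) = u'(0) = 0`, that is `s + z V² s = -g` for `s = u''`, is uniquely solvable. -/
theorem isUnit_one_add_smul_volterra_sq (z : ℂ) : IsUnit (1 + z • volterra ^ 2) := by
  set a : L2Edge →L[ℂ] L2Edge := -(z • volterra ^ 2) with ha
  have hlim := FloorSemiring.tendsto_pow_div_factorial_atTop (‖z‖)
  obtain ⟨n, hn⟩ := ((hlim.comp (Filter.tendsto_add_atTop_nat 1)).eventually
    (gt_mem_nhds one_pos)).exists
  have hnorm : ‖a ^ (n + 1)‖ < 1 := by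
    refine lt_of_le_of_lt ?_ hn
    have h1 : a ^ (n + 1) = (-z) ^ (n + 1) • volterra ^ ((2 * n + 1) + 1) := by
      rw [ha, ← neg_smul, smul_pow, ← pow_mul]
      congr 2
    rw [h1]
    rw [norm_smul, norm_pow, norm_neg, Function.comp_apply, div_eq_mul_one_div]
    gcongr
    refine (norm_volterra_pow_le _).trans ?_
    gcongr
    omega
  have h1 : IsUnit (1 - a ^ (n + 1)) := isUnit_one_sub_of_norm_lt_one hnorm
  have hcomm : Commute (1 - a) (∑ i ∈ Finset.range (n + 1), a ^ i) :=
    (Commute.one_left _).sub_left (Commute.sum_right _ _ _ fun i _ => Commute.self_pow a i)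
  rw [← mul_neg_geom_sum, hcomm.isUnit_mul_iff] at h1
  simpa [ha] using h1.1

/-- For `s ∈ L²(e)`, the function `V² s` is in `H²(e)`, its derivative is `V s` and its second
derivative `s`. -/
theorem isH2Rep_volterra (s : L2Edge) :
    IsH2Rep (volterra (volterra s)) (volterra s) s (fun x => ∫ t in (0 : ℝ)..x, volterra s t)
      (fun x => ∫ t in (0 : ℝ)..x, s t) where
  val := coeFn_volterra _
  der := coeFn_volterra _
  ftc_val := fun x _ => by simp
  ftc_der := fun x _ => by simp

/-- The operator `(1 + z V²)⁻¹` on `L²(e)`. -/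
def volterraInv (z : ℂ) : L2Edge →L[ℂ] L2Edge := Ring.inverse (1 + z • volterra ^ 2)

theorem volterraInv_eq (z : ℂ) (g : L2Edge) :
    volterraInv z g + z • volterra (volterra (volterraInv z g)) = g := by
  have h := DFunLike.congr_fun
    (Ring.mul_inverse_cancel _ (isUnit_one_add_smul_volterra_sq z)) g
  simpa [volterraInv, pow_two] using h

theorem volterraInv_apply_add (z : ℂ) (s : L2Edge) :
    volterraInv z (s + z • volterra (volterra s)) = s := by
  have h := DFunLike.congr_fun
    (Ring.inverse_mul_cancel _ (isUnit_one_add_smul_volterra_sq z)) s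
  simpa [volterraInv, pow_two] using h

/-! ### The equation `-u'' = ω² u` on one edge -/

/-- The solution of `-u'' = ω² u`, `u(0) = 0`, `u'(0) = 1`. -/
def edgeSin (ω : ℂ) (x : ℝ) : ℂ := if ω = 0 then (x : ℂ) else Complex.sin (ω * x) / ω

/-- The solution of `-u'' = ω² u`, `u(0) = 1`, `u'(0) = 0`. -/
def edgeCos (ω : ℂ) (x : ℝ) : ℂ := Complex.cos (ω * x)

theorem hasDerivAt_edgeSin (ω : ℂ) (x : ℝ) : HasDerivAt (edgeSin ω) (edgeCos ω x) x := by
  unfold edgeSin edgeCos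
  by_cases h : ω = 0
  · simp only [h, if_true, zero_mul, Complex.cos_zero]
    exact Complex.ofRealCLM.hasDerivAt
  · simp only [h, if_false]
    have h1 : HasDerivAt (fun x : ℝ => ω * (x : ℂ)) (ω * 1) x :=
      (Complex.ofRealCLM.hasDerivAt (x := x)).const_mul ω
    have h2 := ((Complex.hasDerivAt_sin (ω * x)).comp x h1).div_const ω
    rwa [mul_one, mul_div_cancel_right₀ _ h] at h2

theorem hasDerivAt_edgeCos (ω : ℂ) (x : ℝ) :
    HasDerivAt (edgeCos ω) (-(ω ^ 2 * edgeSin ω x)) x := by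
  have h1 : HasDerivAt (fun x : ℝ => ω * (x : ℂ)) (ω * 1) x :=
    (Complex.ofRealCLM.hasDerivAt (x := x)).const_mul ω
  have h2 := (Complex.hasDerivAt_cos (ω * x)).comp x h1
  have h3 : -(ω ^ 2 * edgeSin ω x) = -Complex.sin (ω * x) * (ω * 1) := by
    unfold edgeSin
    split_ifs with h
    · simp [h]
    · field_simp
  rw [h3]
  exact h2

theorem continuous_edgeSin (ω : ℂ) : Continuous (edgeSin ω) :=
  continuous_iff_continuousAt.2 fun x => (hasDerivAt_edgeSin ω x).continuousAt

theorem continuous_edgeCos (ω : ℂ) : Continuous (edgeCos ω) :=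
  continuous_iff_continuousAt.2 fun x => (hasDerivAt_edgeCos ω x).continuousAt

@[simp] theorem edgeSin_zero_right (ω : ℂ) : edgeSin ω 0 = 0 := by simp [edgeSin]

@[simp] theorem edgeCos_zero_right (ω : ℂ) : edgeCos ω 0 = 1 := by simp [edgeCos]

theorem edgeCos_sq_add (ω : ℂ) (x : ℝ) : edgeCos ω x ^ 2 + ω ^ 2 * edgeSin ω x ^ 2 = 1 := by
  unfold edgeCos edgeSin
  split_ifs with h
  · simp [h]
  · rw [div_pow, mul_div_cancel₀ _ (pow_ne_zero 2 h)]
    exact Complex.cos_sq_add_sin_sq _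

/-- `edgeCos` as an element of `L²(e)`. -/
def edgeCosLp (ω : ℂ) : L2Edge := toEdge (edgeCos ω) (continuous_edgeCos ω).continuousOn

/-- `edgeSin` as an element of `L²(e)`. -/
def edgeSinLp (ω : ℂ) : L2Edge := toEdge (edgeSin ω) (continuous_edgeSin ω).continuousOn

/-- The solution of `-u'' = ω² u` with `u(0) = α` and `u'(0) = γ`. -/
def cauchySol (ω α γ : ℂ) (x : ℝ) : ℂ := α * edgeCos ω x + γ * edgeSin ω x

/-- The derivative of `cauchySol`. -/
def cauchySolDeriv (ω α γ : ℂ) (x : ℝ) : ℂ :=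
  α * -(ω ^ 2 * edgeSin ω x) + γ * edgeCos ω x

theorem continuous_cauchySol (ω α γ : ℂ) : Continuous (cauchySol ω α γ) :=
  ((continuous_edgeCos ω).const_mul α).add ((continuous_edgeSin ω).const_mul γ)

theorem neg_smul_toEdge (c : ℂ) {f : ℝ → ℂ} (hf : ContinuousOn f (Set.Icc 0 1))
    (hf' : ContinuousOn (fun x => -(c * f x)) (Set.Icc 0 1)) :
    -c • toEdge f hf = toEdge (fun x => -(c * f x)) hf' := by
  apply Lp.ext
  filter_upwards [Lp.coeFn_smul (-c) (toEdge f hf), coeFn_toEdge hf, coeFn_toEdge hf']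
    with x h1 h2 h3
  rw [h1, h3, Pi.smul_apply, h2, smul_eq_mul, neg_mul]

theorem isH2Rep_edgeCosLp (ω : ℂ) :
    IsH2Rep (edgeCosLp ω) (-(ω ^ 2) • edgeSinLp ω) (-(ω ^ 2) • edgeCosLp ω) (edgeCos ω)
      (fun x => -(ω ^ 2 * edgeSin ω x)) := by
  have c1 : Continuous fun x => -(ω ^ 2 * edgeSin ω x) :=
    ((continuous_edgeSin ω).const_mul (ω ^ 2)).neg
  have c2 : Continuous fun x => -(ω ^ 2 * edgeCos ω x) :=
    ((continuous_edgeCos ω).const_mul (ω ^ 2)).neg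
  rw [edgeCosLp, edgeSinLp, neg_smul_toEdge _ _ c1.continuousOn,
    neg_smul_toEdge _ _ c2.continuousOn]
  exact isH2Rep_toEdge (hasDerivAt_edgeCos ω)
    (fun x => ((hasDerivAt_edgeSin ω x).const_mul (ω ^ 2)).neg) c2 _ _

theorem isH2Rep_edgeSinLp (ω : ℂ) :
    IsH2Rep (edgeSinLp ω) (edgeCosLp ω) (-(ω ^ 2) • edgeSinLp ω) (edgeSin ω) (edgeCos ω) := by
  have c1 : Continuous fun x => -(ω ^ 2 * edgeSin ω x) :=
    ((continuous_edgeSin ω).const_mul (ω ^ 2)).neg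
  rw [edgeCosLp, edgeSinLp, neg_smul_toEdge _ _ c1.continuousOn]
  exact isH2Rep_toEdge (hasDerivAt_edgeSin ω) (hasDerivAt_edgeCos ω) c1 _ _

/-- `cauchySol` as an element of `L²(e)`. -/
def cauchySolLp (ω α γ : ℂ) : L2Edge := α • edgeCosLp ω + γ • edgeSinLp ω

/-- `cauchySolDeriv` as an element of `L²(e)`. -/
def cauchySolDerivLp (ω α γ : ℂ) : L2Edge := α • -(ω ^ 2) • edgeSinLp ω + γ • edgeCosLp ω

theorem isH2Rep_cauchySolLp (ω α γ : ℂ) :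
    IsH2Rep (cauchySolLp ω α γ) (cauchySolDerivLp ω α γ) (-(ω ^ 2 • cauchySolLp ω α γ))
      (cauchySol ω α γ) (cauchySolDeriv ω α γ) := by
  have h := ((isH2Rep_edgeCosLp ω).smul α).add ((isH2Rep_edgeSinLp ω).smul γ)
  have e : -(ω ^ 2 • cauchySolLp ω α γ)
      = α • -(ω ^ 2) • edgeCosLp ω + γ • -(ω ^ 2) • edgeSinLp ω := by
    rw [cauchySolLp]
    module
  rw [e]
  exact h

theorem coeFn_cauchySolLp (ω α γ : ℂ) :
    ∀ᵐ x ∂edgeMeasure, cauchySolLp ω α γ x = cauchySol ω α γ x :=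
  (isH2Rep_cauchySolLp ω α γ).val

theorem IsH2Rep.continuousOn_val {f d s : L2Edge} {u v : ℝ → ℂ} (h : IsH2Rep f d s u v) :
    ContinuousOn u (Set.Icc 0 1) :=
  (continuousOn_const.add d.continuousOn_primitive).congr h.ftc_val

theorem IsH2Rep.continuousOn_der {f d s : L2Edge} {u v : ℝ → ℂ} (h : IsH2Rep f d s u v) :
    ContinuousOn v (Set.Icc 0 1) :=
  (continuousOn_const.add s.continuousOn_primitive).congr h.ftc_der

/-- A primitive of an element of `L²(e)` with a continuous representative is differentiable. -/
theorem hasDerivWithinAt_of_primitive {g : L2Edge} {G w : ℝ → ℂ}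
    (hG : ∀ x ∈ Set.Icc (0 : ℝ) 1, G x = G 0 + ∫ t in (0 : ℝ)..x, g t)
    (hg : ∀ᵐ x ∂edgeMeasure, g x = w x) (hw : ContinuousOn w (Set.Icc 0 1)) {x : ℝ}
    (hx : x ∈ Set.Ico (0 : ℝ) 1) : HasDerivWithinAt G (w x) (Set.Ici x) x := by
  have hxI : x ∈ Set.Icc (0 : ℝ) 1 := Set.Ico_subset_Icc_self hx
  have hnhds : Set.Icc (0 : ℝ) 1 ∈ nhdsWithin x (Set.Ici x) :=
    Filter.mem_of_superset (Icc_mem_nhdsGE hx.2) (Set.Icc_subset_Icc_left hx.1)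
  have hnhds' : Set.Icc (0 : ℝ) 1 ∈ nhdsWithin x (Set.Ioi x) :=
    nhdsWithin_mono _ Set.Ioi_subset_Ici_self hnhds
  have hint : IntervalIntegrable w volume 0 x :=
    (hw.mono (by rw [Set.uIcc_of_le hx.1]; exact Set.Icc_subset_Icc_right hx.2.le)
      ).intervalIntegrable
  have hcw : ContinuousWithinAt w (Set.Ioi x) x := (hw x hxI).mono_of_mem_nhdsWithin hnhds'
  have h1 : HasDerivWithinAt (fun y => ∫ t in (0 : ℝ)..y, w t) (w x) (Set.Ici x) x :=
    intervalIntegral.integral_hasDerivWithinAt_right hint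
      ⟨_, hnhds', hw.aestronglyMeasurable measurableSet_Icc⟩ hcw
  have h2 := h1.const_add (G 0)
  refine h2.congr_of_eventuallyEq ?_ ?_
  · filter_upwards [hnhds] with y hy
    rw [hG y hy, L2Edge.integral_congr hg hy]
  · rw [hG x hxI, L2Edge.integral_congr hg hxI]

/-- The solutions of `-u'' = ω² u` in `H²(e)` are determined by their Cauchy data at `0`. -/
theorem IsH2Rep.eq_cauchySol {ω : ℂ} {f d : L2Edge} {u v : ℝ → ℂ}
    (h : IsH2Rep f d (-(ω ^ 2 • f)) u v) {x : ℝ} (hx : x ∈ Set.Icc (0 : ℝ) 1) :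
    u x = cauchySol ω (u 0) (v 0) x ∧ v x = cauchySolDeriv ω (u 0) (v 0) x := by
  have hu : ∀ y ∈ Set.Ico (0 : ℝ) 1, HasDerivWithinAt u (v y) (Set.Ici y) y := fun y hy =>
    hasDerivWithinAt_of_primitive h.ftc_val h.der h.continuousOn_der hy
  have hval : ∀ᵐ y ∂edgeMeasure, (-(ω ^ 2 • f) : L2Edge) y = -(ω ^ 2 * u y) := by
    filter_upwards [h.val, Lp.coeFn_smul (ω ^ 2) f, Lp.coeFn_neg (ω ^ 2 • f)] with y h1 h2 h3
    rw [h3, Pi.neg_apply, h2, Pi.smul_apply, h1, smul_eq_mul]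
  have hv : ∀ y ∈ Set.Ico (0 : ℝ) 1, HasDerivWithinAt v (-(ω ^ 2 * u y)) (Set.Ici y) y :=
    fun y hy => hasDerivWithinAt_of_primitive (w := fun y => -(ω ^ 2 * u y)) h.ftc_der hval
      (h.continuousOn_val.const_mul _).neg hy
  have hC := fun y => (hasDerivAt_edgeCos ω y).hasDerivWithinAt (s := Set.Ici y)
  have hS := fun y => (hasDerivAt_edgeSin ω y).hasDerivWithinAt (s := Set.Ici y)
  have cC := (continuous_edgeCos ω).continuousOn (s := Set.Icc 0 1)
  have cS := (continuous_edgeSin ω).continuousOn (s := Set.Icc 0 1)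
  have cu := h.continuousOn_val
  have cv := h.continuousOn_der
  -- the Wronskians of the given solution with the two fundamental solutions are constant
  have hA := constant_of_has_deriv_right_zero
    (f := fun y => u y * edgeCos ω y - v y * edgeSin ω y)
    ((cu.mul cC).sub (cv.mul cS)) (fun y hy => by
      refine (((hu y hy).mul (hC y)).sub ((hv y hy).mul (hS y))).congr_deriv ?_
      ring) x hx
  have hB := constant_of_has_deriv_right_zero
    (f := fun y => ω ^ 2 * (u y * edgeSin ω y) + v y * edgeCos ω y)
    ((continuousOn_const.mul (cu.mul cS)).add (cv.mul cC)) (fun y hy => by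
      refine ((((hu y hy).mul (hS y)).const_mul (ω ^ 2)).add
        ((hv y hy).mul (hC y))).congr_deriv ?_
      ring) x hx
  simp only [edgeCos_zero_right, edgeSin_zero_right, mul_one, mul_zero, sub_zero,
    zero_add] at hA hB
  have hW := edgeCos_sq_add ω x
  rw [cauchySol, cauchySolDeriv]
  constructor
  · rw [← hA, ← hB]
    linear_combination (-u x) * hW
  · rw [← hA, ← hB]
    linear_combination (-v x) * hW

/-! ### Eigenfunctions and discrete harmonic functions -/

/-- The derivative at `0` of the solution of `-u'' = ω² u` with boundary values `α` and `β`. -/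
def initialSlope (ω α β : ℂ) : ℂ := (β - edgeCos ω 1 * α) / edgeSin ω 1

/-- The solution of `-u'' = ω² u` with `u(0) = α` and `u(1) = β`, as an element of `L²(e)`. The
boundary value problem is uniquely solvable if `edgeSin ω 1 ≠ 0`. -/
def dirichletLp (ω α β : ℂ) : L2Edge := cauchySolLp ω α (initialSlope ω α β)

theorem cauchySol_zero (ω α γ : ℂ) : cauchySol ω α γ 0 = α := by simp [cauchySol]

theorem cauchySolDeriv_zero (ω α γ : ℂ) : cauchySolDeriv ω α γ 0 = γ := by simp [cauchySolDeriv]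

theorem cauchySol_one {ω : ℂ} (hω : edgeSin ω 1 ≠ 0) (α β : ℂ) :
    cauchySol ω α (initialSlope ω α β) 1 = β := by
  rw [cauchySol, initialSlope]
  field_simp
  ring

theorem cauchySolDeriv_one {ω : ℂ} (hω : edgeSin ω 1 ≠ 0) (α β : ℂ) :
    cauchySolDeriv ω α (initialSlope ω α β) 1 = (edgeCos ω 1 * β - α) / edgeSin ω 1 := by
  rw [cauchySolDeriv, initialSlope]
  field_simp
  linear_combination (-α) * edgeCos_sq_add ω 1

/-- The function on the metric graph that solves `-u'' = ω² u` on every edge and has the vertex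
values `φ`. -/
def vertexExtension (ω : ℂ) (φ : Vertex → ℂ) : L2loc := fun e =>
  dirichletLp ω (φ (src e)) (φ (tgt e))

/-- The discrete counterpart of the Kirchhoff condition for `vertexExtension`. -/
def IsDiscreteEigenfunction (μ : ℂ) (φ : Vertex → ℂ) : Prop :=
  ∀ w, ∑ e ∈ outEdges w, φ (tgt e) + ∑ e ∈ inEdges w, φ (src e) = μ * (deg w.2 * φ w)

/-- The sum of the outgoing derivatives at the vertex `w`, for edgewise solutions of
`-u'' = ω² u` with vertex values `φ`. -/
theorem sum_outgoing_slopes (ω : ℂ) (φ : Vertex → ℂ) (w : Vertex) :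
    ∑ e ∈ outEdges w, (φ (tgt e) - edgeCos ω 1 * φ (src e)) / edgeSin ω 1
        + ∑ e ∈ inEdges w, -((edgeCos ω 1 * φ (tgt e) - φ (src e)) / edgeSin ω 1)
      = (∑ e ∈ outEdges w, φ (tgt e) + ∑ e ∈ inEdges w, φ (src e)
          - edgeCos ω 1 * (deg w.2 * φ w)) / edgeSin ω 1 := by
  have h1 : ∑ e ∈ outEdges w, (φ (tgt e) - edgeCos ω 1 * φ (src e)) / edgeSin ω 1
      = ∑ e ∈ outEdges w, (φ (tgt e) - edgeCos ω 1 * φ w) / edgeSin ω 1 :=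
    Finset.sum_congr rfl fun e he => by rw [(mem_outEdges w e).1 he]
  have h2 : ∑ e ∈ inEdges w, -((edgeCos ω 1 * φ (tgt e) - φ (src e)) / edgeSin ω 1)
      = ∑ e ∈ inEdges w, (φ (src e) - edgeCos ω 1 * φ w) / edgeSin ω 1 :=
    Finset.sum_congr rfl fun e he => by rw [(mem_inEdges w e).1 he]; ring
  rw [h1, h2, ← Finset.sum_div, ← Finset.sum_div, Finset.sum_sub_distrib, Finset.sum_sub_distrib,
    Finset.sum_const, Finset.sum_const, ← card_outEdges_add_card_inEdges w]
  simp only [nsmul_eq_mul]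
  push_cast
  ring

theorem isKirchhoff_vertexExtension {ω : ℂ} (hω : edgeSin ω 1 ≠ 0) {φ : Vertex → ℂ}
    (hφ : IsDiscreteEigenfunction (edgeCos ω 1) φ) :
    ∃ d, IsKirchhoff (vertexExtension ω φ) d (-(ω ^ 2 • vertexExtension ω φ)) := by
  refine ⟨fun e => cauchySolDerivLp ω (φ (src e)) (initialSlope ω (φ (src e)) (φ (tgt e))),
    fun e => cauchySol ω (φ (src e)) (initialSlope ω (φ (src e)) (φ (tgt e))),
    fun e => cauchySolDeriv ω (φ (src e)) (initialSlope ω (φ (src e)) (φ (tgt e))), φ,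
    fun e => isH2Rep_cauchySolLp _ _ _, fun e => cauchySol_zero _ _ _,
    fun e => cauchySol_one hω _ _, fun w => ?_⟩
  simp only [cauchySolDeriv_zero, cauchySolDeriv_one hω]
  simp only [initialSlope]
  rw [sum_outgoing_slopes, hφ w, sub_self, zero_div]

theorem exists_eq_vertexExtension {ω : ℂ} (hω : edgeSin ω 1 ≠ 0) {f d : L2loc}
    (h : IsKirchhoff f d (-(ω ^ 2 • f))) :
    ∃ φ, f = vertexExtension ω φ ∧ IsDiscreteEigenfunction (edgeCos ω 1) φ := by
  obtain ⟨u, v, φ, h1, h2, h3, h4⟩ := h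
  have hone : (1 : ℝ) ∈ Set.Icc (0 : ℝ) 1 := by simp
  have hslope : ∀ e, v e 0 = initialSlope ω (φ (src e)) (φ (tgt e)) := fun e => by
    have h5 := ((h1 e).eq_cauchySol hone).1
    rw [h2, h3, cauchySol] at h5
    rw [initialSlope, h5]
    field_simp
    ring
  refine ⟨φ, ?_, fun w => ?_⟩
  · funext e
    apply Lp.ext
    filter_upwards [(h1 e).val, coeFn_cauchySolLp ω (φ (src e))
      (initialSlope ω (φ (src e)) (φ (tgt e))), ae_restrict_mem measurableSet_Icc] with x h5 h6 hx
    rw [vertexExtension, dirichletLp, h5, h6, ((h1 e).eq_cauchySol hx).1, h2, hslope]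
  · have h5 := h4 w
    have h6 : ∀ e, v e 1 = (edgeCos ω 1 * φ (tgt e) - φ (src e)) / edgeSin ω 1 := fun e => by
      rw [((h1 e).eq_cauchySol hone).2, h2, hslope, cauchySolDeriv_one hω]
    simp only [h6, hslope, initialSlope] at h5
    rw [sum_outgoing_slopes, div_eq_zero_iff, or_iff_left hω, sub_eq_zero] at h5
    exact h5

theorem L2Edge.coeFn_sum {ι : Type*} (s : Finset ι) (f : ι → L2Edge) :
    ∀ᵐ x ∂edgeMeasure, (∑ i ∈ s, f i : L2Edge) x = ∑ i ∈ s, f i x := by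
  classical
  induction s using Finset.induction_on with
  | empty =>
    simp only [Finset.sum_empty]
    exact Lp.coeFn_zero ℂ 2 edgeMeasure
  | insert i s hi ih =>
    rw [Finset.sum_insert hi]
    filter_upwards [ih, Lp.coeFn_add (f i) (∑ j ∈ s, f j)] with x h1 h2
    rw [h2, Pi.add_apply, h1, Finset.sum_insert hi]

/-- The values at the vertices can be read off the class in `L²_loc(G)`, even from a sum of
eigenfunctions for different eigenvalues. -/
theorem sum_eq_zero_of_sum_vertexExtension_eq_zero {ι : Type*} (s : Finset ι) {ω : ι → ℂ}
    (hω : ∀ i, edgeSin (ω i) 1 ≠ 0) (φ : ι → Vertex → ℂ)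
    (h : ∑ i ∈ s, vertexExtension (ω i) (φ i) = 0) : ∑ i ∈ s, φ i = 0 := by
  have hfun : ∀ e, Set.EqOn (fun x => ∑ i ∈ s, cauchySol (ω i) (φ i (src e))
      (initialSlope (ω i) (φ i (src e)) (φ i (tgt e))) x) 0 (Set.Icc 0 1) := fun e => by
    refine Measure.eqOn_Icc_of_ae_eq volume zero_ne_one ?_ ?_ continuousOn_const
    · have h1 := congrFun h e
      rw [Finset.sum_apply] at h1
      have h2 : ∀ᵐ x ∂edgeMeasure, ∀ i ∈ s, vertexExtension (ω i) (φ i) e x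
          = cauchySol (ω i) (φ i (src e))
              (initialSlope (ω i) (φ i (src e)) (φ i (tgt e))) x := by
        rw [Filter.eventually_all_finset]
        exact fun i _ => coeFn_cauchySolLp _ _ _
      have h3 := Lp.coeFn_zero ℂ 2 edgeMeasure
      rw [← show _ = (0 : L2Edge) from h1] at h3
      filter_upwards [h2, h3, L2Edge.coeFn_sum s
        (fun i => vertexExtension (ω i) (φ i) e)] with x h4 h5 h6
      rw [h6] at h5
      rw [← h5]
      exact Finset.sum_congr rfl fun i hi => (h4 i hi).symm
    · exact (continuous_finsetSum _ fun i _ => continuous_cauchySol _ _ _).continuousOn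
  funext w
  rw [Finset.sum_apply]
  have hcard : (outEdges w).card + (inEdges w).card ≠ 0 := by
    rw [card_outEdges_add_card_inEdges]
    obtain ⟨p, a⟩ := w
    fin_cases a <;> simp [deg]
  by_cases hout : (outEdges w).card = 0
  · obtain ⟨e, he⟩ := Finset.card_ne_zero.1 (fun h0 => hcard (by rw [hout, h0]) :
      (inEdges w).card ≠ 0)
    have h1 := hfun e (show (1 : ℝ) ∈ Set.Icc (0 : ℝ) 1 by simp)
    simp only [fun i => cauchySol_one (hω i)] at h1
    rwa [(mem_inEdges w e).1 he] at h1
  · obtain ⟨e, he⟩ := Finset.card_ne_zero.1 hout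
    have h1 := hfun e (show (0 : ℝ) ∈ Set.Icc (0 : ℝ) 1 by simp)
    simp only [cauchySol_zero] at h1
    rwa [(mem_outEdges w e).1 he] at h1

theorem dirichletLp_add (ω α β α' β' : ℂ) :
    dirichletLp ω (α + α') (β + β') = dirichletLp ω α β + dirichletLp ω α' β' := by
  simp only [dirichletLp, cauchySolLp, initialSlope]
  module

theorem dirichletLp_smul (ω c α β : ℂ) :
    dirichletLp ω (c * α) (c * β) = c • dirichletLp ω α β := by
  simp only [dirichletLp, cauchySolLp, initialSlope]
  module

/-- `vertexExtension` as a linear map. -/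
def vertexExtensionₗ (ω : ℂ) : (Vertex → ℂ) →ₗ[ℂ] L2loc where
  toFun := vertexExtension ω
  map_add' := fun _ _ => funext fun _ => dirichletLp_add _ _ _ _ _
  map_smul' := fun _ _ => funext fun _ => dirichletLp_smul _ _ _ _

theorem vertexExtension_injective {ω : ℂ} (hω : edgeSin ω 1 ≠ 0) :
    Function.Injective (vertexExtension ω) := by
  refine (injective_iff_map_eq_zero (vertexExtensionₗ ω)).2 fun φ h => ?_
  simpa using sum_eq_zero_of_sum_vertexExtension_eq_zero {()} (fun _ => hω) (fun _ => φ)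
    (by rw [Finset.sum_singleton]; exact h)

/-- The quasiperiodic extension of vertex data on the fundamental domain, as a linear map. -/
def cyclicExtensionₗ (k : ℝ × ℝ) : (Fin 5 → ℂ) →ₗ[ℂ] Vertex → ℂ where
  toFun := cyclicExtension k
  map_add' := fun _ _ => funext fun _ => mul_add _ _ _
  map_smul' := fun _ _ => funext fun _ => mul_left_comm _ _ _

theorem phase_zero (k : ℝ × ℝ) : phase k 0 = 1 := by simp [phase]

theorem cyclicExtension_injective (k : ℝ × ℝ) : Function.Injective (cyclicExtension k) := by
  intro c c' h
  funext a
  simpa [cyclicExtension, phase_zero] using congrFun h (0, a)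

/-- The eigenfunction candidate with the vertex data `c` on the fundamental domain. -/
def blochExtension (k : ℝ × ℝ) (ω : ℂ) : (Fin 5 → ℂ) →ₗ[ℂ] L2loc :=
  vertexExtensionₗ ω ∘ₗ cyclicExtensionₗ k

theorem blochExtension_apply (k : ℝ × ℝ) (ω : ℂ) (c : Fin 5 → ℂ) :
    blochExtension k ω c = vertexExtension ω (cyclicExtension k c) := rfl

theorem blochExtension_injective (k : ℝ × ℝ) {ω : ℂ} (hω : edgeSin ω 1 ≠ 0) :
    Function.Injective (blochExtension k ω) :=
  (vertexExtension_injective hω).comp (cyclicExtension_injective k)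

theorem isDiscreteEigenfunction_cyclicExtension_iff (k : ℝ × ℝ) (μ : ℂ) (c : Fin 5 → ℂ) :
    IsDiscreteEigenfunction μ (cyclicExtension k c) ↔
      ∀ a, (DeltaMatrix k).mulVec c a = μ * (deg a * c a) := by
  simp only [IsDiscreteEigenfunction, adjacency_cyclicExtension]
  constructor
  · intro h a
    simpa [cyclicExtension, phase_zero] using h (0, a)
  · rintro h ⟨p, a⟩
    simp only [cyclicExtension, h a]
    ring

theorem isCyclic_blochExtension (k : ℝ × ℝ) (ω : ℂ) (c : Fin 5 → ℂ) :
    IsCyclic k (blochExtension k ω c) := by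
  intro p q i
  simp only [blochExtension_apply, vertexExtension, ← dirichletLp_smul, src, tgt, cyclicExtension,
    phase_add, mul_assoc]

/-- The Bloch eigenfunctions for `ω²` are the extensions of the solutions of
`Δ(k) c = cos ω S² c`. -/
theorem mem_blochEigenspace_sq_iff (k : ℝ × ℝ) {ω : ℂ} (hω : edgeSin ω 1 ≠ 0) (f : L2loc) :
    f ∈ blochEigenspace k (ω ^ 2) ↔ ∃ c : Fin 5 → ℂ, f = blochExtension k ω c ∧
      ∀ a, (DeltaMatrix k).mulVec c a = edgeCos ω 1 * (deg a * c a) := by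
  constructor
  · rintro ⟨hcyc, d, hd⟩
    obtain ⟨φ, rfl, hφ⟩ := exists_eq_vertexExtension hω hd
    have hφc : φ = cyclicExtension k fun a => φ (0, a) := by
      funext ⟨p, a⟩
      have h1 : vertexExtension ω (fun w => φ (p + w.1, w.2))
          = vertexExtension ω (phase k p • φ) := by
        funext ⟨q, i⟩
        refine Eq.trans ?_ ((hcyc p q i).trans (dirichletLp_smul _ _ _ _).symm)
        simp only [vertexExtension, src, tgt, add_assoc]
      simpa [cyclicExtension] using congrFun (vertexExtension_injective hω h1) (0, a)
    refine ⟨fun a => φ (0, a), congrArg (vertexExtension ω) hφc, ?_⟩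
    rw [← isDiscreteEigenfunction_cyclicExtension_iff k, ← hφc]
    exact hφ
  · rintro ⟨c, rfl, hc⟩
    exact ⟨isCyclic_blochExtension k ω c, isKirchhoff_vertexExtension hω
      ((isDiscreteEigenfunction_cyclicExtension_iff k _ c).2 hc)⟩

theorem deg_pos (a : Fin 5) : 0 < deg a := by fin_cases a <;> simp [deg]

theorem sqrt_deg_ne_zero (a : Fin 5) : ((Real.sqrt (deg a) : ℝ) : ℂ) ≠ 0 := by
  have := deg_pos a
  exact_mod_cast (Real.sqrt_pos.2 (by exact_mod_cast this)).ne'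

theorem sqrt_deg_mul_self (a : Fin 5) :
    ((Real.sqrt (deg a) : ℝ) : ℂ) * ((Real.sqrt (deg a) : ℝ) : ℂ) = deg a := by
  rw [← Complex.ofReal_mul, Real.mul_self_sqrt (Nat.cast_nonneg _), Complex.ofReal_natCast]

theorem inv_sqrtDegMatrix :
    sqrtDegMatrix⁻¹ = Matrix.diagonal fun a => (((Real.sqrt (deg a) : ℝ) : ℂ))⁻¹ := by
  refine Matrix.inv_eq_left_inv ?_
  rw [sqrtDegMatrix, Matrix.diagonal_mul_diagonal, ← Matrix.diagonal_one]
  exact congrArg _ (funext fun a => inv_mul_cancel₀ (sqrt_deg_ne_zero a))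

/-- Division by the square roots of the degrees, the passage from eigenvectors of `L(k)` to vertex
data. -/
def sqrtDegDiv : (Fin 5 → ℂ) ≃ₗ[ℂ] (Fin 5 → ℂ) :=
  LinearEquiv.piCongrRight fun a =>
    LinearEquiv.smulOfUnit (Units.mk0 (((Real.sqrt (deg a) : ℝ) : ℂ))⁻¹
      (inv_ne_zero (sqrt_deg_ne_zero a)))

theorem sqrtDegDiv_apply (x : Fin 5 → ℂ) (a : Fin 5) :
    sqrtDegDiv x a = x a / ((Real.sqrt (deg a) : ℝ) : ℂ) := by
  rw [div_eq_inv_mul]; rfl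

theorem mem_eigenspace_LMatrix_iff (k : ℝ × ℝ) (μ : ℂ) (x : Fin 5 → ℂ) :
    x ∈ Module.End.eigenspace (Matrix.toLin' (LMatrix k)) μ ↔
      ∀ a, (DeltaMatrix k).mulVec (sqrtDegDiv x) a = μ * (deg a * sqrtDegDiv x a) := by
  rw [Module.End.mem_eigenspace_iff, Matrix.toLin'_apply, LMatrix, ← Matrix.mulVec_mulVec,
    ← Matrix.mulVec_mulVec, inv_sqrtDegMatrix, funext_iff]
  have h1 : (Matrix.diagonal fun a => (((Real.sqrt (deg a) : ℝ) : ℂ))⁻¹).mulVec x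
      = sqrtDegDiv x := by
    funext a
    rw [Matrix.mulVec_diagonal, sqrtDegDiv_apply, div_eq_inv_mul]
  refine forall_congr' fun a => ?_
  rw [h1, Matrix.mulVec_diagonal, Pi.smul_apply, smul_eq_mul, sqrtDegDiv_apply,
    ← sqrt_deg_mul_self]
  have h2 := sqrt_deg_ne_zero a
  rw [inv_mul_eq_iff_eq_mul₀ h2]
  field_simp

/-- The eigenspace of `L(k)` for `cos ω` is isomorphic to the eigenspace of `H(k)` for `ω²`. -/
def blochEquiv (k : ℝ × ℝ) {ω : ℂ} (hω : edgeSin ω 1 ≠ 0) :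
    Module.End.eigenspace (Matrix.toLin' (LMatrix k)) (edgeCos ω 1) ≃ₗ[ℂ]
      blochEigenspace k (ω ^ 2) :=
  LinearEquiv.ofBijective
    (((blochExtension k ω ∘ₗ sqrtDegDiv.toLinearMap).domRestrict _).codRestrict _ fun x =>
      (mem_blochEigenspace_sq_iff k hω _).2
        ⟨_, rfl, (mem_eigenspace_LMatrix_iff k _ _).1 x.2⟩) <| by
    constructor
    · intro x y h
      apply Subtype.ext
      exact sqrtDegDiv.injective (blochExtension_injective k hω (congrArg Subtype.val h))
    · rintro ⟨f, hf⟩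
      obtain ⟨c, rfl, hc⟩ := (mem_blochEigenspace_sq_iff k hω _).1 hf
      refine ⟨⟨sqrtDegDiv.symm c, (mem_eigenspace_LMatrix_iff k _ _).2 ?_⟩, Subtype.ext ?_⟩
      · rwa [LinearEquiv.apply_symm_apply]
      · exact congrArg (blochExtension k ω) (sqrtDegDiv.apply_symm_apply c)

theorem coe_blochEquiv (k : ℝ × ℝ) {ω : ℂ} (hω : edgeSin ω 1 ≠ 0)
    (x : Module.End.eigenspace (Matrix.toLin' (LMatrix k)) (edgeCos ω 1)) :
    (blochEquiv k hω x : L2loc) = blochExtension k ω (sqrtDegDiv x) := rfl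

theorem isBlochEigenvalue_sq_iff (k : ℝ × ℝ) {ω : ℂ} (hω : edgeSin ω 1 ≠ 0) :
    IsBlochEigenvalue k (ω ^ 2) ↔
      Module.End.HasEigenvalue (Matrix.toLin' (LMatrix k)) (edgeCos ω 1) := by
  rw [IsBlochEigenvalue, Module.End.hasEigenvalue_iff, ← Submodule.nontrivial_iff_ne_bot,
    ← Submodule.nontrivial_iff_ne_bot]
  exact (blochEquiv k hω).toEquiv.nontrivial_congr.symm

theorem edgeCos_one (ω : ℂ) : edgeCos ω 1 = Complex.cos ω := by simp [edgeCos]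

theorem ne_zero_of_sin_ne_zero {ω : ℂ} (hω : Complex.sin ω ≠ 0) : ω ≠ 0 := by
  rintro rfl
  simp at hω

theorem edgeSin_one_ne_zero {ω : ℂ} (hω : Complex.sin ω ≠ 0) : edgeSin ω 1 ≠ 0 := by
  have := ne_zero_of_sin_ne_zero hω
  simp [edgeSin, this, hω]

theorem isBlochEigenvalue_sq_iff_cos (k : ℝ × ℝ) {ω : ℂ} (hω : Complex.sin ω ≠ 0) :
    IsBlochEigenvalue k (ω ^ 2) ↔
      Module.End.HasEigenvalue (Matrix.toLin' (LMatrix k)) (Complex.cos ω) := by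
  rw [isBlochEigenvalue_sq_iff k (edgeSin_one_ne_zero hω), edgeCos_one]

theorem exists_blochEquiv (k : ℝ × ℝ) {ω : ℂ} (hω : Complex.sin ω ≠ 0) :
    ∃ Φ : blochEigenspace k (ω ^ 2) ≃ₗ[ℂ]
        Module.End.eigenspace (Matrix.toLin' (LMatrix k)) (Complex.cos ω),
      ∀ ψ : blochEigenspace k (ω ^ 2), ∃ φ : Vertex → ℂ,
        (φ = cyclicExtension k fun a =>
          (Φ ψ : Fin 5 → ℂ) a / ((Real.sqrt (deg a) : ℝ) : ℂ)) ∧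
        ∀ e : Edge, ∀ᵐ x ∂(volume.restrict (Set.Icc (0 : ℝ) 1)),
          (ψ : L2loc) e x = φ (src e) * Complex.cos (ω * x) +
            (φ (tgt e) - Complex.cos ω * φ (src e)) / Complex.sin ω * Complex.sin (ω * x) := by
  have h0 := ne_zero_of_sin_ne_zero hω
  have hS := edgeSin_one_ne_zero hω
  rw [← edgeCos_one]
  refine ⟨(blochEquiv k hS).symm, fun ψ => ⟨_, rfl, fun e => ?_⟩⟩
  obtain ⟨x, rfl⟩ := (blochEquiv k hS).surjective ψ
  have h1 : (fun a => (x : Fin 5 → ℂ) a / ((Real.sqrt (deg a) : ℝ) : ℂ)) = sqrtDegDiv x :=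
    funext fun a => (sqrtDegDiv_apply _ _).symm
  rw [LinearEquiv.symm_apply_apply, h1, coe_blochEquiv, blochExtension_apply]
  set φ := cyclicExtension k (sqrtDegDiv x)
  filter_upwards [coeFn_cauchySolLp ω (φ (src e)) (initialSlope ω (φ (src e)) (φ (tgt e)))]
    with t ht
  rw [vertexExtension, dirichletLp, ht]
  simp only [cauchySol, initialSlope, edgeSin, edgeCos, if_neg h0, Complex.ofReal_one, mul_one]
  field_simp

/-! ### The eigenvalues of the Floquet matrices -/

/-- The matrix `Δ(k)` with the Floquet multipliers `exp (i k₁)` and `exp (i k₂)` and their inverses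
replaced by elements `u`, `v` and `u'`, `v'` of a ring. -/
def floquetMatrix {R : Type*} [Zero R] [One R] (u u' v v' : R) : Matrix (Fin 5) (Fin 5) R :=
  !![0, 0, u, 1, 1;
     0, 0, 1, v, 1;
     u', 1, 0, 1, 0;
     1, v', 1, 0, 1;
     1, 1, 0, 1, 0]

theorem det_sub_floquetMatrix {R : Type*} [CommRing R] (u u' v v' x : R) (hu : u * u' = 1)
    (hv : v * v' = 1) :
    (Matrix.diagonal (fun a => x * (deg a : R)) - floquetMatrix u u' v v').det =
      324 * x ^ 5 - 252 * x ^ 3 - (9 * (u + u') + 18 * (v + v') + 18) * x ^ 2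
        + (26 - 3 * (u * v + u' * v') - 7 * (u + u') - 3 * (v + v')) * x
        + 2 * (v + v') - (u + u') * (v + v') := by
  simp [floquetMatrix, deg, Matrix.det_succ_row_zero, Fin.sum_univ_succ, Fin.succAbove,
    Matrix.diagonal_apply, Matrix.of_apply]
  grind

theorem DeltaMatrix_eq_floquetMatrix (k : ℝ × ℝ) :
    DeltaMatrix k = floquetMatrix (Complex.exp (Complex.I * k.1))
      (Complex.exp (-(Complex.I * k.1))) (Complex.exp (Complex.I * k.2))
      (Complex.exp (-(Complex.I * k.2))) := rfl

/-- The polynomial `det (x S² - Δ(k))`, in terms of `c₁ = cos k₁`, `s₁ = sin k₁`, `c₂ = cos k₂`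
and `s₂ = sin k₂`. -/
def trigCharpoly (x c₁ s₁ c₂ s₂ : ℝ) : ℝ :=
  324 * x ^ 5 - 252 * x ^ 3 - (18 * c₁ + 36 * c₂ + 18) * x ^ 2
    + (26 - 6 * (c₁ * c₂ - s₁ * s₂) - 14 * c₁ - 6 * c₂) * x + 4 * c₂ - 4 * c₁ * c₂

/-- The polynomial `det (x S² - Δ(k))`. -/
def floquetCharpoly (k : ℝ × ℝ) (x : ℝ) : ℝ :=
  trigCharpoly x (Real.cos k.1) (Real.sin k.1) (Real.cos k.2) (Real.sin k.2)

theorem det_sub_DeltaMatrix (k : ℝ × ℝ) (x : ℝ) :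
    (Matrix.diagonal (fun a => (x : ℂ) * (deg a : ℂ)) - DeltaMatrix k).det
      = (floquetCharpoly k x : ℂ) := by
  rw [DeltaMatrix_eq_floquetMatrix, det_sub_floquetMatrix]
  · have h : ∀ t : ℝ, Complex.exp (Complex.I * t) = Complex.cos t + Complex.sin t * Complex.I ∧
        Complex.exp (-(Complex.I * t)) = Complex.cos t - Complex.sin t * Complex.I := fun t => by
      rw [mul_comm, Complex.exp_mul_I, ← neg_mul, Complex.exp_mul_I, Complex.cos_neg,
        Complex.sin_neg]
      exact ⟨rfl, by ring⟩
    rw [(h k.1).1, (h k.1).2, (h k.2).1, (h k.2).2, floquetCharpoly, trigCharpoly]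
    push_cast
    linear_combination (-6 * x * Complex.sin k.1 * Complex.sin k.2) * Complex.I_sq
  · rw [← Complex.exp_add, add_neg_cancel, Complex.exp_zero]
  · rw [← Complex.exp_add, add_neg_cancel, Complex.exp_zero]

theorem isHermitian_LMatrix (k : ℝ × ℝ) : (LMatrix k).IsHermitian := by
  have hS : (sqrtDegMatrix⁻¹).IsHermitian := by
    rw [inv_sqrtDegMatrix]
    refine Matrix.isHermitian_diagonal_of_self_adjoint _ (funext fun a => ?_)
    simp
  have hΔ : (DeltaMatrix k).IsHermitian := by
    have h1 : ∀ t : ℝ, (starRingEnd ℂ) (Complex.exp (Complex.I * t))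
        = Complex.exp (-(Complex.I * t)) := fun t => by
      rw [← Complex.exp_conj, map_mul, Complex.conj_I, Complex.conj_ofReal, neg_mul]
    have h2 : ∀ t : ℝ, (starRingEnd ℂ) (Complex.exp (-(Complex.I * t)))
        = Complex.exp (Complex.I * t) := fun t => by
      rw [← h1, Complex.conj_conj]
    ext i j
    rw [Matrix.conjTranspose_apply]
    fin_cases i <;> fin_cases j <;> simp [DeltaMatrix, h1, h2]
  rw [Matrix.IsHermitian, LMatrix, Matrix.conjTranspose_mul, Matrix.conjTranspose_mul, hS.eq,
    hΔ.eq, Matrix.mul_assoc]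

/-- The bijection of the index types of the sorted and the unsorted eigenvalues in Mathlib. -/
def sortEquiv : Fin 5 ≃ Fin 5 :=
  (finCongr (Fintype.card_fin 5).symm).trans (Fintype.equivOfCardEq (Fintype.card_fin _))

/-- The eigenvalues of `L(k)` in decreasing order. -/
def floquetEigenvalue (k : ℝ × ℝ) (i : Fin 5) : ℝ :=
  (isHermitian_LMatrix k).eigenvalues (sortEquiv i)

/-- A basis of eigenvectors of `L(k)`, in the order of `floquetEigenvalue`. -/
def floquetBasis (k : ℝ × ℝ) : Module.Basis (Fin 5) ℂ (Fin 5 → ℂ) :=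
  (((isHermitian_LMatrix k).eigenvectorBasis.toBasis).map
    (WithLp.linearEquiv 2 ℂ (Fin 5 → ℂ))).reindex sortEquiv.symm

theorem floquetEigenvalue_antitone (k : ℝ × ℝ) : Antitone (floquetEigenvalue k) := by
  intro i j hij
  simp only [floquetEigenvalue, Matrix.IsHermitian.eigenvalues, sortEquiv, Equiv.trans_apply,
    Equiv.symm_apply_apply]
  exact (isHermitian_LMatrix k).eigenvalues₀_antitone (by simpa using hij)

theorem LMatrix_mulVec_floquetBasis (k : ℝ × ℝ) (i : Fin 5) :
    (LMatrix k).mulVec (floquetBasis k i) = (floquetEigenvalue k i : ℂ) • floquetBasis k i := by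
  have h := (isHermitian_LMatrix k).mulVec_eigenvectorBasis (sortEquiv i)
  simpa [floquetBasis, floquetEigenvalue] using h

theorem floquetBasis_mem_eigenspace (k : ℝ × ℝ) (i : Fin 5) :
    floquetBasis k i ∈ Module.End.eigenspace (Matrix.toLin' (LMatrix k))
      (floquetEigenvalue k i : ℂ) := by
  rw [Module.End.mem_eigenspace_iff, Matrix.toLin'_apply]
  exact LMatrix_mulVec_floquetBasis k i

theorem repr_eq_zero_of_mem_eigenspace {k : ℝ × ℝ} {μ : ℂ} {x : Fin 5 → ℂ}
    (hx : x ∈ Module.End.eigenspace (Matrix.toLin' (LMatrix k)) μ) {i : Fin 5}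
    (hi : (floquetEigenvalue k i : ℂ) ≠ μ) : (floquetBasis k).repr x i = 0 := by
  rw [Module.End.mem_eigenspace_iff] at hx
  have h1 : (floquetBasis k).repr (Matrix.toLin' (LMatrix k) x) i
      = floquetEigenvalue k i * (floquetBasis k).repr x i := by
    conv_lhs => rw [← (floquetBasis k).sum_repr x]
    simp only [map_sum, map_smul, Matrix.toLin'_apply, LMatrix_mulVec_floquetBasis]
    simp [Finsupp.single_apply, mul_comm]
  rw [hx, map_smul, Finsupp.smul_apply, smul_eq_mul] at h1
  have h2 : ((floquetEigenvalue k i : ℂ) - μ) * (floquetBasis k).repr x i = 0 := by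
    rw [sub_mul, ← h1, sub_self]
  exact (mul_eq_zero.1 h2).resolve_left (sub_ne_zero.2 hi)

theorem hasEigenvalue_LMatrix_iff (k : ℝ × ℝ) (μ : ℂ) :
    Module.End.HasEigenvalue (Matrix.toLin' (LMatrix k)) μ ↔
      ∃ i, (floquetEigenvalue k i : ℂ) = μ := by
  constructor
  · intro h
    obtain ⟨x, hx⟩ := h.exists_hasEigenvector
    by_contra! hne
    refine hx.2 ((floquetBasis k).repr.map_eq_zero_iff.1 (Finsupp.ext fun i => ?_))
    exact repr_eq_zero_of_mem_eigenspace hx.1 (hne i)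
  · rintro ⟨i, rfl⟩
    exact Module.End.hasEigenvalue_of_hasEigenvector
      ⟨floquetBasis_mem_eigenspace k i, (floquetBasis k).ne_zero i⟩

theorem floquetCharpoly_eq_prod (k : ℝ × ℝ) (x : ℝ) :
    floquetCharpoly k x = 324 * ∏ i, (x - floquetEigenvalue k i) := by
  have h1 : Matrix.diagonal (fun a => (x : ℂ) * (deg a : ℂ)) - DeltaMatrix k
      = sqrtDegMatrix * ((Matrix.scalar (Fin 5)) (x : ℂ) - LMatrix k) * sqrtDegMatrix := by
    have hdet : IsUnit sqrtDegMatrix.det := by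
      rw [sqrtDegMatrix, Matrix.det_diagonal, isUnit_iff_ne_zero]
      exact Finset.prod_ne_zero_iff.2 fun a _ => sqrt_deg_ne_zero a
    rw [mul_sub, sub_mul, LMatrix]
    congr 1
    · rw [sqrtDegMatrix, Matrix.scalar_apply, Matrix.diagonal_mul_diagonal,
        Matrix.diagonal_mul_diagonal]
      congr 1
      funext a
      rw [mul_right_comm, sqrt_deg_mul_self, mul_comm]
    · rw [← mul_assoc, ← mul_assoc, Matrix.mul_nonsing_inv _ hdet, one_mul, mul_assoc,
        Matrix.nonsing_inv_mul _ hdet, mul_one]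
  have h2 : sqrtDegMatrix.det * sqrtDegMatrix.det = 324 := by
    rw [sqrtDegMatrix, Matrix.det_diagonal, ← Finset.prod_mul_distrib]
    simp only [sqrt_deg_mul_self]
    simp [Fin.prod_univ_succ, deg]
    norm_num
  have h3 : (floquetCharpoly k x : ℂ) = 324 * ∏ i, ((x : ℂ) - floquetEigenvalue k i) := by
    rw [← det_sub_DeltaMatrix, h1, Matrix.det_mul, Matrix.det_mul, mul_right_comm, h2,
      ← Matrix.eval_charpoly, (isHermitian_LMatrix k).charpoly_eq, Polynomial.eval_prod]
    congr 1
    rw [← Equiv.prod_comp sortEquiv]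
    simp [floquetEigenvalue]
  exact_mod_cast h3

theorem sum_floquetEigenvalue (k : ℝ × ℝ) : ∑ i, floquetEigenvalue k i = 0 := by
  have h1 : (LMatrix k).trace = 0 := by
    rw [LMatrix, Matrix.trace_mul_comm, ← mul_assoc, inv_sqrtDegMatrix,
      Matrix.diagonal_mul_diagonal, Matrix.trace]
    simp only [Matrix.diag_apply, Matrix.diagonal_mul]
    refine Finset.sum_eq_zero fun a _ => ?_
    fin_cases a <;> simp [DeltaMatrix]
  rw [(isHermitian_LMatrix k).trace_eq_sum_eigenvalues, ← Equiv.sum_comp sortEquiv] at h1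
  have h2 : ((∑ i, floquetEigenvalue k i : ℝ) : ℂ) = 0 := by
    rw [← h1]
    push_cast
    rfl
  exact_mod_cast h2

/-- The matrix `S⁻² Δ(k)` has row sums of absolute values equal to `1`, so that the eigenvalues of
`L(k)` lie in the unit disc. -/
theorem norm_le_one_of_hasEigenvalue {k : ℝ × ℝ} {μ : ℂ}
    (h : Module.End.HasEigenvalue (Matrix.toLin' (LMatrix k)) μ) : ‖μ‖ ≤ 1 := by
  obtain ⟨x, hx⟩ := h.exists_hasEigenvector
  have h1 := (mem_eigenspace_LMatrix_iff k μ x).1 hx.1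
  set c := sqrtDegDiv x
  have hc : c ≠ 0 := fun h0 => hx.2 (by simpa [c] using h0)
  obtain ⟨a, -, ha⟩ := Finset.exists_max_image Finset.univ (fun a => ‖c a‖) Finset.univ_nonempty
  have hca : 0 < ‖c a‖ := by
    obtain ⟨b, hb⟩ := Function.ne_iff.1 hc
    exact (norm_pos_iff.2 hb).trans_le (ha b (Finset.mem_univ b))
  have hrow : ∑ b, ‖DeltaMatrix k a b‖ = deg a := by
    have h2 : ∀ t : ℝ, ‖Complex.exp (-(Complex.I * t))‖ = 1 := fun t => by
      rw [← mul_neg, mul_comm, ← Complex.ofReal_neg, Complex.norm_exp_ofReal_mul_I]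
    have h3 : ∀ t : ℝ, ‖Complex.exp (Complex.I * t)‖ = 1 := fun t => by
      rw [mul_comm, Complex.norm_exp_ofReal_mul_I]
    fin_cases a <;> simp [DeltaMatrix, Fin.sum_univ_succ, deg, h2, h3] <;> norm_num
  have hd : (0 : ℝ) < deg a := by exact_mod_cast deg_pos a
  have h4 : ‖μ‖ * (deg a * ‖c a‖) ≤ 1 * (deg a * ‖c a‖) := by
    calc ‖μ‖ * (deg a * ‖c a‖) = ‖(DeltaMatrix k).mulVec c a‖ := by
          rw [h1 a, norm_mul, norm_mul, Complex.norm_natCast]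
      _ ≤ ∑ b, ‖DeltaMatrix k a b‖ * ‖c b‖ := by
          rw [Matrix.mulVec, dotProduct]
          refine (norm_sum_le _ _).trans_eq ?_
          simp only [norm_mul]
      _ ≤ ∑ b, ‖DeltaMatrix k a b‖ * ‖c a‖ := by
          gcongr with b
          exact ha b (Finset.mem_univ b)
      _ = 1 * (deg a * ‖c a‖) := by rw [← Finset.sum_mul, hrow, one_mul]
  exact le_of_mul_le_mul_right h4 (by positivity)

theorem abs_floquetEigenvalue_le_one (k : ℝ × ℝ) (i : Fin 5) : |floquetEigenvalue k i| ≤ 1 := by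
  have h := norm_le_one_of_hasEigenvalue ((hasEigenvalue_LMatrix_iff k _).2 ⟨i, rfl⟩)
  simpa using h

/-! ### The isolated branch of eigenvalues of the Floquet matrices -/

/-- An affine function on the unit circle with `α² > β² + γ²` has the sign of `α`. -/
theorem affine_pos_of_sq_lt {α β γ c s : ℝ} (hα : 0 < α) (h : β ^ 2 + γ ^ 2 < α ^ 2)
    (hcs : c ^ 2 + s ^ 2 = 1) : 0 < α + β * c + γ * s := by
  have h1 : |β * c + γ * s| < α := by
    refine abs_lt_of_sq_lt_sq (lt_of_le_of_lt ?_ h) hα.le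
    nlinarith [sq_nonneg (β * s - γ * c)]
  linarith [(abs_lt.1 h1).1]

/-- For fixed `x` and `k₁`, the characteristic polynomial is affine on the circle of the `k₂`; the
condition of `affine_pos_of_sq_lt` is a quadratic inequality for `cos k₁`. -/
theorem trigCharpoly_neg_quarter_neg {c₁ s₁ c₂ s₂ : ℝ} (h₁ : c₁ ^ 2 + s₁ ^ 2 = 1)
    (h₂ : c₂ ^ 2 + s₂ ^ 2 = 1) : trigCharpoly (-1 / 4) c₁ s₁ c₂ s₂ < 0 := by
  have hc1 : -1 ≤ c₁ ∧ c₁ ≤ 1 := by constructor <;> nlinarith [sq_nonneg s₁]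
  have h := affine_pos_of_sq_lt (α := 1025 / 256 - 19 / 8 * c₁) (β := -13 / 4 + 5 / 2 * c₁)
    (γ := 3 / 2 * s₁) (by linarith [hc1.2]) (by nlinarith [sq_nonneg (c₁ - 27 / 32)]) h₂
  unfold trigCharpoly
  nlinarith [h]

/-- The counterpart of `trigCharpoly_neg_quarter_neg` at `-11/20`. -/
theorem trigCharpoly_neg_eleven_twentieths_pos {c₁ s₁ c₂ s₂ : ℝ} (h₁ : c₁ ^ 2 + s₁ ^ 2 = 1)
    (h₂ : c₂ ^ 2 + s₂ ^ 2 = 1) : 0 < trigCharpoly (-11 / 20) c₁ s₁ c₂ s₂ := by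
  have hc1 : -1 ≤ c₁ ∧ c₁ ≤ 1 := by constructor <;> nlinarith [sq_nonneg s₁]
  have h := affine_pos_of_sq_lt (α := 4700069 / 800000 + 451 / 200 * c₁)
    (β := -359 / 100 - 7 / 10 * c₁) (γ := -33 / 10 * s₁) (by linarith [hc1.1])
    (by nlinarith [sq_nonneg (c₁ + 7 / 10)]) h₂
  unfold trigCharpoly
  nlinarith [h]

/-- The fourth eigenvalue of `L(k)` is separated from the others by `-11/20` and `-1/4`. By the
signs of the characteristic polynomial, an odd number of eigenvalues is below `-11/20` and an even
number below `-1/4`, hence at least one and at least two. Four eigenvalues below `-1/4` are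
impossible, since the sum of all five vanishes and the largest is at most `1`. -/
theorem floquetEigenvalue_separation (k : ℝ × ℝ) :
    floquetEigenvalue k 4 < -11 / 20 ∧ -11 / 20 < floquetEigenvalue k 3 ∧
      floquetEigenvalue k 3 < -1 / 4 ∧ -1 / 4 < floquetEigenvalue k 2 := by
  have hA : floquetCharpoly k (-1 / 4) < 0 :=
    trigCharpoly_neg_quarter_neg (Real.cos_sq_add_sin_sq _) (Real.cos_sq_add_sin_sq _)
  have hB : 0 < floquetCharpoly k (-11 / 20) :=
    trigCharpoly_neg_eleven_twentieths_pos (Real.cos_sq_add_sin_sq _) (Real.cos_sq_add_sin_sq _)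
  have hsum := sum_floquetEigenvalue k
  rw [floquetCharpoly_eq_prod] at hA hB
  have h0 := (abs_le.1 (abs_floquetEigenvalue_le_one k 0)).2
  have h01 := floquetEigenvalue_antitone k (show (0 : Fin 5) ≤ 1 by decide)
  have h12 := floquetEigenvalue_antitone k (show (1 : Fin 5) ≤ 2 by decide)
  have h23 := floquetEigenvalue_antitone k (show (2 : Fin 5) ≤ 3 by decide)
  have h34 := floquetEigenvalue_antitone k (show (3 : Fin 5) ≤ 4 by decide)
  simp only [Fin.prod_univ_five, Fin.sum_univ_five] at hA hB hsum
  set e := floquetEigenvalue k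
  have hA' : 0 < (e 0 + 1 / 4) * (e 1 + 1 / 4) * (e 2 + 1 / 4) * (e 3 + 1 / 4) * (e 4 + 1 / 4) := by
    nlinarith [hA]
  have hB' : (e 0 + 11 / 20) * (e 1 + 11 / 20) * (e 2 + 11 / 20) * (e 3 + 11 / 20)
      * (e 4 + 11 / 20) < 0 := by
    nlinarith [hB]
  clear hA hB
  have h4 : e 4 < -11 / 20 := by
    by_contra! h
    refine absurd hB' (not_lt.2 ?_)
    have := h.trans h34
    refine mul_nonneg (mul_nonneg (mul_nonneg (mul_nonneg ?_ ?_) ?_) ?_) ?_ <;> linarith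
  have h3 : e 3 < -1 / 4 := by
    by_contra! h
    refine absurd hA' (not_lt.2 (mul_nonpos_of_nonneg_of_nonpos ?_ (by linarith)))
    refine mul_nonneg (mul_nonneg (mul_nonneg ?_ ?_) ?_) ?_ <;> linarith
  have h2 : -1 / 4 < e 2 := by
    by_contra! h
    -- otherwise the sum of the eigenvalues would be at most `1 - 3/4 - 11/20`
    have h1 : -1 / 4 < e 1 := by
      by_contra! h1
      linarith
    refine absurd hA' (not_lt.2 ?_)
    rw [mul_assoc, mul_assoc]
    refine mul_nonpos_of_nonneg_of_nonpos (mul_nonneg ?_ ?_)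
      (mul_nonpos_of_nonpos_of_nonneg ?_ (mul_nonneg_of_nonpos_of_nonpos ?_ ?_)) <;> linarith
  refine ⟨h4, ?_, h3, h2⟩
  by_contra! h
  refine absurd hB' (not_lt.2 ?_)
  rw [mul_assoc]
  refine mul_nonneg (mul_nonneg (mul_nonneg ?_ ?_) ?_)
    (mul_nonneg_of_nonpos_of_nonpos ?_ ?_) <;> linarith

theorem lt_floquetEigenvalue_of_lt_three (k : ℝ × ℝ) {i : Fin 5} (hi : i < 3) :
    -1 / 4 < floquetEigenvalue k i :=
  (floquetEigenvalue_separation k).2.2.2.trans_le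
    (floquetEigenvalue_antitone k (by revert i; decide))

theorem eq_three_of_floquetEigenvalue_mem {k : ℝ × ℝ} {i : Fin 5}
    (hi : floquetEigenvalue k i ∈ Set.Icc (-11 / 20 : ℝ) (-1 / 4)) : i = 3 := by
  rcases lt_trichotomy i 3 with h | h | h
  · exact absurd hi.2 (not_le.2 (lt_floquetEigenvalue_of_lt_three k h))
  · exact h
  · obtain rfl : i = 4 := (show ∀ j : Fin 5, 3 < j → j = 4 by decide) i h
    exact absurd hi.1 (not_le.2 (floquetEigenvalue_separation k).1)

/-- Between `-11/20` and `-1/4`, the characteristic polynomial changes sign exactly at the fourth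
eigenvalue. -/
theorem exists_floquetCharpoly_eq_mul (k : ℝ × ℝ) {y : ℝ}
    (hy : y ∈ Set.Icc (-11 / 20 : ℝ) (-1 / 4)) :
    ∃ r > 0, floquetCharpoly k y = r * (floquetEigenvalue k 3 - y) := by
  have h0 := lt_floquetEigenvalue_of_lt_three k (show (0 : Fin 5) < 3 by decide)
  have h1 := lt_floquetEigenvalue_of_lt_three k (show (1 : Fin 5) < 3 by decide)
  obtain ⟨h4, -, -, h2⟩ := floquetEigenvalue_separation k
  refine ⟨324 * ((floquetEigenvalue k 0 - y) * (floquetEigenvalue k 1 - y)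
    * (floquetEigenvalue k 2 - y) * (y - floquetEigenvalue k 4)), ?_, ?_⟩
  · refine mul_pos (by norm_num) (mul_pos (mul_pos (mul_pos ?_ ?_) ?_) ?_) <;>
      linarith [hy.1, hy.2]
  · rw [floquetCharpoly_eq_prod, Fin.prod_univ_five]
    ring

theorem floquetCharpoly_pos_iff (k : ℝ × ℝ) {y : ℝ}
    (hy : y ∈ Set.Icc (-11 / 20 : ℝ) (-1 / 4)) :
    0 < floquetCharpoly k y ↔ y < floquetEigenvalue k 3 := by
  obtain ⟨r, hr, h⟩ := exists_floquetCharpoly_eq_mul k hy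
  rw [h, mul_pos_iff_of_pos_left hr, sub_pos]

theorem floquetCharpoly_neg_iff (k : ℝ × ℝ) {y : ℝ}
    (hy : y ∈ Set.Icc (-11 / 20 : ℝ) (-1 / 4)) :
    floquetCharpoly k y < 0 ↔ floquetEigenvalue k 3 < y := by
  obtain ⟨r, hr, h⟩ := exists_floquetCharpoly_eq_mul k hy
  rw [h, ← neg_pos, ← mul_neg, mul_pos_iff_of_pos_left hr, neg_sub, sub_pos]

theorem continuous_floquetCharpoly (y : ℝ) : Continuous fun k => floquetCharpoly k y := by
  unfold floquetCharpoly trigCharpoly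
  fun_prop

theorem continuous_floquetEigenvalue_three : Continuous fun k => floquetEigenvalue k 3 := by
  refine continuous_iff_continuousAt.2 fun k => tendsto_order.2 ⟨fun y hy => ?_, fun y hy => ?_⟩
  · by_cases h : y < -11 / 20
    · exact Filter.Eventually.of_forall fun k' => h.trans (floquetEigenvalue_separation k').2.1
    · have hyI : y ∈ Set.Icc (-11 / 20 : ℝ) (-1 / 4) :=
        ⟨not_lt.1 h, (hy.trans (floquetEigenvalue_separation k).2.2.1).le⟩
      filter_upwards [(continuous_floquetCharpoly y).continuousAt.eventually
        (lt_mem_nhds ((floquetCharpoly_pos_iff k hyI).2 hy))] with k' hk'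
      exact (floquetCharpoly_pos_iff k' hyI).1 hk'
  · by_cases h : -1 / 4 < y
    · exact Filter.Eventually.of_forall fun k' => (floquetEigenvalue_separation k').2.2.1.trans h
    · have hyI : y ∈ Set.Icc (-11 / 20 : ℝ) (-1 / 4) :=
        ⟨((floquetEigenvalue_separation k).2.1.trans hy).le, not_lt.1 h⟩
      filter_upwards [(continuous_floquetCharpoly y).continuousAt.eventually
        (gt_mem_nhds ((floquetCharpoly_neg_iff k hyI).2 hy))] with k' hk'
      exact (floquetCharpoly_neg_iff k' hyI).1 hk'

/-- On the boundary of the Brillouin zone and at the symmetry points one has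
`sin k₁ sin k₂ = 0`, the characteristic polynomial is affine in each cosine, and its sign at `-1/2`
and at `-5/16` is decided at the corners. -/
theorem floquetEigenvalue_three_mem_of_notMem {k : ℝ × ℝ} (hk : k ∈ brillouinZone)
    (hk' : k ∉ interior brillouinZone \ symmetryPoints) :
    -1 / 2 < floquetEigenvalue k 3 ∧ floquetEigenvalue k 3 < -5 / 16 := by
  rw [← floquetCharpoly_pos_iff k (by norm_num), ← floquetCharpoly_neg_iff k (by norm_num)]
  obtain ⟨k₁, k₂⟩ := k
  have hb1 := Real.neg_one_le_cos k₁
  have hb1' := Real.cos_le_one k₁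
  have hb2 := Real.neg_one_le_cos k₂
  have hb2' := Real.cos_le_one k₂
  have hpi := Real.pi_pos
  have hcases : (k₁ = 0 ∧ k₂ = 0) ∨ Real.cos k₁ = -1 ∨ Real.cos k₂ = -1 := by
    by_cases hint : (k₁, k₂) ∈ interior brillouinZone
    · left
      have hX : (k₁, k₂) ∈ symmetryPoints := by
        by_contra h
        exact hk' ⟨hint, h⟩
      rw [brillouinZone, interior_prod_eq, interior_Icc] at hint
      obtain ⟨-, m, n, hmn⟩ := hX
      obtain ⟨rfl, rfl⟩ := Prod.mk.inj hmn
      have key : ∀ m : ℤ, (m * Real.pi) ∈ Set.Ioo (-Real.pi) Real.pi → m * Real.pi = 0 := by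
        intro m hm
        have h1 : (m : ℝ) < 1 := by
          by_contra! h
          nlinarith [hm.2]
        have h2 : (-1 : ℝ) < m := by
          by_contra! h
          nlinarith [hm.1]
        have h3 : m < 1 := by exact_mod_cast h1
        have h4 : -1 < m := by exact_mod_cast h2
        have h5 : m = 0 := by omega
        simp [h5]
      exact ⟨key m hint.1, key n hint.2⟩
    · right
      rw [brillouinZone, interior_prod_eq, interior_Icc] at hint
      by_contra! hne
      have key : ∀ t ∈ Set.Icc (-Real.pi) Real.pi, Real.cos t ≠ -1 →
          t ∈ Set.Ioo (-Real.pi) Real.pi := by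
        intro t ht hcos
        refine ⟨ht.1.lt_of_ne ?_, ht.2.lt_of_ne ?_⟩
        · rintro rfl
          simp at hcos
        · rintro rfl
          simp at hcos
      exact hint ⟨key _ hk.1 hne.1, key _ hk.2 hne.2⟩
  have hs : Real.sin k₁ * Real.sin k₂ = 0 := by
    have h : ∀ t : ℝ, Real.cos t = -1 → Real.sin t = 0 := fun t ht => by
      have := Real.sin_sq_add_cos_sq t
      rw [ht] at this
      nlinarith
    rcases hcases with ⟨h1, -⟩ | h1 | h1
    · simp [h1]
    · simp [h _ h1]
    · simp [h _ h1]
  simp only [floquetCharpoly, trigCharpoly, hs]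
  rcases hcases with ⟨rfl, rfl⟩ | h1 | h1
  · norm_num
  · rw [h1]; constructor <;> nlinarith
  · rw [h1]; constructor <;> nlinarith

theorem sin_arccos_eq_four_fifths {u : ℝ} (hu : u ^ 2 = 9 / 25) :
    Real.sin (Real.arccos u) = 4 / 5 := by
  rw [Real.sin_arccos, hu, show (1 : ℝ) - 9 / 25 = (4 / 5) ^ 2 by norm_num,
    Real.sqrt_sq (by norm_num)]

theorem arccos_mem_Icc (u : ℝ) : Real.arccos u ∈ Set.Icc (-Real.pi) Real.pi :=
  ⟨by linarith [Real.arccos_nonneg u, Real.pi_pos], Real.arccos_le_pi u⟩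

theorem exists_floquetEigenvalue_three_lt :
    ∃ k ∈ brillouinZone, floquetEigenvalue k 3 < -1 / 2 := by
  -- a point with rational sines and cosines near a minimum
  refine ⟨(Real.arccos (-3 / 5), Real.arccos (3 / 5)), ⟨arccos_mem_Icc _, arccos_mem_Icc _⟩, ?_⟩
  rw [← floquetCharpoly_neg_iff _ (by norm_num)]
  rw [floquetCharpoly, Real.cos_arccos (by norm_num) (by norm_num),
    Real.cos_arccos (by norm_num) (by norm_num), sin_arccos_eq_four_fifths (by norm_num),
    sin_arccos_eq_four_fifths (by norm_num), trigCharpoly]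
  norm_num

theorem exists_lt_floquetEigenvalue_three :
    ∃ k ∈ brillouinZone, -5 / 16 < floquetEigenvalue k 3 := by
  -- a point with rational sines and cosines near a maximum
  refine ⟨(Real.arccos (3 / 5), -Real.arccos (3 / 5)), ⟨arccos_mem_Icc _,
    neg_le_neg (arccos_mem_Icc _).2, neg_le.1 (arccos_mem_Icc _).1⟩, ?_⟩
  rw [← floquetCharpoly_pos_iff _ (by norm_num)]
  rw [floquetCharpoly, Real.cos_neg, Real.sin_neg, Real.cos_arccos (by norm_num) (by norm_num),
    sin_arccos_eq_four_fifths (by norm_num), trigCharpoly]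
  norm_num

/-! ### The band functions below `π²` -/

/-- The frequency `ω ∈ [0, π]` with `cos ω` equal to the `i`-th eigenvalue of `L(k)`. -/
def frequency (k : ℝ × ℝ) (i : Fin 5) : ℝ := Real.arccos (floquetEigenvalue k i)

theorem cos_frequency (k : ℝ × ℝ) (i : Fin 5) :
    Real.cos (frequency k i) = floquetEigenvalue k i :=
  have h := abs_le.1 (abs_floquetEigenvalue_le_one k i)
  Real.cos_arccos h.1 h.2

theorem frequency_nonneg (k : ℝ × ℝ) (i : Fin 5) : 0 ≤ frequency k i := Real.arccos_nonneg _

theorem edgeSin_ne_zero_of_lt_pi {ω : ℝ} (h0 : 0 ≤ ω) (h1 : ω < Real.pi) :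
    edgeSin (ω : ℂ) 1 ≠ 0 := by
  rcases h0.eq_or_lt with rfl | h
  · simp [edgeSin]
  · refine edgeSin_one_ne_zero ?_
    rw [← Complex.ofReal_sin]
    exact_mod_cast (Real.sin_pos_of_pos_of_lt_pi h h1).ne'

theorem edgeCos_ofReal_one (ω : ℝ) : edgeCos (ω : ℂ) 1 = (Real.cos ω : ℂ) := by
  rw [edgeCos_one, Complex.ofReal_cos]

theorem frequency_lt_pi (k : ℝ × ℝ) {i : Fin 5} (hi : i ≤ 3) : frequency k i < Real.pi := by
  have h := floquetEigenvalue_antitone k hi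
  refine (Real.arccos_le_pi _).lt_of_ne fun h1 => ?_
  rw [Real.arccos_eq_pi] at h1
  linarith [(floquetEigenvalue_separation k).2.1]

/-- The Bloch eigenfunction that corresponds to the `i`-th eigenvector of `L(k)`. -/
def blochEigenfunction (k : ℝ × ℝ) (i : Fin 5) : L2loc :=
  blochExtension k (frequency k i) (sqrtDegDiv (floquetBasis k i))

theorem blochExtension_mem_blochEigenspace {k : ℝ × ℝ} {ω : ℂ} (hω : edgeSin ω 1 ≠ 0)
    {x : Fin 5 → ℂ}
    (hx : x ∈ Module.End.eigenspace (Matrix.toLin' (LMatrix k)) (edgeCos ω 1)) :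
    blochExtension k ω (sqrtDegDiv x) ∈ blochEigenspace k (ω ^ 2) :=
  (blochEquiv k hω ⟨x, hx⟩).2

theorem blochEigenfunction_mem (k : ℝ × ℝ) {i : Fin 5} (hi : i ≤ 3) :
    blochEigenfunction k i ∈ blochEigenspace k ((frequency k i ^ 2 : ℝ) : ℂ) := by
  rw [Complex.ofReal_pow]
  refine blochExtension_mem_blochEigenspace
    (edgeSin_ne_zero_of_lt_pi (frequency_nonneg k _) (frequency_lt_pi k hi)) ?_
  rw [edgeCos_ofReal_one, cos_frequency]
  exact floquetBasis_mem_eigenspace k i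

/-- The eigenfunctions of different eigenvalues are linearly independent already because their
vertex values are. -/
theorem linearIndependent_blochEigenfunction (k : ℝ × ℝ) :
    LinearIndependent ℂ fun i : Fin 4 => blochEigenfunction k i.castSucc := by
  rw [Fintype.linearIndependent_iff]
  intro g hg
  have hle : ∀ i : Fin 4, i.castSucc ≤ 3 := by decide
  have h1 := sum_eq_zero_of_sum_vertexExtension_eq_zero Finset.univ
    (ω := fun i : Fin 4 => (frequency k i.castSucc : ℂ))
    (fun i => edgeSin_ne_zero_of_lt_pi (frequency_nonneg k _) (frequency_lt_pi k (hle i)))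
    (fun i => cyclicExtension k (g i • sqrtDegDiv (floquetBasis k i.castSucc))) (by
      rw [← hg]
      refine Finset.sum_congr rfl fun i _ => ?_
      rw [← blochExtension_apply, map_smul, blochEigenfunction])
  have h2 : cyclicExtensionₗ k (sqrtDegDiv (∑ i : Fin 4, g i • floquetBasis k i.castSucc)) = 0 := by
    rw [map_sum, map_sum, ← h1]
    refine Finset.sum_congr rfl fun i _ => ?_
    rw [map_smul]
    rfl
  have h3 : ∑ i : Fin 4, g i • floquetBasis k i.castSucc = 0 := by
    have h4 : sqrtDegDiv (∑ i : Fin 4, g i • floquetBasis k i.castSucc) = 0 :=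
      cyclicExtension_injective k (h2.trans (map_zero (cyclicExtensionₗ k)).symm)
    exact sqrtDegDiv.map_eq_zero_iff.1 h4
  have h5 := (floquetBasis k).linearIndependent.comp _ (Fin.castSucc_injective 4)
  exact Fintype.linearIndependent_iff.1 h5 g h3

theorem blochEigenspace_eq_bot_of_neg (k : ℝ × ℝ) {t : ℝ} (ht : t < 0) :
    blochEigenspace k (t : ℂ) = ⊥ := by
  by_contra hne
  set r := Real.sqrt (-t) with hr
  have hr0 : 0 < r := Real.sqrt_pos.2 (by linarith)
  have hsq : ((r : ℂ) * Complex.I) ^ 2 = (t : ℂ) := by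
    rw [mul_pow, Complex.I_sq, ← Complex.ofReal_pow, hr, Real.sq_sqrt (by linarith)]
    push_cast
    ring
  have hsin : Complex.sin ((r : ℂ) * Complex.I) ≠ 0 := by
    rw [Complex.sin_mul_I, ← Complex.ofReal_sinh]
    refine mul_ne_zero ?_ Complex.I_ne_zero
    exact_mod_cast (Real.sinh_pos_iff.2 hr0).ne'
  have h1 := (isBlochEigenvalue_sq_iff_cos k hsin).1 (by rw [hsq]; exact hne)
  have h2 := norm_le_one_of_hasEigenvalue h1
  rw [Complex.cos_mul_I, ← Complex.ofReal_cosh, Complex.norm_real, Real.norm_eq_abs] at h2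
  exact absurd (Real.one_lt_cosh.2 hr0.ne') (not_lt.2 ((le_abs_self _).trans h2))

/-- For `0 ≤ ω < π`, the Bloch eigenfunctions for `ω²` are linear combinations of the
`blochEigenfunction k i` with `floquetEigenvalue k i = cos ω`. -/
theorem blochEigenspace_le_span (k : ℝ × ℝ) {ω : ℝ} (h0 : 0 ≤ ω) (h1 : ω < Real.pi) :
    blochEigenspace k ((ω ^ 2 : ℝ) : ℂ) ≤ Submodule.span ℂ
      (blochEigenfunction k '' {i | floquetEigenvalue k i = Real.cos ω}) := by
  intro f hf
  have hS := edgeSin_ne_zero_of_lt_pi h0 h1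
  rw [Complex.ofReal_pow] at hf
  obtain ⟨⟨x, hx⟩, hxf⟩ := (blochEquiv k hS).surjective ⟨f, hf⟩
  have hf' : f = blochExtension k ω (sqrtDegDiv x) := by
    rw [← coe_blochEquiv k hS ⟨x, hx⟩, hxf]
  rw [edgeCos_ofReal_one] at hx
  rw [hf', ← (floquetBasis k).sum_repr x]
  simp only [map_sum, map_smul]
  refine Submodule.sum_mem _ fun i _ => ?_
  by_cases hi : floquetEigenvalue k i = Real.cos ω
  · refine Submodule.smul_mem _ _ (Submodule.subset_span ⟨i, hi, ?_⟩)
    rw [blochEigenfunction, frequency, hi, Real.arccos_cos h0 h1.le]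
  · rw [repr_eq_zero_of_mem_eigenspace hx (by exact_mod_cast hi), zero_smul]
    exact Submodule.zero_mem _

/-- Below the square of the fourth frequency there are only the eigenfunctions that correspond to
the first three eigenvectors of `L(k)`. -/
theorem iSup_blochEigenspace_le_span (k : ℝ × ℝ) {t : ℝ} (ht : t < frequency k 3 ^ 2) :
    (⨆ s : Set.Iic t, blochEigenspace k ((s : ℝ) : ℂ)) ≤
      Submodule.span ℂ
        (Set.range fun i : Fin 3 => blochEigenfunction k (i.castLE (by norm_num))) := by
  refine iSup_le fun ⟨s, hs⟩ => ?_
  rcases lt_or_ge s 0 with hneg | hpos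
  · simp [blochEigenspace_eq_bot_of_neg k hneg]
  · have hlt : Real.sqrt s < frequency k 3 :=
      (Real.sqrt_lt' (by
        have h1 : 0 ≤ frequency k 3 := frequency_nonneg k _
        refine h1.lt_of_ne fun h2 => ?_
        rw [← h2] at ht
        exact absurd (hpos.trans hs) (by simpa using ht))).2 (lt_of_le_of_lt hs ht)
    have h1 := blochEigenspace_le_span k (Real.sqrt_nonneg s)
      (hlt.trans (frequency_lt_pi k le_rfl))
    rw [Real.sq_sqrt hpos] at h1
    refine h1.trans (Submodule.span_mono ?_)
    rintro _ ⟨i, hi, rfl⟩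
    have h2 : floquetEigenvalue k 3 < floquetEigenvalue k i := by
      rw [hi, ← cos_frequency k 3]
      exact Real.cos_lt_cos_of_nonneg_of_le_pi (Real.sqrt_nonneg s) (Real.arccos_le_pi _) hlt
    have h3 : i < 3 := not_le.1 fun h => absurd (floquetEigenvalue_antitone k h) (not_le.2 h2)
    exact ⟨⟨i, h3⟩, rfl⟩

theorem bandFunction_three (k : ℝ × ℝ) : bandFunction 3 k = frequency k 3 ^ 2 := by
  rw [bandFunction]
  have hset : {t : ℝ | ((3 + 1 : ℕ) : Cardinal) ≤
      Module.rank ℂ (⨆ s : Set.Iic t, blochEigenspace k ((s : ℝ) : ℂ) : Submodule ℂ L2loc)}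
      = Set.Ici (frequency k 3 ^ 2) := by
    ext t
    rw [Set.mem_ofPred_eq, Set.mem_Ici]
    constructor
    · intro h
      by_contra! ht
      have h1 := h.trans (Submodule.rank_mono (iSup_blochEigenspace_le_span k ht))
      have h2 := h1.trans (rank_span_le _)
      have h3 := h2.trans Cardinal.mk_range_le
      rw [Cardinal.mk_fin] at h3
      exact absurd h3 (by rw [Nat.cast_le]; norm_num)
    · intro ht
      have hmem : ∀ i : Fin 4, blochEigenfunction k i.castSucc ∈
          (⨆ s : Set.Iic t, blochEigenspace k ((s : ℝ) : ℂ) : Submodule ℂ L2loc) := by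
        intro i
        have hi : i.castSucc ≤ 3 := by revert i; decide
        have h1 : frequency k i.castSucc ^ 2 ≤ t := by
          refine le_trans ?_ ht
          have h2 : frequency k i.castSucc ≤ frequency k 3 :=
            Real.arccos_le_arccos (floquetEigenvalue_antitone k hi)
          have h3 : 0 ≤ frequency k i.castSucc := frequency_nonneg k _
          gcongr
        exact Submodule.mem_iSup_of_mem (⟨_, h1⟩ : Set.Iic t) (blochEigenfunction_mem k hi)
      have hli : LinearIndependent ℂ (fun i : Fin 4 =>
          (⟨_, hmem i⟩ : (⨆ s : Set.Iic t, blochEigenspace k ((s : ℝ) : ℂ) :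
            Submodule ℂ L2loc))) :=
        LinearIndependent.of_comp (Submodule.subtype _) (linearIndependent_blochEigenfunction k)
      simpa using hli.cardinal_le_rank
  rw [hset, csInf_Ici]

theorem finrank_blochEigenspace_bandFunction_three (k : ℝ × ℝ) :
    Module.finrank ℂ (blochEigenspace k (bandFunction 3 k : ℂ)) = 1 := by
  have h1 : blochEigenspace k (bandFunction 3 k : ℂ) = ℂ ∙ blochEigenfunction k 3 := by
    rw [bandFunction_three]
    refine le_antisymm ?_ ?_
    · refine (blochEigenspace_le_span k (frequency_nonneg k _)
        (frequency_lt_pi k le_rfl)).trans (Submodule.span_mono ?_)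
      rintro _ ⟨i, hi, rfl⟩
      have h2 := floquetEigenvalue_separation k
      rw [Set.mem_ofPred_eq, cos_frequency] at hi
      rw [eq_three_of_floquetEigenvalue_mem (i := i) (k := k)
        (by rw [hi]; exact ⟨h2.2.1.le, h2.2.2.1.le⟩)]
      rfl
    · rw [Submodule.span_singleton_le_iff_mem]
      exact blochEigenfunction_mem k le_rfl
  rw [h1]
  refine finrank_span_singleton ?_
  exact (linearIndependent_blochEigenfunction k).ne_zero 3

/-- In the energy window given by `-11/20` and `-1/4`, the only Bloch eigenvalue is the value of
the fourth band function. -/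
theorem isBlochEigenvalue_iff_eq_bandFunction_three (k : ℝ × ℝ) {ω : ℝ} (h0 : 0 ≤ ω)
    (h1 : ω < Real.pi) (hω : Real.cos ω ∈ Set.Icc (-11 / 20 : ℝ) (-1 / 4)) :
    Module.End.HasEigenvalue (Matrix.toLin' (LMatrix k)) (Complex.cos ω) ↔
      ω ^ 2 = bandFunction 3 k := by
  rw [hasEigenvalue_LMatrix_iff, bandFunction_three, ← Complex.ofReal_cos]
  constructor
  · rintro ⟨i, hi⟩
    have hi' : floquetEigenvalue k i = Real.cos ω := by exact_mod_cast hi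
    have h3 := eq_three_of_floquetEigenvalue_mem (hi' ▸ hω)
    rw [frequency, ← h3, hi', Real.arccos_cos h0 h1.le]
  · intro h
    refine ⟨3, ?_⟩
    rw [← cos_frequency, (sq_eq_sq₀ h0 (frequency_nonneg k _)).1 h]

theorem continuous_bandFunction_three : Continuous (bandFunction 3) := by
  rw [funext bandFunction_three]
  exact (Real.continuous_arccos.comp continuous_floquetEigenvalue_three).pow 2

/-- The isolated band, given the description of the spectrum of `H` in terms of the Floquet
matrices. -/
theorem exists_isolated_band
    (hspec : ∀ ω : ℂ, Complex.sin ω ≠ 0 →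
      (ω ^ 2 ∈ unboundedSpectrum kirchhoffLaplacian ↔
        ∃ k ∈ brillouinZone,
          Module.End.HasEigenvalue (Matrix.toLin' (LMatrix k)) (Complex.cos ω))) :
    ∃ (n : ℕ) (a b ε : ℝ), a < b ∧ 0 < ε ∧
      bandFunction n '' brillouinZone = Set.Icc a b ∧
      (∀ t ∈ Set.Icc (a - ε) (b + ε),
        (t : ℂ) ∈ unboundedSpectrum kirchhoffLaplacian ↔ t ∈ Set.Icc a b) ∧
      (∀ k ∈ brillouinZone,
        Module.finrank ℂ (blochEigenspace k (bandFunction n k : ℂ)) = 1 ∧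
        ∀ t ∈ Set.Icc (a - ε) (b + ε), IsBlochEigenvalue k (t : ℂ) → t = bandFunction n k) ∧
      (∀ k ∈ brillouinZone, (IsBlochEigenvalue k (a : ℂ) ∨ IsBlochEigenvalue k (b : ℂ)) →
        k ∈ interior brillouinZone \ symmetryPoints) := by
  obtain ⟨kb, hkb, hb⟩ := exists_floquetEigenvalue_three_lt
  obtain ⟨ka, hka, ha⟩ := exists_lt_floquetEigenvalue_three
  have hcompact : IsCompact (bandFunction 3 '' brillouinZone) :=
    (isCompact_Icc.prod isCompact_Icc).image continuous_bandFunction_three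
  have hconn : IsConnected (bandFunction 3 '' brillouinZone) :=
    IsConnected.image ⟨⟨ka, hka⟩, (isPreconnected_Icc.prod isPreconnected_Icc)⟩ _
      continuous_bandFunction_three.continuousOn
  have himage := eq_Icc_of_connected_compact hconn hcompact
  set a := sInf (bandFunction 3 '' brillouinZone)
  set b := sSup (bandFunction 3 '' brillouinZone)
  have hmem : ∀ k ∈ brillouinZone, a ≤ bandFunction 3 k ∧ bandFunction 3 k ≤ b := fun k hk => by
    have h : bandFunction 3 k ∈ Set.Icc a b := himage ▸ Set.mem_image_of_mem _ hk
    exact h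
  have harccos : ∀ {x y : ℝ}, -1 ≤ x → x < y → y ≤ 1 →
      Real.arccos y ^ 2 < Real.arccos x ^ 2 := fun hx hxy hy => by
    have := Real.arccos_lt_arccos hx hxy hy
    have := Real.arccos_nonneg
    gcongr
    exact this _
  have habs := fun k => abs_le.1 (abs_floquetEigenvalue_le_one k 3)
  have hab : a < b := by
    refine (hmem ka hka).1.trans_lt (lt_of_lt_of_le ?_ (hmem kb hkb).2)
    rw [bandFunction_three, bandFunction_three]
    exact harccos (habs kb).1 (by linarith) (habs ka).2
  -- the energies that correspond to the separating values `-1/4` and `-11/20`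
  set A := Real.arccos (-1 / 4) ^ 2
  set B := Real.arccos (-11 / 20) ^ 2
  have hband : ∀ k, A < bandFunction 3 k ∧ bandFunction 3 k < B := fun k => by
    rw [bandFunction_three]
    have h := floquetEigenvalue_separation k
    exact ⟨harccos (habs k).1 h.2.2.1 (by norm_num), harccos (by norm_num) h.2.1 (habs k).2⟩
  obtain ⟨k₁, hk₁, hk₁a⟩ : a ∈ bandFunction 3 '' brillouinZone := himage ▸ Set.left_mem_Icc.2 hab.le
  obtain ⟨k₂, hk₂, hk₂b⟩ : b ∈ bandFunction 3 '' brillouinZone :=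
    himage ▸ Set.right_mem_Icc.2 hab.le
  have hAa : A < a := hk₁a ▸ (hband k₁).1
  have hbB : b < B := hk₂b ▸ (hband k₂).2
  obtain ⟨ε, hε, hεa, hεb⟩ : ∃ ε > 0, ε ≤ a - A ∧ ε ≤ B - b :=
    ⟨min (a - A) (B - b), lt_min (by linarith) (by linarith), min_le_left _ _, min_le_right _ _⟩
  have hwindow : ∀ t ∈ Set.Icc (a - ε) (b + ε), ∃ ω : ℝ, ω ^ 2 = t ∧ 0 < ω ∧ ω < Real.pi ∧
      Real.cos ω ∈ Set.Icc (-11 / 20 : ℝ) (-1 / 4) := by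
    intro t ht
    have htA : A ≤ t := by linarith [ht.1]
    have htB : t ≤ B := by linarith [ht.2]
    have hA0 : 0 < Real.arccos (-1 / 4) := Real.arccos_pos.2 (by norm_num)
    have ht0 : 0 < t := lt_of_lt_of_le (by positivity) htA
    have h1 : Real.arccos (-1 / 4) ≤ Real.sqrt t := Real.le_sqrt_of_sq_le htA
    have h2 : Real.sqrt t ≤ Real.arccos (-11 / 20) :=
      (Real.sqrt_le_left (Real.arccos_nonneg _)).2 htB
    have h3 : Real.arccos (-11 / 20) < Real.pi := by
      refine (Real.arccos_le_pi _).lt_of_ne fun h => ?_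
      rw [Real.arccos_eq_pi] at h
      norm_num at h
    refine ⟨Real.sqrt t, Real.sq_sqrt ht0.le, Real.sqrt_pos.2 ht0, h2.trans_lt h3, ?_, ?_⟩
    · rw [← Real.cos_arccos (show (-1 : ℝ) ≤ -11 / 20 by norm_num) (by norm_num)]
      exact Real.cos_le_cos_of_nonneg_of_le_pi (Real.sqrt_nonneg t) h3.le h2
    · conv_rhs => rw [← Real.cos_arccos (show (-1 : ℝ) ≤ -1 / 4 by norm_num) (by norm_num)]
      exact Real.cos_le_cos_of_nonneg_of_le_pi hA0.le (h2.trans h3.le) h1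
  have hsin : ∀ {ω : ℝ}, 0 < ω → ω < Real.pi → Complex.sin ω ≠ 0 := fun h0 h1 => by
    rw [← Complex.ofReal_sin]
    exact_mod_cast (Real.sin_pos_of_pos_of_lt_pi h0 h1).ne'
  have hunique : ∀ k, ∀ t ∈ Set.Icc (a - ε) (b + ε), IsBlochEigenvalue k (t : ℂ) →
      t = bandFunction 3 k := by
    intro k t ht hB
    obtain ⟨ω, rfl, h0, h1, h2⟩ := hwindow t ht
    rw [Complex.ofReal_pow, isBlochEigenvalue_sq_iff_cos k (hsin h0 h1)] at hB
    exact (isBlochEigenvalue_iff_eq_bandFunction_three k h0.le h1 h2).1 hB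
  refine ⟨3, a, b, ε, hab, hε, himage, fun t ht => ?_, fun k _ =>
    ⟨finrank_blochEigenspace_bandFunction_three k, hunique k⟩, fun k hk hor => ?_⟩
  · rw [← himage]
    obtain ⟨ω, rfl, h0, h1, h2⟩ := hwindow t ht
    rw [Complex.ofReal_pow, hspec _ (hsin h0 h1)]
    simp only [isBlochEigenvalue_iff_eq_bandFunction_three _ h0.le h1 h2]
    exact ⟨fun ⟨k, hk, h⟩ => ⟨k, hk, h.symm⟩, fun ⟨k, hk, h⟩ => ⟨k, hk, h.symm⟩⟩
  · by_contra hnot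
    obtain ⟨h1, h2⟩ := floquetEigenvalue_three_mem_of_notMem hk hnot
    rcases hor with h | h
    · have h3 := hunique k a ⟨by linarith, by linarith⟩ h
      have h4 := (hmem ka hka).1
      rw [h3, bandFunction_three, bandFunction_three] at h4
      exact absurd h4 (not_le.2 (harccos (habs k).1 (by linarith) (habs ka).2))
    · have h3 := hunique k b ⟨by linarith, by linarith⟩ h
      have h4 := (hmem kb hkb).2
      rw [h3, bandFunction_three, bandFunction_three] at h4
      exact absurd h4 (not_le.2 (harccos (habs kb).1 (by linarith) (habs k).2))

/-! ### Operators between spaces of square summable families -/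

section lpLift

variable {ι κ X Y : Type*} [NormedAddCommGroup X] [NormedSpace ℂ X] [NormedAddCommGroup Y]
  [NormedSpace ℂ Y]

theorem sum_norm_lift_rpow_le (σ : ι → κ) (T : ι → X →L[ℂ] Y) {C : ℝ} (hC : 0 ≤ C)
    (hT : ∀ i, ‖T i‖ ≤ C) (hσ : Set.InjOn σ {i | T i ≠ 0}) (x : lp (fun _ : κ => X) 2)
    (s : Finset ι) :
    ∑ i ∈ s, ‖T i (x (σ i))‖ ^ (2 : ℝ≥0∞).toReal ≤ (C * ‖x‖) ^ (2 : ℝ≥0∞).toReal := by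
  classical
  have h2 : 0 < (2 : ℝ≥0∞).toReal := by norm_num
  calc ∑ i ∈ s, ‖T i (x (σ i))‖ ^ (2 : ℝ≥0∞).toReal
      = ∑ i ∈ s with T i ≠ 0, ‖T i (x (σ i))‖ ^ (2 : ℝ≥0∞).toReal := by
        refine (Finset.sum_filter_of_ne fun i _ hi => ?_).symm
        rintro h0
        simp [h0] at hi
    _ ≤ ∑ i ∈ s with T i ≠ 0, C ^ (2 : ℝ≥0∞).toReal * ‖x (σ i)‖ ^ (2 : ℝ≥0∞).toReal := by
        refine Finset.sum_le_sum fun i _ => ?_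
        rw [← Real.mul_rpow hC (norm_nonneg _)]
        exact Real.rpow_le_rpow (norm_nonneg _) ((T i).le_of_opNorm_le (hT i) _) h2.le
    _ = C ^ (2 : ℝ≥0∞).toReal *
          ∑ j ∈ (s.filter fun i => T i ≠ 0).image σ, ‖x j‖ ^ (2 : ℝ≥0∞).toReal := by
        rw [Finset.sum_image, Finset.mul_sum]
        intro i hi j hj hij
        exact hσ (Finset.mem_filter.1 hi).2 (Finset.mem_filter.1 hj).2 hij
    _ ≤ (C * ‖x‖) ^ (2 : ℝ≥0∞).toReal := by
        rw [Real.mul_rpow hC (norm_nonneg _)]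
        gcongr
        exact lp.sum_rpow_le_norm_rpow h2 x _

/-- The operator `x ↦ (i ↦ T i (x (σ i)))` between spaces of square summable families. It is
bounded if the operators `T i` are uniformly bounded and `σ` is injective on the set of the `i` with
`T i ≠ 0`. -/
def lpLift (σ : ι → κ) (T : ι → X →L[ℂ] Y) {C : ℝ} (hC : 0 ≤ C) (hT : ∀ i, ‖T i‖ ≤ C)
    (hσ : Set.InjOn σ {i | T i ≠ 0}) : lp (fun _ : κ => X) 2 →L[ℂ] lp (fun _ : ι => Y) 2 :=
  LinearMap.mkContinuous
    { toFun := fun x => ⟨fun i => T i (x (σ i)),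
        memℓp_gen' (sum_norm_lift_rpow_le σ T hC hT hσ x)⟩
      map_add' := fun x y => lp.ext (funext fun i => (T i).map_add (x (σ i)) (y (σ i)))
      map_smul' := fun c x => lp.ext (funext fun i => (T i).map_smul c (x (σ i))) } C
    fun x => lp.norm_le_of_forall_sum_le (by norm_num) (by positivity)
      (sum_norm_lift_rpow_le σ T hC hT hσ x)

theorem norm_lpLift_le (σ : ι → κ) (T : ι → X →L[ℂ] Y) {C : ℝ} (hC : 0 ≤ C)
    (hT : ∀ i, ‖T i‖ ≤ C) (hσ : Set.InjOn σ {i | T i ≠ 0}) : ‖lpLift σ T hC hT hσ‖ ≤ C :=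
  LinearMap.mkContinuous_norm_le _ hC _

end lpLift

/-- The space `ℓ²(ℤ²)`. -/
abbrev Lattice : Type := lp (fun _ : ℤ × ℤ => ℂ) 2

/-- The translation `x ↦ (p ↦ x (p + q))` on `ℓ²(ℤ²)`. -/
def shift (q : ℤ × ℤ) : Lattice →L[ℂ] Lattice :=
  lpLift (fun p => p + q) (fun _ => ContinuousLinearMap.id ℂ ℂ) zero_le_one
    (fun _ => ContinuousLinearMap.norm_id_le) ((add_left_injective q).injOn)

@[simp] theorem shift_apply (q : ℤ × ℤ) (x : Lattice) (p : ℤ × ℤ) : shift q x p = x (p + q) := rfl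

theorem norm_shift_le (q : ℤ × ℤ) : ‖shift q‖ ≤ 1 :=
  norm_lpLift_le _ _ _ _ _

theorem shift_mul_shift (q q' : ℤ × ℤ) : shift q * shift q' = shift (q + q') := by
  ext x p
  exact congrArg x (add_assoc p q q')

theorem shift_zero : shift 0 = 1 := by
  ext x p
  exact congrArg x (add_zero p)

/-- The operator that applies the functional `ℓ` on the edges of class `i`. -/
def edgeFunctional (i : Fin 8) (ℓ : L2Edge →L[ℂ] ℂ) : L2G →L[ℂ] Lattice :=
  lpLift (fun p => (p, i)) (fun _ => ℓ) (norm_nonneg ℓ) (fun _ => le_rfl)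
    (fun _ _ _ _ h => (Prod.mk.inj h).1)

@[simp] theorem edgeFunctional_apply (i : Fin 8) (ℓ : L2Edge →L[ℂ] ℂ) (g : L2G) (p : ℤ × ℤ) :
    edgeFunctional i ℓ g p = ℓ (g (p, i)) := rfl

/-- The operator that applies `T` on every edge. -/
def edgeMap (T : L2Edge →L[ℂ] L2Edge) : L2G →L[ℂ] L2G :=
  lpLift id (fun _ => T) (norm_nonneg T) (fun _ => le_rfl) (Function.injective_id.injOn)

@[simp] theorem edgeMap_apply (T : L2Edge →L[ℂ] L2Edge) (g : L2G) (e : Edge) :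
    edgeMap T g e = T (g e) := rfl

/-- The function on the edges of class `i` that is `x p • w` on the edge in the cell `p`. -/
def edgeSpread (i : Fin 8) (w : L2Edge) : Lattice →L[ℂ] L2G :=
  lpLift (fun e : Edge => e.1)
    (fun e => if e.2 = i then ContinuousLinearMap.toSpanSingleton ℂ w else 0)
    (norm_nonneg (ContinuousLinearMap.toSpanSingleton ℂ w))
    (fun e => by
      split_ifs
      · exact le_rfl
      · simp)
    (fun e he e' he' h => by
      have h1 : e.2 = i := by
        by_contra h1
        simp [h1] at he
      have h2 : e'.2 = i := by
        by_contra h2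
        simp [h2] at he'
      exact Prod.ext h (h1.trans h2.symm))

theorem edgeSpread_apply (i : Fin 8) (w : L2Edge) (x : Lattice) (e : Edge) :
    edgeSpread i w x e = if e.2 = i then x e.1 • w else 0 := by
  change (if e.2 = i then ContinuousLinearMap.toSpanSingleton ℂ w else 0) (x e.1) = _
  split_ifs <;> rfl

/-- The function on the vertices with the values `φ a p` at `(p, a)`. -/
def vertexFun (φ : Fin 5 → Lattice) (w : Vertex) : ℂ := φ w.2 w.1

/-- The part of `spread` that concerns the edges of class `i`. -/
def spreadClass (w₀ w₁ : L2Edge) (i : Fin 8) : (Fin 5 → Lattice) →L[ℂ] L2G :=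
  edgeSpread i w₀ ∘L ContinuousLinearMap.proj (srcIdx i)
    + edgeSpread i w₁ ∘L shift (tgtCell i) ∘L ContinuousLinearMap.proj (tgtIdx i)

/-- The operator that maps the vertex function `φ` to the function with the restriction
`φ (src e) • w₀ + φ (tgt e) • w₁` to the edge `e`. -/
def spread (w₀ w₁ : L2Edge) : (Fin 5 → Lattice) →L[ℂ] L2G := ∑ i, spreadClass w₀ w₁ i

theorem spreadClass_apply (w₀ w₁ : L2Edge) (i : Fin 8) (φ : Fin 5 → Lattice) (e : Edge) :
    spreadClass w₀ w₁ i φ e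
      = if e.2 = i then vertexFun φ (src e) • w₀ + vertexFun φ (tgt e) • w₁ else 0 := by
  change edgeSpread i w₀ (φ (srcIdx i)) e + edgeSpread i w₁ (shift (tgtCell i) (φ (tgtIdx i))) e
    = _
  rw [edgeSpread_apply, edgeSpread_apply]
  split_ifs with hi
  · subst hi
    rfl
  · simp

theorem spread_apply (w₀ w₁ : L2Edge) (φ : Fin 5 → Lattice) (e : Edge) :
    spread w₀ w₁ φ e = vertexFun φ (src e) • w₀ + vertexFun φ (tgt e) • w₁ := by
  rw [spread, sum_apply, lp.coeFn_sum, Finset.sum_apply]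
  simp only [spreadClass_apply]
  simp

/-- The action of a matrix of operators. -/
def matrixOp (N : Matrix (Fin 5) (Fin 5) (Lattice →L[ℂ] Lattice)) :
    (Fin 5 → Lattice) →L[ℂ] (Fin 5 → Lattice) :=
  ContinuousLinearMap.pi fun a => ∑ b, N a b ∘L ContinuousLinearMap.proj b

theorem matrixOp_apply (N : Matrix (Fin 5) (Fin 5) (Lattice →L[ℂ] Lattice))
    (φ : Fin 5 → Lattice) (a : Fin 5) : matrixOp N φ a = ∑ b, N a b (φ b) := by
  simp [matrixOp]

theorem matrixOp_one (φ : Fin 5 → Lattice) : matrixOp 1 φ = φ := by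
  funext a
  rw [matrixOp_apply, Finset.sum_eq_single a]
  · simp
  · intro b _ hb
    simp [Matrix.one_apply_ne hb.symm]
  · simp

theorem matrixOp_mul (M N : Matrix (Fin 5) (Fin 5) (Lattice →L[ℂ] Lattice))
    (φ : Fin 5 → Lattice) : matrixOp (M * N) φ = matrixOp M (matrixOp N φ) := by
  funext a
  simp only [matrixOp_apply, Matrix.mul_apply, sum_apply, map_sum]
  rw [Finset.sum_comm]
  rfl

/-- The matrix of translations `μ S² - A`, where `A` is the adjacency operator of `Γ`. -/
def translationMatrix (μ : ℂ) : Matrix (Fin 5) (Fin 5) (Lattice →L[ℂ] Lattice) :=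
  Matrix.diagonal (fun a => algebraMap ℂ (Lattice →L[ℂ] Lattice) (μ * deg a))
    - floquetMatrix (shift (1, 0)) (shift (-1, 0)) (shift (0, 1)) (shift (0, -1))

theorem sum_outEdges (v : Vertex) {M : Type*} [AddCommMonoid M] (f : Edge → M) :
    ∑ e ∈ outEdges v, f e = ∑ i, if srcIdx i = v.2 then f (v.1, i) else 0 := by
  rw [outEdges, Finset.sum_image fun i _ j _ h => (Prod.mk.inj h).2, Finset.sum_filter]

theorem sum_inEdges (v : Vertex) {M : Type*} [AddCommMonoid M] (f : Edge → M) :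
    ∑ e ∈ inEdges v, f e = ∑ i, if tgtIdx i = v.2 then f (v.1 - tgtCell i, i) else 0 := by
  rw [inEdges, Finset.sum_image fun i _ j _ h => (Prod.mk.inj h).2, Finset.sum_filter]

theorem matrixOp_translationMatrix_apply (μ : ℂ) (φ : Fin 5 → Lattice) (w : Vertex) :
    vertexFun (matrixOp (translationMatrix μ) φ) w = μ * (deg w.2 * vertexFun φ w)
      - (∑ e ∈ outEdges w, vertexFun φ (tgt e) + ∑ e ∈ inEdges w, vertexFun φ (src e)) := by
  obtain ⟨p, a⟩ := w
  rw [sum_outEdges, sum_inEdges, vertexFun, matrixOp_apply]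
  simp only [vertexFun, src, tgt, sub_eq_add_neg]
  have hdiag : ∑ b, translationMatrix μ a b (φ b) = (μ * deg a) • φ a
      - ∑ b, floquetMatrix (shift (1, 0)) (shift (-1, 0)) (shift (0, 1)) (shift (0, -1)) a b
          (φ b) := by
    simp only [translationMatrix, Matrix.sub_apply, sub_apply,
      Finset.sum_sub_distrib]
    congr 1
    rw [Finset.sum_eq_single a]
    · rw [Matrix.diagonal_apply_eq, Algebra.algebraMap_eq_smul_one]
      rfl
    · intro b _ hb
      rw [Matrix.diagonal_apply_ne _ hb.symm]
      rfl
    · simp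
  rw [hdiag, lp.coeFn_sub, Pi.sub_apply, lp.coeFn_smul, Pi.smul_apply, smul_eq_mul, mul_assoc,
    lp.coeFn_sum, Finset.sum_apply]
  congr 1
  clear hdiag
  have h00 : p + ((0 : ℤ), (0 : ℤ)) = p := add_zero p
  fin_cases a <;>
    simp [Fin.sum_univ_succ, srcIdx, tgtIdx, tgtCell, floquetMatrix, h00] <;> ring

/-! ### Inversion of matrices of commuting operators -/

theorem map_floquetMatrix {R T : Type*} [Ring R] [Ring T] (f : R →+* T) (x x' y y' : R) :
    (floquetMatrix x x' y y').map f = floquetMatrix (f x) (f x') (f y) (f y') := by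
  ext a b
  fin_cases a <;> fin_cases b <;> simp [floquetMatrix]

section Gelfand

variable {A : Type*} [NormedRing A] [NormedAlgebra ℂ A] [CompleteSpace A] [NormOneClass A]

/-- A matrix of the form `x S² - Δ`, with the Floquet multipliers replaced by commuting invertible
isometries, is invertible if its determinant has no zero on the torus. By Gelfand theory, the
determinant is a unit of the commutative Banach algebra generated by these elements, because a
character of that algebra maps them to complex numbers of modulus one. -/
theorem exists_inverse_sub_floquetMatrix {u u' v v' : A} (hu : u * u' = 1) (hu' : u' * u = 1)
    (hv : v * v' = 1) (hv' : v' * v = 1) (huv : Commute u v) (huv' : Commute u v')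
    (hu'v : Commute u' v) (hu'v' : Commute u' v') (nu : ‖u‖ ≤ 1) (nu' : ‖u'‖ ≤ 1) (nv : ‖v‖ ≤ 1)
    (nv' : ‖v'‖ ≤ 1) (μ : ℂ)
    (hdet : ∀ ζ ξ : ℂ, ‖ζ‖ = 1 → ‖ξ‖ = 1 →
      (Matrix.diagonal (fun a => μ * (deg a : ℂ)) - floquetMatrix ζ ζ⁻¹ ξ ξ⁻¹).det ≠ 0) :
    ∃ N : Matrix (Fin 5) (Fin 5) A,
      (Matrix.diagonal (fun a => algebraMap ℂ A (μ * deg a)) - floquetMatrix u u' v v') * N = 1 ∧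
      N * (Matrix.diagonal (fun a => algebraMap ℂ A (μ * deg a)) - floquetMatrix u u' v v')
        = 1 := by
  set s : Set A := {u, u', v, v'} with hs
  set S : Subalgebra ℂ A := Subalgebra.centralizer ℂ (Subalgebra.centralizer ℂ s : Set A) with hS
  have hsub : s ⊆ (Subalgebra.centralizer ℂ s : Set A) := by
    intro x hx y hy
    have c1 : u * u' = u' * u := hu.trans hu'.symm
    have c2 : v * v' = v' * v := hv.trans hv'.symm
    have e1 := huv.eq
    have e2 := huv'.eq
    have e3 := hu'v.eq
    have e4 := hu'v'.eq
    simp only [hs, Set.mem_insert_iff, Set.mem_singleton_iff] at hx hy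
    rcases hx with rfl | rfl | rfl | rfl <;> rcases hy with rfl | rfl | rfl | rfl <;>
      simp only [*]
  have hmemS : ∀ x ∈ s, x ∈ S := fun x hx y hy => (hy x hx).symm
  have hcomm : ∀ x y : S, x * y = y * x := fun x y => Subtype.ext
    (y.2 x.1 fun z hz => x.2 z (hsub hz))
  have hclosed : IsClosed (S : Set A) := Set.isClosed_centralizer _
  let _ : NormedCommRing S :=
    { (inferInstance : NormedRing S) with mul_comm := hcomm }
  have _ : CompleteSpace S := hclosed.completeSpace_coe
  have _ : NormOneClass S := ⟨(norm_one : ‖(1 : A)‖ = 1)⟩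
  set U : S := ⟨u, hmemS u (by simp [hs])⟩
  set U' : S := ⟨u', hmemS u' (by simp [hs])⟩
  set V : S := ⟨v, hmemS v (by simp [hs])⟩
  set V' : S := ⟨v', hmemS v' (by simp [hs])⟩
  set M : Matrix (Fin 5) (Fin 5) S :=
    Matrix.diagonal (fun a => algebraMap ℂ S (μ * deg a)) - floquetMatrix U U' V V' with hM
  have hunit : IsUnit M.det := by
    by_contra hnot
    obtain ⟨χ, hχ⟩ := WeakDual.CharacterSpace.exists_apply_eq_zero hnot
    have hnorm : ∀ x : S, ‖χ x‖ ≤ ‖x‖ := fun x =>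
      AlgHom.norm_apply_le_self (WeakDual.CharacterSpace.toAlgHom χ) x
    have hone : ∀ x x' : S, x * x' = 1 → ‖x‖ ≤ 1 → ‖x'‖ ≤ 1 →
        ‖χ x‖ = 1 ∧ χ x' = (χ x)⁻¹ := by
      intro x x' hx h1 h2
      have h3 : χ x * χ x' = 1 := by rw [← map_mul, hx, map_one]
      have h4 : ‖χ x‖ * ‖χ x'‖ = 1 := by rw [← norm_mul, h3, norm_one]
      have h5 := (hnorm x).trans h1
      have h6 := (hnorm x').trans h2
      refine ⟨le_antisymm h5 ?_, eq_inv_of_mul_eq_one_right h3⟩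
      rw [← h4]
      exact mul_le_of_le_one_right (norm_nonneg _) h6
    obtain ⟨h1, h1'⟩ := hone U U' (Subtype.ext hu) nu nu'
    obtain ⟨h2, h2'⟩ := hone V V' (Subtype.ext hv) nv nv'
    refine hdet (χ U) (χ V) h1 h2 ?_
    set f : S →+* ℂ := (WeakDual.CharacterSpace.toAlgHom χ : S →ₐ[ℂ] ℂ).toRingHom
    have h3 : f M.det = 0 := hχ
    rw [RingHom.map_det, RingHom.mapMatrix_apply, hM, Matrix.map_sub f (map_sub f),
      map_floquetMatrix, Matrix.diagonal_map (map_zero f)] at h3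
    rw [← h1', ← h2', ← h3]
    congr 2
    exact congrArg _ (funext fun a =>
      ((WeakDual.CharacterSpace.toAlgHom χ).commutes (μ * deg a)).symm)
  have hMA : M.map S.val = Matrix.diagonal (fun a => algebraMap ℂ A (μ * deg a))
      - floquetMatrix u u' v v' := by
    rw [hM, Matrix.map_sub S.val (map_sub S.val)]
    rw [Matrix.diagonal_map (map_zero S.val)]
    exact congrArg₂ _ rfl (map_floquetMatrix (S.val : S →ₐ[ℂ] A).toRingHom U U' V V')
  refine ⟨(M⁻¹).map S.val, ?_, ?_⟩
  · rw [← hMA, ← Matrix.map_mul, Matrix.mul_nonsing_inv _ hunit]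
    exact Matrix.map_one _ (map_zero _) (map_one _)
  · rw [← hMA, ← Matrix.map_mul, Matrix.nonsing_inv_mul _ hunit]
    exact Matrix.map_one _ (map_zero _) (map_one _)

end Gelfand

/-! ### The inverse of the discrete operator -/

instance : Nontrivial Lattice :=
  ⟨⟨lp.single 2 (0 : ℤ × ℤ) (1 : ℂ), 0, fun h => by
    have h1 := congrFun (congrArg Subtype.val h) (0 : ℤ × ℤ)
    simp at h1⟩⟩

theorem hasEigenvalue_LMatrix_of_det_eq_zero {k : ℝ × ℝ} {μ : ℂ}
    (h : (Matrix.diagonal (fun a => μ * (deg a : ℂ)) - DeltaMatrix k).det = 0) :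
    Module.End.HasEigenvalue (Matrix.toLin' (LMatrix k)) μ := by
  obtain ⟨c, hc, hc'⟩ := Matrix.exists_mulVec_eq_zero_iff.2 h
  refine Module.End.hasEigenvalue_of_hasEigenvector (x := sqrtDegDiv.symm c)
    ⟨(mem_eigenspace_LMatrix_iff k μ _).2 fun a => ?_, by simpa using hc⟩
  rw [LinearEquiv.apply_symm_apply]
  have h1 := congrFun hc' a
  rw [Matrix.sub_mulVec, Pi.sub_apply, Matrix.mulVec_diagonal, Pi.zero_apply, sub_eq_zero] at h1
  rw [← h1, mul_assoc]

/-- If `μ` is not in the spectrum of any `L(k)`, then the operator `μ S² - A` on `ℓ²` of the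
vertices is invertible. -/
theorem exists_inverse_translationMatrix {μ : ℂ}
    (h : ¬ ∃ k ∈ brillouinZone, Module.End.HasEigenvalue (Matrix.toLin' (LMatrix k)) μ) :
    ∃ N, translationMatrix μ * N = 1 ∧ N * translationMatrix μ = 1 := by
  have hc : ∀ q q', Commute (shift q) (shift q') := fun q q' => by
    rw [Commute, SemiconjBy, shift_mul_shift, shift_mul_shift, add_comm]
  have hone : ∀ q q' : ℤ × ℤ, q + q' = 0 → shift q * shift q' = 1 := fun q q' hq => by
    rw [shift_mul_shift, hq, shift_zero]
  refine exists_inverse_sub_floquetMatrix (hone _ _ rfl) (hone _ _ rfl) (hone _ _ rfl)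
    (hone _ _ rfl) (hc _ _) (hc _ _) (hc _ _) (hc _ _) (norm_shift_le _) (norm_shift_le _)
    (norm_shift_le _) (norm_shift_le _) μ fun ζ ξ hζ hξ h0 => h ?_
  have harg : ∀ z : ℂ, ‖z‖ = 1 → Complex.exp (Complex.I * (z.arg : ℂ)) = z := fun z hz => by
    have h1 := Complex.norm_mul_exp_arg_mul_I z
    rwa [hz, Complex.ofReal_one, one_mul, mul_comm] at h1
  refine ⟨(ζ.arg, ξ.arg), ⟨⟨(Complex.neg_pi_lt_arg ζ).le, Complex.arg_le_pi ζ⟩,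
    ⟨(Complex.neg_pi_lt_arg ξ).le, Complex.arg_le_pi ξ⟩⟩,
    hasEigenvalue_LMatrix_of_det_eq_zero ?_⟩
  rw [DeltaMatrix_eq_floquetMatrix, Complex.exp_neg, Complex.exp_neg, harg ζ hζ, harg ξ hξ]
  exact h0

/-! ### Approximate eigenvectors of the translations -/

theorem abs_pow_sub_pow_le {r : ℝ} (h0 : 0 < r) (h1 : r ≤ 1) {m n : ℕ} (hmn : m ≤ n + 1)
    (hnm : n ≤ m + 1) : |r ^ m - r ^ n| ≤ (r⁻¹ - 1) * r ^ n := by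
  have hr : 1 - r ≤ r⁻¹ - 1 := by
    rw [← sub_nonneg, show r⁻¹ - 1 - (1 - r) = (1 - r) ^ 2 * r⁻¹ by field_simp]
    positivity
  rcases (by omega : m = n ∨ m = n + 1 ∨ n = m + 1) with rfl | rfl | rfl
  · rw [sub_self, abs_zero]
    exact mul_nonneg (by linarith) (by positivity)
  · rw [abs_of_nonpos (by rw [pow_succ]; nlinarith [pow_pos h0 n]), pow_succ]
    nlinarith [pow_pos h0 n]
  · rw [abs_of_nonneg (by rw [pow_succ]; nlinarith [pow_pos h0 m]), pow_succ]
    apply le_of_eq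
    field_simp

theorem norm_phase (k : ℝ × ℝ) (p : ℤ × ℤ) : ‖phase k p‖ = 1 := by
  rw [phase, mul_comm]
  exact_mod_cast Complex.norm_exp_ofReal_mul_I (p.1 * k.1 + p.2 * k.2)

/-- The plane wave `phase k` becomes square summable after multiplication with the slowly decaying
weight `r ^ (|p₁| + |p₂|)`. -/
theorem memℓp_weight {r : ℝ} (h0 : 0 < r) (h1 : r < 1) (k : ℝ × ℝ) :
    Memℓp (fun p : ℤ × ℤ => ((r ^ (p.1.natAbs + p.2.natAbs) : ℝ) : ℂ) * phase k p) 2 := by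
  refine memℓp_gen ?_
  have hgeo : Summable fun n : ℤ => (r ^ 2) ^ n.natAbs := by
    have h2 : Summable fun n : ℕ => (r ^ 2) ^ n :=
      summable_geometric_of_lt_one (by positivity) (by nlinarith)
    refine Summable.of_nat_of_neg ?_ ?_ <;> simpa using h2
  refine (hgeo.mul_of_nonneg hgeo (fun _ => by positivity) (fun _ => by positivity)).congr
    fun p => ?_
  rw [norm_mul, norm_phase, mul_one, Complex.norm_real, Real.norm_of_nonneg (by positivity)]
  norm_num
  ring

/-- The translations have a common approximate eigenvector for the eigenvalues `phase k`. -/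
theorem exists_approximate_eigenvector (k : ℝ × ℝ) {δ : ℝ} (hδ : 0 < δ) :
    ∃ x : Lattice, ‖x‖ = 1 ∧ ∀ q : ℤ × ℤ, q.1.natAbs + q.2.natAbs ≤ 1 →
      ‖shift q x - phase k q • x‖ ≤ δ := by
  -- The weights of neighbouring points differ by a relative error of at most `r⁻¹ - 1`.
  set r : ℝ := (1 + δ)⁻¹ with hr
  have h0 : 0 < r := by positivity
  have h1 : r < 1 := inv_lt_one_of_one_lt₀ (by linarith)
  have hrδ : r⁻¹ - 1 = δ := by rw [hr, inv_inv]; ring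
  set y : Lattice := ⟨_, memℓp_weight h0 h1 k⟩ with hy
  have hyapply : ∀ p, y p = ((r ^ (p.1.natAbs + p.2.natAbs) : ℝ) : ℂ) * phase k p := fun _ => rfl
  have hy0 : y ≠ 0 := fun h => by
    have h2 := hyapply 0
    rw [h] at h2
    simp [phase_zero] at h2
  have hnorm : ∀ p, ‖y p‖ = r ^ (p.1.natAbs + p.2.natAbs) := fun p => by
    rw [hyapply, norm_mul, norm_phase, mul_one, Complex.norm_real,
      Real.norm_of_nonneg (by positivity)]
  have hshift : ∀ q : ℤ × ℤ, q.1.natAbs + q.2.natAbs ≤ 1 →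
      ‖shift q y - phase k q • y‖ ≤ δ * ‖y‖ := by
    intro q hq
    refine lp.norm_le_of_forall_sum_le (by norm_num) (by positivity) fun s => ?_
    have hpt : ∀ p, ‖(shift q y - phase k q • y : Lattice) p‖ ≤ δ * ‖y p‖ := fun p => by
      rw [lp.coeFn_sub, Pi.sub_apply, lp.coeFn_smul, Pi.smul_apply, shift_apply, hnorm, hyapply,
        hyapply, phase_add, smul_eq_mul]
      rw [show ∀ a b c d : ℂ, a * (b * c) - c * (d * b) = (a - d) * (b * c) by intros; ring,
        norm_mul, norm_mul, norm_phase, norm_phase, mul_one, mul_one, ← Complex.ofReal_sub,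
        Complex.norm_real, Real.norm_eq_abs, ← hrδ]
      refine abs_pow_sub_pow_le h0 h1.le ?_ ?_ <;> simp only [Prod.fst_add, Prod.snd_add] <;> omega
    rw [Real.mul_rpow hδ.le (norm_nonneg _)]
    refine le_trans ?_ (mul_le_mul_of_nonneg_left
      (lp.sum_rpow_le_norm_rpow (p := 2) (by norm_num) y s) (by positivity))
    rw [Finset.mul_sum]
    refine Finset.sum_le_sum fun p _ => ?_
    rw [← Real.mul_rpow hδ.le (norm_nonneg _)]
    exact Real.rpow_le_rpow (norm_nonneg _) (hpt p) (by norm_num)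
  have hypos : 0 < ‖y‖ := norm_pos_iff.2 hy0
  refine ⟨((‖y‖⁻¹ : ℝ) : ℂ) • y, ?_, fun q hq => ?_⟩
  · rw [norm_smul, Complex.norm_real, norm_inv, norm_norm, inv_mul_cancel₀ hypos.ne']
  · rw [map_smul, smul_comm (phase k q), ← smul_sub, norm_smul, Complex.norm_real, norm_inv,
      norm_norm, inv_mul_le_iff₀ hypos, mul_comm]
    exact hshift q hq

/-- An eigenvector of `L(k)` yields approximate solutions of the discrete eigenvalue equation. -/
theorem tendsto_matrixOp_translationMatrix {k : ℝ × ℝ} {μ : ℂ} {c : Fin 5 → ℂ}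
    (hc : ∀ a, (DeltaMatrix k).mulVec c a = μ * (deg a * c a)) {x : ℕ → Lattice}
    (hx : ∀ q : ℤ × ℤ, q.1.natAbs + q.2.natAbs ≤ 1 →
      Filter.Tendsto (fun n => shift q (x n) - phase k q • x n) Filter.atTop (nhds 0)) :
    Filter.Tendsto (fun n => matrixOp (translationMatrix μ) fun b => c b • x n) Filter.atTop
      (nhds 0) := by
  rw [tendsto_pi_nhds]
  intro a
  have hentry : ∀ b, Filter.Tendsto (fun n =>
      floquetMatrix (shift (1, 0)) (shift (-1, 0)) (shift (0, 1)) (shift (0, -1)) a b (x n)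
        - DeltaMatrix k a b • x n) Filter.atTop (nhds 0) := by
    have h1 := hx (1, 0) (by decide)
    have h2 := hx (-1, 0) (by decide)
    have h3 := hx (0, 1) (by decide)
    have h4 := hx (0, -1) (by decide)
    simp only [phase, Int.cast_one, Int.cast_zero, Int.cast_neg, zero_mul, one_mul, neg_mul,
      add_zero, zero_add, mul_neg] at h1 h2 h3 h4
    intro b
    fin_cases a <;> fin_cases b <;>
      first
        | exact h1
        | exact h2
        | exact h3
        | exact h4
        | simp [floquetMatrix, DeltaMatrix]
  have hsum : Filter.Tendsto (fun n => -∑ b, c b •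
      (floquetMatrix (shift (1, 0)) (shift (-1, 0)) (shift (0, 1)) (shift (0, -1)) a b (x n)
        - DeltaMatrix k a b • x n)) Filter.atTop (nhds 0) := by
    have h := (tendsto_finsetSum Finset.univ fun b _ => (hentry b).const_smul (c b)).neg
    simpa using h
  refine hsum.congr fun n => ?_
  have hdiag : ∑ b, c b • (Matrix.diagonal (fun a => algebraMap ℂ (Lattice →L[ℂ] Lattice)
      (μ * deg a)) a b) (x n) = (μ * deg a * c a) • x n := by
    rw [Finset.sum_eq_single a]
    · rw [Matrix.diagonal_apply_eq, Algebra.algebraMap_eq_smul_one, mul_comm _ (c a),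
        mul_smul (c a)]
      rfl
    · intro b _ hb
      rw [Matrix.diagonal_apply_ne _ hb.symm, zero_apply, smul_zero]
    · simp
  rw [matrixOp_apply]
  simp only [translationMatrix, Matrix.sub_apply, sub_apply, Finset.sum_sub_distrib, hdiag,
    smul_sub, map_smul]
  have h2 : ∑ b, c b • DeltaMatrix k a b • x n = (μ * deg a * c a) • x n := by
    rw [mul_assoc, ← hc a, Matrix.mulVec, dotProduct, Finset.sum_smul]
    exact Finset.sum_congr rfl fun b _ => by rw [smul_smul, mul_comm]
  rw [h2]
  abel

/-! ### The inhomogeneous equation and its reduction to the vertices -/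

/-- The second derivative of the solution of `-u'' - z u = g`, `u(0) = u'(0) = 0`. -/
def cauchySecondDeriv (z : ℂ) : L2Edge →L[ℂ] L2Edge := -volterraInv z

theorem neg_sub_smul_cauchySecondDeriv (z : ℂ) (g : L2Edge) :
    -cauchySecondDeriv z g - z • volterra (volterra (cauchySecondDeriv z g)) = g := by
  conv_rhs => rw [← volterraInv_eq z g]
  simp [cauchySecondDeriv]

theorem cauchySecondDeriv_neg_add (z : ℂ) (s : L2Edge) :
    cauchySecondDeriv z (-(s + z • volterra (volterra s))) = s := by
  rw [map_neg, cauchySecondDeriv, neg_apply, neg_neg, volterraInv_apply_add]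

/-- The value at `1` of the solution of `-u'' - z u = g`, `u(0) = u'(0) = 0`. -/
def cauchyEndValue (z : ℂ) : L2Edge →L[ℂ] ℂ := edgeIntegral ∘L volterra ∘L cauchySecondDeriv z

/-- The derivative at `1` of the solution of `-u'' - z u = g`, `u(0) = u'(0) = 0`. -/
def cauchyEndSlope (z : ℂ) : L2Edge →L[ℂ] ℂ := edgeIntegral ∘L cauchySecondDeriv z

/-- The functional by which the right side `g` on an edge enters the discrete equation at the
terminal vertex of the edge; at the initial vertex it is `cauchyEndValue`. -/
def terminalFunctional (ω : ℂ) : L2Edge →L[ℂ] ℂ :=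
  edgeSin ω 1 • cauchyEndSlope (ω ^ 2) - edgeCos ω 1 • cauchyEndValue (ω ^ 2)

/-- The solution operator of `-u'' - ω² u = g`, `u(0) = u(1) = 0`, if `edgeSin ω 1 ≠ 0`. -/
def dirichletInv (ω : ℂ) : L2Edge →L[ℂ] L2Edge :=
  volterra ∘L volterra ∘L cauchySecondDeriv (ω ^ 2)
    - (cauchyEndValue (ω ^ 2)).smulRight (dirichletLp ω 0 1)

/-- The derivative of `dirichletLp`. -/
def dirichletDerivLp (ω α β : ℂ) : L2Edge := cauchySolDerivLp ω α (initialSlope ω α β)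

/-- The derivative of `dirichletInv`. -/
def dirichletInvDeriv (ω : ℂ) : L2Edge →L[ℂ] L2Edge :=
  volterra ∘L cauchySecondDeriv (ω ^ 2)
    - (cauchyEndValue (ω ^ 2)).smulRight (dirichletDerivLp ω 0 1)

theorem dirichletLp_eq (ω α β : ℂ) :
    dirichletLp ω α β = α • dirichletLp ω 1 0 + β • dirichletLp ω 0 1 := by
  rw [← dirichletLp_smul, ← dirichletLp_smul, ← dirichletLp_add]
  simp

/-- The solution of the boundary value problem `-u'' - ω² u = g`, `u(0) = α`, `u(1) = β`, on one
edge. The representatives are the sum of the solution of the homogeneous equation with boundary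
values `α` and `β - cauchyEndValue (ω ^ 2) g`, and the solution for `g` with zero Cauchy data. -/
theorem isH2Rep_dirichlet (ω α β : ℂ) (g : L2Edge) :
    IsH2Rep (α • dirichletLp ω 1 0 + β • dirichletLp ω 0 1 + dirichletInv ω g)
      (α • dirichletDerivLp ω 1 0 + β • dirichletDerivLp ω 0 1 + dirichletInvDeriv ω g)
      (-(ω ^ 2 • (α • dirichletLp ω 1 0 + β • dirichletLp ω 0 1 + dirichletInv ω g) + g))
      (cauchySol ω α (initialSlope ω α (β - cauchyEndValue (ω ^ 2) g))
        + fun x => ∫ t in (0 : ℝ)..x, volterra (cauchySecondDeriv (ω ^ 2) g) t)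
      (cauchySolDeriv ω α (initialSlope ω α (β - cauchyEndValue (ω ^ 2) g))
        + fun x => ∫ t in (0 : ℝ)..x, cauchySecondDeriv (ω ^ 2) g t) := by
  have h := (isH2Rep_cauchySolLp ω α (initialSlope ω α (β - cauchyEndValue (ω ^ 2) g))).add
    (isH2Rep_volterra (cauchySecondDeriv (ω ^ 2) g))
  have e1 : cauchySolLp ω α (initialSlope ω α (β - cauchyEndValue (ω ^ 2) g))
      + volterra (volterra (cauchySecondDeriv (ω ^ 2) g))
      = α • dirichletLp ω 1 0 + β • dirichletLp ω 0 1 + dirichletInv ω g := by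
    change dirichletLp ω α (β - cauchyEndValue (ω ^ 2) g)
      + volterra (volterra (cauchySecondDeriv (ω ^ 2) g))
      = α • dirichletLp ω 1 0 + β • dirichletLp ω 0 1
        + (volterra (volterra (cauchySecondDeriv (ω ^ 2) g))
          - cauchyEndValue (ω ^ 2) g • dirichletLp ω 0 1)
    rw [dirichletLp_eq, sub_smul]
    abel
  have e2 : cauchySolDerivLp ω α (initialSlope ω α (β - cauchyEndValue (ω ^ 2) g))
      + volterra (cauchySecondDeriv (ω ^ 2) g)
      = α • dirichletDerivLp ω 1 0 + β • dirichletDerivLp ω 0 1 + dirichletInvDeriv ω g := by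
    change _ = _ + (volterra (cauchySecondDeriv (ω ^ 2) g)
      - cauchyEndValue (ω ^ 2) g • dirichletDerivLp ω 0 1)
    simp only [dirichletDerivLp, cauchySolDerivLp, initialSlope]
    module
  have e3 : -(ω ^ 2 • cauchySolLp ω α (initialSlope ω α (β - cauchyEndValue (ω ^ 2) g)))
      + cauchySecondDeriv (ω ^ 2) g
      = -(ω ^ 2 • (α • dirichletLp ω 1 0 + β • dirichletLp ω 0 1 + dirichletInv ω g) + g) := by
    rw [← e1]
    have hs := neg_sub_smul_cauchySecondDeriv (ω ^ 2) g
    generalize cauchySolLp ω α _ = y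
    generalize cauchySecondDeriv (ω ^ 2) g = s at hs ⊢
    rw [← hs]
    module
  rw [e1, e2, e3] at h
  exact h

/-- The right side of the discrete equation, up to the sign: the sum of `cauchyEndValue` over the
outgoing edges and of `terminalFunctional` over the incoming edges, see
`vertexFun_vertexSource`. -/
def vertexSource (ω : ℂ) : L2G →L[ℂ] (Fin 5 → Lattice) :=
  ContinuousLinearMap.pi fun a =>
    (∑ i, if srcIdx i = a then edgeFunctional i (cauchyEndValue (ω ^ 2)) else 0)
      + ∑ i, if tgtIdx i = a then
          shift (-tgtCell i) ∘L edgeFunctional i (terminalFunctional ω) else 0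

theorem vertexFun_vertexSource (ω : ℂ) (g : L2G) (w : Vertex) :
    vertexFun (vertexSource ω g) w = ∑ e ∈ outEdges w, cauchyEndValue (ω ^ 2) (g e)
      + ∑ e ∈ inEdges w, terminalFunctional ω (g e) := by
  obtain ⟨p, a⟩ := w
  rw [sum_outEdges, sum_inEdges, vertexFun, vertexSource, ContinuousLinearMap.pi_apply, add_apply,
    sum_apply, sum_apply, lp.coeFn_add, Pi.add_apply, lp.coeFn_sum, lp.coeFn_sum,
    Finset.sum_apply, Finset.sum_apply]
  congr 1
  · refine Finset.sum_congr rfl fun i _ => ?_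
    split_ifs <;> rfl
  · refine Finset.sum_congr rfl fun i _ => ?_
    split_ifs
    · simp [sub_eq_add_neg]
    · rfl

/-- The solution of `-f'' - ω² f = g` on all edges with the vertex values `φ`, if
`edgeSin ω 1 ≠ 0`. -/
def edgewiseSolution (ω : ℂ) (φ : Fin 5 → Lattice) (g : L2G) : L2G :=
  spread (dirichletLp ω 1 0) (dirichletLp ω 0 1) φ + edgeMap (dirichletInv ω) g

/-- The edgewise solution satisfies the Kirchhoff condition if the vertex values solve the discrete
equation. -/
theorem edgewiseSolution_mem_kirchhoffGraph {ω : ℂ} (hω : edgeSin ω 1 ≠ 0)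
    {φ : Fin 5 → Lattice} {g : L2G}
    (h : matrixOp (translationMatrix (edgeCos ω 1)) φ = -vertexSource ω g) :
    (edgewiseSolution ω φ g, ω ^ 2 • edgewiseSolution ω φ g + g) ∈ kirchhoffGraph := by
  have hF : ∀ e, edgewiseSolution ω φ g e = vertexFun φ (src e) • dirichletLp ω 1 0
      + vertexFun φ (tgt e) • dirichletLp ω 0 1 + dirichletInv ω (g e) := fun e => by
    rw [edgewiseSolution, lp.coeFn_add, Pi.add_apply, spread_apply, edgeMap_apply]
  refine ⟨spread (dirichletDerivLp ω 1 0) (dirichletDerivLp ω 0 1) φ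
    + edgeMap (dirichletInvDeriv ω) g, 
    fun e => cauchySol ω (vertexFun φ (src e)) (initialSlope ω (vertexFun φ (src e))
        (vertexFun φ (tgt e) - cauchyEndValue (ω ^ 2) (g e)))
      + fun x => ∫ t in (0 : ℝ)..x, volterra (cauchySecondDeriv (ω ^ 2) (g e)) t,
    fun e => cauchySolDeriv ω (vertexFun φ (src e)) (initialSlope ω (vertexFun φ (src e))
        (vertexFun φ (tgt e) - cauchyEndValue (ω ^ 2) (g e)))
      + fun x => ∫ t in (0 : ℝ)..x, cauchySecondDeriv (ω ^ 2) (g e) t,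
    vertexFun φ, fun e => ?_,
    fun e => ?_, fun e => ?_, fun w => ?_⟩
  · have h1 := isH2Rep_dirichlet ω (vertexFun φ (src e)) (vertexFun φ (tgt e)) (g e)
    rw [← hF, ← edgeMap_apply (dirichletInvDeriv ω), ← spread_apply] at h1
    exact h1
  · simp [cauchySol_zero]
  · beta_reduce
    rw [Pi.add_apply, cauchySol_one hω]
    exact sub_add_cancel _ _
  · simp only [Pi.add_apply, cauchySolDeriv_zero, cauchySolDeriv_one hω,
      intervalIntegral.integral_same, add_zero]
    have hdisc := matrixOp_translationMatrix_apply (edgeCos ω 1) φ w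
    have hsrc := vertexFun_vertexSource ω g w
    have h2 : vertexFun (matrixOp (translationMatrix (edgeCos ω 1)) φ) w
        = -vertexFun (vertexSource ω g) w := by
      rw [h]; rfl
    have h3 := sum_outgoing_slopes ω (vertexFun φ) w
    have h4 : ∀ e, initialSlope ω (vertexFun φ (src e))
        (vertexFun φ (tgt e) - cauchyEndValue (ω ^ 2) (g e))
        = (vertexFun φ (tgt e) - edgeCos ω 1 * vertexFun φ (src e)) / edgeSin ω 1
          - cauchyEndValue (ω ^ 2) (g e) / edgeSin ω 1 := fun e => by
      rw [initialSlope]; ring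
    have h5 : ∀ e, -((edgeCos ω 1 * (vertexFun φ (tgt e) - cauchyEndValue (ω ^ 2) (g e))
          - vertexFun φ (src e)) / edgeSin ω 1
          + ∫ t in (0 : ℝ)..1, cauchySecondDeriv (ω ^ 2) (g e) t)
        = -((edgeCos ω 1 * vertexFun φ (tgt e) - vertexFun φ (src e)) / edgeSin ω 1)
          - terminalFunctional ω (g e) / edgeSin ω 1 := fun e => by
      have h6 : terminalFunctional ω (g e) = edgeSin ω 1 *
          (∫ t in (0 : ℝ)..1, cauchySecondDeriv (ω ^ 2) (g e) t)
          - edgeCos ω 1 * cauchyEndValue (ω ^ 2) (g e) := rfl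
      rw [h6]
      field_simp
      ring
    simp only [h4, h5, Finset.sum_sub_distrib]
    rw [h2, hsrc] at hdisc
    rw [sub_add_sub_comm, h3, ← Finset.sum_div, ← Finset.sum_div, ← add_div, ← sub_div,
      div_eq_zero_iff]
    left
    linear_combination hdisc

/-! ### The spectrum of the Kirchhoff Laplacian -/

theorem eq_zero_of_dirichletLp_eq_zero {ω : ℂ} (hω : edgeSin ω 1 ≠ 0) {α β : ℂ}
    (h : dirichletLp ω α β = 0) : α = 0 ∧ β = 0 := by
  have h1 : Set.EqOn (cauchySol ω α (initialSlope ω α β)) 0 (Set.Icc 0 1) := by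
    refine Measure.eqOn_Icc_of_ae_eq volume zero_ne_one ?_
      (continuous_cauchySol _ _ _).continuousOn continuousOn_const
    have h3 := Lp.coeFn_zero ℂ 2 edgeMeasure
    rw [← show _ = (0 : L2Edge) from h] at h3
    filter_upwards [h3, coeFn_cauchySolLp ω α (initialSlope ω α β)] with x h4 h5
    rw [← h5]
    exact h4
  have h0 := h1 (show (0 : ℝ) ∈ Set.Icc (0 : ℝ) 1 by simp)
  have h2 := h1 (show (1 : ℝ) ∈ Set.Icc (0 : ℝ) 1 by simp)
  rw [cauchySol_zero] at h0
  rw [cauchySol_one hω] at h2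
  exact ⟨h0, h2⟩

/-- The values at the two ends of an edge, on the solutions of `-u'' = ω² u`, extend to bounded
functionals on `L²(e)`. -/
theorem exists_trace_functionals {ω : ℂ} (hω : edgeSin ω 1 ≠ 0) :
    ∃ η₀ η₁ : L2Edge →L[ℂ] ℂ, ∀ α β, η₀ (dirichletLp ω α β) = α ∧ η₁ (dirichletLp ω α β) = β := by
  let f : ℂ × ℂ →ₗ[ℂ] L2Edge :=
    { toFun := fun p => dirichletLp ω p.1 p.2
      map_add' := fun p q => dirichletLp_add ω _ _ _ _
      map_smul' := fun c p => dirichletLp_smul ω c _ _ }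
  have hf : Function.Injective f := by
    rw [← LinearMap.ker_eq_bot, LinearMap.ker_eq_bot']
    intro p hp
    obtain ⟨h1, h2⟩ := eq_zero_of_dirichletLp_eq_zero hω hp
    exact Prod.ext h1 h2
  have hsurj := SeparatingDual.dualMap_surjective_iff.2 hf
  obtain ⟨η₀, h₀⟩ := hsurj (LinearMap.fst ℂ ℂ ℂ)
  obtain ⟨η₁, h₁⟩ := hsurj (LinearMap.snd ℂ ℂ ℂ)
  exact ⟨η₀, η₁, fun α β => ⟨LinearMap.congr_fun h₀ (α, β), LinearMap.congr_fun h₁ (α, β)⟩⟩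

/-- The vertex values of an edgewise solution of `-f'' = ω² f` depend continuously on `f` in
`L²(G)`. -/
theorem exists_vertexTrace {ω : ℂ} (hω : edgeSin ω 1 ≠ 0) :
    ∃ T : L2G →L[ℂ] (Fin 5 → Lattice), ∀ (f : L2G) (φ : Vertex → ℂ),
      (f : L2loc) = vertexExtension ω φ → vertexFun (T f) = φ := by
  obtain ⟨η₀, η₁, hη⟩ := exists_trace_functionals hω
  -- Each class of vertices is represented by an end of an edge: the vertices `0`, `1`, `2`, `3`
  -- are initial vertices of the edges `0`, `3`, `6`, `7`, and `4` is the terminal vertex of `2`.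
  refine ⟨ContinuousLinearMap.pi ![edgeFunctional 0 η₀, edgeFunctional 3 η₀, edgeFunctional 6 η₀,
    edgeFunctional 7 η₀, edgeFunctional 2 η₁], fun f φ hf => ?_⟩
  have h₀ : ∀ e, η₀ (f e) = φ (src e) := fun e => by
    rw [hf]
    exact (hη _ _).1
  have h₁ : ∀ e, η₁ (f e) = φ (tgt e) := fun e => by
    rw [hf]
    exact (hη _ _).2
  funext w
  obtain ⟨p, a⟩ := w
  fin_cases a
  · exact h₀ (p, 0)
  · exact h₀ (p, 3)
  · exact h₀ (p, 6)
  · exact h₀ (p, 7)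
  · refine (h₁ (p, 2)).trans ?_
    rw [tgt, show tgtCell 2 = 0 from rfl, add_zero]
    rfl

theorem coeFn_spread_dirichletLp (ω : ℂ) (φ : Fin 5 → Lattice) :
    (spread (dirichletLp ω 1 0) (dirichletLp ω 0 1) φ : L2loc)
      = vertexExtension ω (vertexFun φ) := by
  funext e
  rw [spread_apply, vertexExtension, ← dirichletLp_eq]

theorem vertexFun_injective : Function.Injective vertexFun := fun φ φ' h => by
  funext a
  exact lp.ext (funext fun p => congrFun h (p, a))

/-- If the discrete operator is invertible, then `ω²` is not an eigenvalue of `H`. -/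
theorem eq_zero_of_mem_kirchhoffGraph {ω : ℂ} (hω : edgeSin ω 1 ≠ 0)
    {N : Matrix (Fin 5) (Fin 5) (Lattice →L[ℂ] Lattice)}
    (hN : N * translationMatrix (edgeCos ω 1) = 1) {f : L2G}
    (hf : (f, ω ^ 2 • f) ∈ kirchhoffGraph) : f = 0 := by
  obtain ⟨d, hd⟩ := hf
  have hd' : IsKirchhoff (f : L2loc) (d : L2loc) (-(ω ^ 2 • (f : L2loc))) := hd
  obtain ⟨φ, h1, h2⟩ := exists_eq_vertexExtension hω hd'
  obtain ⟨T, hT⟩ := exists_vertexTrace hω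
  have h3 := hT f φ h1
  have h4 : matrixOp (translationMatrix (edgeCos ω 1)) (T f) = 0 := by
    refine vertexFun_injective (funext fun w => ?_)
    rw [matrixOp_translationMatrix_apply, h3, h2 w, sub_self]
    rfl
  have h5 : T f = 0 := by
    rw [← matrixOp_one (T f), ← hN, matrixOp_mul, h4, map_zero]
  refine lp.ext ?_
  rw [h1, ← h3, ← coeFn_spread_dirichletLp, h5, map_zero]

/-- If `cos ω` is not an eigenvalue of any `L(k)`, then `H - ω²` has a bounded inverse. -/
theorem notMem_spectrum {ω : ℂ} (hω : edgeSin ω 1 ≠ 0)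
    (h : ¬ ∃ k ∈ brillouinZone,
      Module.End.HasEigenvalue (Matrix.toLin' (LMatrix k)) (edgeCos ω 1)) :
    ω ^ 2 ∉ unboundedSpectrum kirchhoffLaplacian := by
  obtain ⟨N, hN, hN'⟩ := exists_inverse_translationMatrix h
  let R : L2G →L[ℂ] L2G := spread (dirichletLp ω 1 0) (dirichletLp ω 0 1) ∘L matrixOp N
      ∘L (-vertexSource ω) + edgeMap (dirichletInv ω)
  have hR : ∀ y, (R y, ω ^ 2 • R y + y) ∈ kirchhoffGraph := fun y => by
    refine edgewiseSolution_mem_kirchhoffGraph (φ := matrixOp N (-vertexSource ω y)) hω ?_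
    rw [← matrixOp_mul, hN, matrixOp_one]
  rw [unboundedSpectrum, Set.mem_ofPred_eq, not_not]
  refine ⟨R, fun y => ?_, fun x => ?_⟩
  · have h1 := hR y
    rw [← graph_kirchhoffLaplacian, LinearPMap.mem_graph_iff] at h1
    obtain ⟨x, hx, hx'⟩ := h1
    dsimp only at hx hx'
    have hmem : R y ∈ kirchhoffLaplacian.domain := hx ▸ x.2
    refine ⟨hmem, ?_⟩
    have hxe : x = ⟨R y, hmem⟩ := Subtype.ext hx
    rw [← hxe, hx', add_sub_cancel_left]
  · have h1 := LinearPMap.mem_graph kirchhoffLaplacian x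
    rw [graph_kirchhoffLaplacian] at h1
    have h2 := kirchhoffGraph.sub_mem (hR (kirchhoffLaplacian x - ω ^ 2 • (x : L2G))) h1
    rw [← sub_eq_zero]
    refine eq_zero_of_mem_kirchhoffGraph hω hN' ?_
    convert h2 using 1
    rw [Prod.mk_sub_mk, Prod.mk.injEq]
    refine ⟨rfl, ?_⟩
    rw [smul_sub]
    abel

theorem IsH2Rep.volterra_eq {f d s : L2Edge} {u v : ℝ → ℂ} (h : IsH2Rep f d s u v)
    (h0 : v 0 = 0) : volterra s = d := by
  apply Lp.ext
  filter_upwards [coeFn_volterra s, h.der, ae_restrict_mem measurableSet_Icc] with x h1 h2 hx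
  rw [h1, h2, h.ftc_der x hx, h0, zero_add]

/-- The end value and the end slope can be prescribed independently, by a cubic polynomial. -/
theorem exists_cauchyEnd_eq (z X Y : ℂ) :
    ∃ γ : L2Edge, cauchyEndValue z γ = X ∧ cauchyEndSlope z γ = Y := by
  have hX : ∀ (x : ℝ) (c : ℂ) (n : ℕ), HasDerivAt (fun x : ℝ => c * (x : ℂ) ^ n)
      (c * (n * (x : ℂ) ^ (n - 1))) x := fun x c n => by
    have h := (Complex.ofRealCLM.hasDerivAt (x := x)).pow n
    simpa using h.const_mul c
  have h1 : ∀ x : ℝ, HasDerivAt (fun x : ℝ => (3 * X - Y) * (x : ℂ) ^ 2 + (Y - 2 * X) * (x : ℂ) ^ 3)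
      (2 * (3 * X - Y) * (x : ℂ) ^ 1 + 3 * (Y - 2 * X) * (x : ℂ) ^ 2) x := fun x => by
    refine ((hX x (3 * X - Y) 2).add (hX x (Y - 2 * X) 3)).congr_deriv ?_
    simp only [Nat.reduceSub]
    push_cast
    ring
  have h2 : ∀ x : ℝ, HasDerivAt
      (fun x : ℝ => 2 * (3 * X - Y) * (x : ℂ) ^ 1 + 3 * (Y - 2 * X) * (x : ℂ) ^ 2)
      (2 * (3 * X - Y) + 6 * (Y - 2 * X) * (x : ℂ)) x := fun x => by
    refine ((hX x (2 * (3 * X - Y)) 1).add (hX x (3 * (Y - 2 * X)) 2)).congr_deriv ?_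
    simp only [Nat.reduceSub]
    push_cast
    ring
  have h3 : Continuous fun x : ℝ => 2 * (3 * X - Y) + 6 * (Y - 2 * X) * (x : ℂ) := by fun_prop
  have h := isH2Rep_toEdge h1 h2 h3
    (continuous_iff_continuousAt.2 fun x => (h1 x).continuousAt).continuousOn
    (continuous_iff_continuousAt.2 fun x => (h2 x).continuousAt).continuousOn
  have hv := h.volterra_eq (by simp)
  have hone : (1 : ℝ) ∈ Set.Icc (0 : ℝ) 1 := by simp
  refine ⟨-(toEdge _ h3.continuousOn + z • volterra (volterra (toEdge _ h3.continuousOn))), ?_, ?_⟩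
  · change edgeIntegral (volterra (cauchySecondDeriv z _)) = X
    rw [cauchySecondDeriv_neg_add, hv, edgeIntegral_apply]
    rw [← sub_eq_iff_eq_add'.2 (h.ftc_val 1 hone)]
    push_cast
    ring
  · change edgeIntegral (cauchySecondDeriv z _) = Y
    rw [cauchySecondDeriv_neg_add, edgeIntegral_apply]
    rw [← sub_eq_iff_eq_add'.2 (h.ftc_der 1 hone)]
    push_cast
    ring

/-- The source is diagonal on the functions that act only on the equation at the initial vertex
(`γ₀`) and at the terminal vertex (`γ₁`) of each edge. -/
theorem vertexSource_spread {ω : ℂ} {γ₀ γ₁ : L2Edge} (h1 : cauchyEndValue (ω ^ 2) γ₀ = 1)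
    (h2 : terminalFunctional ω γ₀ = 0) (h3 : cauchyEndValue (ω ^ 2) γ₁ = 0)
    (h4 : terminalFunctional ω γ₁ = 1) (φ : Fin 5 → Lattice) :
    vertexSource ω (spread γ₀ γ₁ φ) = fun a => (deg a : ℂ) • φ a := by
  refine vertexFun_injective (funext fun w => ?_)
  rw [vertexFun_vertexSource]
  simp only [spread_apply, map_add, map_smul, h1, h2, h3, h4, smul_eq_mul, mul_one, mul_zero,
    add_zero, zero_add]
  rw [Finset.sum_congr rfl fun e he => by rw [(mem_outEdges w e).1 he],
    Finset.sum_congr (rfl : inEdges w = _) fun e he => by rw [(mem_inEdges w e).1 he],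
    Finset.sum_const, Finset.sum_const, ← add_nsmul, card_outEdges_add_card_inEdges,
    nsmul_eq_mul]
  rfl

/-- Every right side of the discrete equation comes from a function on the edges that depends
continuously on it. -/
theorem exists_rightInverse_vertexSource {ω : ℂ} (hω : edgeSin ω 1 ≠ 0) :
    ∃ G : (Fin 5 → Lattice) →L[ℂ] L2G, ∀ y, vertexSource ω (G y) = y := by
  -- the Cauchy data at `1` for which `terminalFunctional` takes the values `0` and `1`
  obtain ⟨γ₀, hX₀, hY₀⟩ := exists_cauchyEnd_eq (ω ^ 2) 1 (edgeCos ω 1 / edgeSin ω 1)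
  obtain ⟨γ₁, hX₁, hY₁⟩ := exists_cauchyEnd_eq (ω ^ 2) 0 (1 / edgeSin ω 1)
  have hterm : ∀ γ, terminalFunctional ω γ = edgeSin ω 1 * cauchyEndSlope (ω ^ 2) γ
      - edgeCos ω 1 * cauchyEndValue (ω ^ 2) γ := fun _ => rfl
  refine ⟨spread γ₀ γ₁ ∘L ContinuousLinearMap.pi
    fun a => (deg a : ℂ)⁻¹ • ContinuousLinearMap.proj a, fun y => ?_⟩
  rw [ContinuousLinearMap.comp_apply, vertexSource_spread hX₀ ?_ hX₁ ?_]
  · funext a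
    exact smul_inv_smul₀ (Nat.cast_ne_zero.2 (deg_pos a).ne') (y a)
  · rw [hterm, hX₀, hY₀]
    field_simp
    ring
  · rw [hterm, hX₁, hY₁]
    field_simp
    ring

theorem resolvent_apply_of_mem_graph {z : ℂ} {R : L2G →L[ℂ] L2G}
    (hR : ∀ x : kirchhoffLaplacian.domain, R (kirchhoffLaplacian x - z • (x : L2G)) = x)
    {f g : L2G} (h : (f, z • f + g) ∈ kirchhoffGraph) : R g = f := by
  rw [← graph_kirchhoffLaplacian, LinearPMap.mem_graph_iff] at h
  obtain ⟨x, hx, hx'⟩ := h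
  dsimp only at hx hx'
  have h1 := hR x
  rwa [hx', hx, add_sub_cancel_left] at h1

/-- If `cos ω` is an eigenvalue of `L(k)`, then `H - ω²` has no bounded inverse `R`: for approximate
solutions `φ n` of the discrete equation there is `g n → 0` such that `R (g n)` has the vertex
values `φ n`, and then `φ n → 0` as well, although its norm is bounded below. -/
theorem mem_spectrum {ω : ℂ} (hω : edgeSin ω 1 ≠ 0) {k : ℝ × ℝ}
    (h : Module.End.HasEigenvalue (Matrix.toLin' (LMatrix k)) (edgeCos ω 1)) :
    ω ^ 2 ∈ unboundedSpectrum kirchhoffLaplacian := by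
  rintro ⟨R, -, hR⟩
  obtain ⟨c', hc'⟩ := h.exists_hasEigenvector
  have hc := (mem_eigenspace_LMatrix_iff k (edgeCos ω 1) c').1 hc'.1
  set c := sqrtDegDiv c' with hcdef
  have hc0 : c ≠ 0 := fun h0 => hc'.2 (by simpa [hcdef] using h0)
  obtain ⟨a, ha⟩ := Function.ne_iff.1 hc0
  have hex := fun n : ℕ =>
    exists_approximate_eigenvector k (Nat.one_div_pos_of_nat (α := ℝ) (n := n))
  choose x hx hx' using hex
  let φ : ℕ → Fin 5 → Lattice := fun n b => c b • x n
  have hM : Filter.Tendsto (fun n => matrixOp (translationMatrix (edgeCos ω 1)) (φ n))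
      Filter.atTop (nhds 0) := tendsto_matrixOp_translationMatrix hc fun q hq =>
    squeeze_zero_norm (fun n => hx' n q hq) tendsto_one_div_add_atTop_nhds_zero_nat
  obtain ⟨G, hG⟩ := exists_rightInverse_vertexSource hω
  let g : ℕ → L2G := fun n => G (-matrixOp (translationMatrix (edgeCos ω 1)) (φ n))
  have hg : Filter.Tendsto g Filter.atTop (nhds 0) := by
    have h1 := (G.continuous.tendsto _).comp hM.neg
    rwa [neg_zero, map_zero] at h1
  have hRg : ∀ n, R (g n) = edgewiseSolution ω (φ n) (g n) := fun n =>
    resolvent_apply_of_mem_graph hR (edgewiseSolution_mem_kirchhoffGraph hω (by rw [hG, neg_neg]))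
  have hspread : Filter.Tendsto (fun n => spread (dirichletLp ω 1 0) (dirichletLp ω 0 1) (φ n))
      Filter.atTop (nhds 0) := by
    have h1 := ((R - edgeMap (dirichletInv ω)).continuous.tendsto _).comp hg
    rw [map_zero] at h1
    refine h1.congr fun n => ?_
    rw [Function.comp_apply, sub_apply, hRg, edgewiseSolution, add_sub_cancel_right]
  obtain ⟨T, hT⟩ := exists_vertexTrace hω
  have hφ : Filter.Tendsto φ Filter.atTop (nhds 0) := by
    have h1 := (T.continuous.tendsto _).comp hspread
    rw [map_zero] at h1
    refine h1.congr fun n => ?_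
    exact vertexFun_injective (hT _ _ (coeFn_spread_dirichletLp ω (φ n)))
  have h2 := (tendsto_pi_nhds.1 hφ a).norm
  simp only [φ, norm_smul, hx, mul_one, Pi.zero_apply, norm_zero] at h2
  exact ha (norm_eq_zero.1 (tendsto_nhds_unique tendsto_const_nhds h2))

theorem sq_mem_spectrum_iff (ω : ℂ) (hω : Complex.sin ω ≠ 0) :
    ω ^ 2 ∈ unboundedSpectrum kirchhoffLaplacian ↔
      ∃ k ∈ brillouinZone,
        Module.End.HasEigenvalue (Matrix.toLin' (LMatrix k)) (Complex.cos ω) := by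
  rw [← edgeCos_one]
  refine ⟨fun h => ?_, fun ⟨k, _, hk⟩ => mem_spectrum (edgeSin_one_ne_zero hω) hk⟩
  by_contra h0
  exact notMem_spectrum (edgeSin_one_ne_zero hω) h0 h

end

end QuantumGraph

theorem mainTheorem5 :
    -- correspondence of the Bloch eigenfunctions with the eigenvectors of `L(k)`
    (∀ (k : ℝ × ℝ) (ω : ℂ), Complex.sin ω ≠ 0 →
      (IsBlochEigenvalue k (ω ^ 2) ↔
        Module.End.HasEigenvalue (Matrix.toLin' (LMatrix k)) (Complex.cos ω)) ∧
      ∃ Φ : blochEigenspace k (ω ^ 2) ≃ₗ[ℂ]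
          Module.End.eigenspace (Matrix.toLin' (LMatrix k)) (Complex.cos ω),
        ∀ ψ : blochEigenspace k (ω ^ 2), ∃ φ : Vertex → ℂ,
          (φ = cyclicExtension k fun a =>
            (Φ ψ : Fin 5 → ℂ) a / ((Real.sqrt (deg a) : ℝ) : ℂ)) ∧
          ∀ e : Edge, ∀ᵐ x ∂(MeasureTheory.volume.restrict (Set.Icc (0 : ℝ) 1)),
            (ψ : L2loc) e x = φ (src e) * Complex.cos (ω * x) +
              (φ (tgt e) - Complex.cos ω * φ (src e)) / Complex.sin ω * Complex.sin (ω * x)) ∧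
    -- correspondence of the spectra
    (∀ ω : ℂ, Complex.sin ω ≠ 0 →
      (ω ^ 2 ∈ unboundedSpectrum kirchhoffLaplacian ↔
        ∃ k ∈ brillouinZone,
          Module.End.HasEigenvalue (Matrix.toLin' (LMatrix k)) (Complex.cos ω))) ∧
    -- an isolated band whose edges are attained only inside the Brillouin zone
    (∃ (n : ℕ) (a b ε : ℝ), a < b ∧ 0 < ε ∧
      bandFunction n '' brillouinZone = Set.Icc a b ∧
      (∀ t ∈ Set.Icc (a - ε) (b + ε),
        (t : ℂ) ∈ unboundedSpectrum kirchhoffLaplacian ↔ t ∈ Set.Icc a b) ∧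
      (∀ k ∈ brillouinZone,
        Module.finrank ℂ (blochEigenspace k (bandFunction n k : ℂ)) = 1 ∧
        ∀ t ∈ Set.Icc (a - ε) (b + ε), IsBlochEigenvalue k (t : ℂ) → t = bandFunction n k) ∧
      (∀ k ∈ brillouinZone, (IsBlochEigenvalue k (a : ℂ) ∨ IsBlochEigenvalue k (b : ℂ)) →
        k ∈ interior brillouinZone \ symmetryPoints)) := by
  exact ⟨fun k ω hω => ⟨isBlochEigenvalue_sq_iff_cos k hω, exists_blochEquiv k hω⟩,
    sq_mem_spectrum_iff, exists_isolated_band sq_mem_spectrum_iff⟩
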